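/- Let $T>0$, $0<\rho_0<R$, $\alpha\ge 0$. Let $\rho:[0,T]\to[\rho_0,R)$ be Lipschitz with $\rho(0)=\rho_0$ and $0\le\dot\rho(t)<1$ for a.e. $t\in[0,T]$, and put $\Omega:=\{(t,r): 0<t<T,\ 0<r<\rho(t)\}$. Let $z\in W^{1,2}(0,T)$, $h_0\in W^{1,2}(0,\rho_0)$, $h_1\in L^2(0,\rho_0)$ satisfy the compatibility conditions $h_0(0)=z(0)$ and $h_0(\rho_0)=0$ (for the continuous representatives of $z$, $h_0$). Consider the problem $$ \begin{cases} h_{tt}-h_{rr}-\frac14\Big(\alpha^2+\frac1{(R-r)^2}\Big)h=0 & 0<t<T,\ 0<r<\rho(t),\\ h(t,0)=z(t),\quad h(t,\rho(t))=0 & 0<t<T,\\ h(0,r)=h_0(r),\quad h_t(0,r)=h_1(r) & 0<r<\rho_0. \end{cases}\tag{1} $$ A solution is a function $h\in W^{1,2}(\Omega)$ such that the equation holds in the sense of distributions in $\Omega$, the boundary conditions hold in the sense of traces, and the initial conditions hold in the sense of $L^2(0,\rho_0)$ and $W^{-1,2}(0,\rho_0)$ respectively. Let $\psi(t):=t+\rho(t)$,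 and let $\omega(s):=\psi^{-1}(s)-\rho(\psi^{-1}(s))$ for $s\in[\rho_0,T+\rho(T)]$ and $\omega(s):=-\rho_0$ for $s<\rho_0$. Let $\Omega_1':=\{(t,r)\in\Omega: t\le r,\ t+r\le\rho_0\}$, $\Omega_2':=\{(t,r)\in\Omega: t>r,\ t+r<\rho_0\}$, $\Omega_3':=\{(t,r)\in\Omega: t<r,\ t+r>\rho_0\}$, $\Omega':=\Omega'_1\cup\Omega'_2\cup\Omega'_3$. Let $$C(t,r):=\{(\tau,\sigma)\in\Omega: 0\le\tau\le t,\ r-t+\tau\le\sigma\le r+t-\tau\},$$ $$P(t,r):=\begin{cases} C(t,r) & t<r,\ t+r<\rho_0,\\ C(t,r)\setminus C(t-r,0) & t>r,\ t+r<\rho_0,\\ C(t,r)\setminus C(\psi^{-1}(t+r),\rho(\psi^{-1}(t+r))) & t<r,\ t+r>\rho_0,\end{cases}$$ and, on $\Omega'$, $$A(t,r):=\begin{cases}\frac12h_0(r-t)+\frac12h_0(r+t)+\frac12\int_{r-t}^{r+t}h_1(s)\,ds & (t,r)\in\Omega'_1,\\ z(t-r)-\frac12h_0(t-r)+\frac12h_0(r+t)+\frac12\int_{t-r}^{t+r}h_1(s)\,ds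 & (t,r)\in\Omega'_2,\\ \frac12h_0(r-t)-\frac12h_0(-\omega(r+t))+\frac12\int_{r-t}^{-\omega(r+t)}h_1(s)\,ds & (t,r)\in\Omega'_3.\end{cases}$$ Then there exists a unique solution $h\in W^{1,2}(\Omega)$ of problem (1). Moreover, $h$ satisfies $$h(t,r)=A(t,r)+\frac12\iint_{P(t,r)}\frac14\Big(\alpha^2+\frac1{(R-\sigma)^2}\Big)h(\tau,\sigma)\,d\sigma\,d\tau\qquad\text{for a.e. }(t,r)\in\Omega';$$ it has a continuous representative on $\overline\Omega$, still denoted by $h$; and, setting $h\equiv0$ outside $\overline\Omega$, $$h\in C^0([0,T];W^{1,2}(0,R))\cap C^1([0,T];L^2(0,R)).$$ -/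

import Mathlib

open MeasureTheory Set Filter Topology
open scoped ENNReal NNReal ContDiff

noncomputable section

namespace Debonding

/-! Points of the plane are pairs `p = (t, r)`: time `p.1`, space `p.2`. -/

/-- `φ ∈ C_c^∞(U)`. -/
structure IsTestFun {E : Type*} [NormedAddCommGroup E] [NormedSpace ℝ E]
    (U : Set E) (φ : E → ℝ) : Prop where
  smooth : ContDiff ℝ ∞ φ
  compact : HasCompactSupport φ
  support : tsupport φ ⊆ U

/-- The derivative of `φ` in the direction `v`. -/
def dirDeriv {E : Type*} [NormedAddCommGroup E] [NormedSpace ℝ E]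
    (v : E) (φ : E → ℝ) : E → ℝ :=
  fun x => fderiv ℝ φ x v

/-- `g` is the weak (distributional) derivative of `f` on `U` in the direction `v`.  It is only
used for `f`, `g` in `L²(U)`. -/
def HasWeakDeriv {E : Type*} [NormedAddCommGroup E] [NormedSpace ℝ E] [MeasureSpace E]
    (U : Set E) (v : E) (f g : E → ℝ) : Prop :=
  ∀ φ : E → ℝ, IsTestFun U φ → ∫ x in U, f x * dirDeriv v φ x = -∫ x in U, g x * φ x

/-- `f ∈ W^{1,2}(a,b)`. -/
def MemW12Interval (a b : ℝ) (f : ℝ → ℝ) : Prop :=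
  MemLp f 2 (volume.restrict (Ioo a b)) ∧
    ∃ g : ℝ → ℝ, MemLp g 2 (volume.restrict (Ioo a b)) ∧ HasWeakDeriv (Ioo a b) 1 f g

/-- `ht` and `hr` are the weak partial derivatives of `h`, and `h, ht, hr ∈ L²(U)`: thus
`h ∈ W^{1,2}(U)` if and only if such `ht`, `hr` exist. -/
structure IsW12With (U : Set (ℝ × ℝ)) (h ht hr : ℝ × ℝ → ℝ) : Prop where
  memLp : MemLp h 2 (volume.restrict U)
  memLp_t : MemLp ht 2 (volume.restrict U)
  memLp_r : MemLp hr 2 (volume.restrict U)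
  weak_t : HasWeakDeriv U (1, 0) h ht
  weak_r : HasWeakDeriv U (0, 1) h hr

/-- The filter of `ε → 0⁺` up to null sets of `ε` (essential limits at `0⁺`). -/
def essZeroRight : Filter ℝ := 𝓝[>] (0 : ℝ) ⊓ ae (volume : Measure ℝ)

/-- `g` is the `L²(a,b)` trace of `h` on the curve `γ 0`, which is approached by the parallel curves
`γ ε` as `ε → 0⁺`: the restrictions of `h` to `γ ε` converge to `g` in `L²(a,b)`.
For `h` of class `W^{1,2}` on a region foliated by the curves `γ ε` this limit always exists, and it
is the usual trace.  As the limit is essential in `ε`, the condition depends only on the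
almost everywhere class of `h`. -/
def HasTrace (a b : ℝ) (γ : ℝ → ℝ → ℝ × ℝ) (h : ℝ × ℝ → ℝ) (g : ℝ → ℝ) : Prop :=
  Tendsto (fun ε => eLpNorm (fun s => h (γ ε s) - g s) 2 (volume.restrict (Ioo a b)))
    essZeroRight (𝓝 0)

/-- The `W^{1,2}` norm on `(a,b)` of a smooth function. -/
def w12Norm (a b : ℝ) (φ : ℝ → ℝ) : ℝ :=
  Real.sqrt ((∫ r in Ioo a b, φ r ^ 2) + ∫ r in Ioo a b, deriv φ r ^ 2)

/-- The `W^{-1,2}(a,b)` norm of `f ∈ L²(a,b)`, as the dual of `W₀^{1,2}(a,b)`. -/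
def wNegNorm (a b : ℝ) (f : ℝ → ℝ) : ℝ≥0∞ :=
  ⨆ (φ : ℝ → ℝ) (_ : IsTestFun (Ioo a b) φ) (_ : w12Norm a b φ ≤ 1),
    ENNReal.ofReal |∫ r in Ioo a b, f r * φ r|

/-- The prescribed front: `ρ ∈ C^{0,1}([0,T]; [ρ₀,R))`, `ρ(0) = ρ₀`, `0 ≤ ρ̇ < 1` a.e. -/
structure IsFront (T R ρ₀ : ℝ) (ρ : ℝ → ℝ) : Prop where
  lipschitz : ∃ K : ℝ≥0, LipschitzOnWith K ρ (Icc 0 T)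
  mapsTo : MapsTo ρ (Icc 0 T) (Ico ρ₀ R)
  initial : ρ 0 = ρ₀
  speed : ∀ᵐ t ∂(volume.restrict (Ioo 0 T)), 0 ≤ deriv ρ t ∧ deriv ρ t < 1

/-- `Ω = {(t,r) ∈ (0,T) × (0,R) : 0 < r < ρ(t)}`. -/
def Omega (T R : ℝ) (ρ : ℝ → ℝ) : Set (ℝ × ℝ) :=
  {p | p.1 ∈ Ioo 0 T ∧ p.2 ∈ Ioo 0 R ∧ 0 < p.2 ∧ p.2 < ρ p.1}

/-- The potential `¼ (α² + (R - r)⁻²)`. -/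
def potential (α R r : ℝ) : ℝ := (1 / 4) * (α ^ 2 + 1 / (R - r) ^ 2)

/-- `h ∈ W^{1,2}(Ω)` is a solution of
`h_tt - h_rr - ¼ (α² + (R - r)⁻²) h = 0` in `Ω`, in the sense of distributions,
`h(t,0) = z(t)` and `h(t,ρ(t)) = 0` in the sense of traces,
`h(0,·) = h₀` in `L²(0,ρ₀)`, and `h_t(0,·) = h₁` in `W^{-1,2}(0,ρ₀)`. -/
def IsSolution (T R ρ₀ α : ℝ) (ρ z h₀ h₁ : ℝ → ℝ) (h : ℝ × ℝ → ℝ) : Prop :=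
  ∃ ht hr : ℝ × ℝ → ℝ,
    IsW12With (Omega T R ρ) h ht hr ∧
    (∀ φ : ℝ × ℝ → ℝ, IsTestFun (Omega T R ρ) φ →
      ∫ p in Omega T R ρ, h p *
        (dirDeriv (1, 0) (dirDeriv (1, 0) φ) p - dirDeriv (0, 1) (dirDeriv (0, 1) φ) p
          - potential α R p.2 * φ p) = 0) ∧
    HasTrace 0 T (fun ε t => (t, ε)) h z ∧
    HasTrace 0 T (fun ε t => (t, ρ t - ε)) h (fun _ => 0) ∧
    HasTrace 0 ρ₀ (fun ε r => (ε, r)) h h₀ ∧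
    Tendsto (fun t => wNegNorm 0 ρ₀ (fun r => ht (t, r) - h₁ r)) essZeroRight (𝓝 0)

/-- `ψ(t) = t + ρ(t)` has the inverse `ψ⁻¹ : [ρ₀, T + ρ(T)] → [0,T]`. -/
def psiInv (T : ℝ) (ρ : ℝ → ℝ) (s : ℝ) : ℝ :=
  Function.invFunOn (fun t => t + ρ t) (Icc 0 T) s

/-- `ω = φ ∘ ψ⁻¹` on `[ρ₀, T + ρ(T)]`, where `φ(t) = t - ρ(t)`, and `ω = -ρ₀` below `ρ₀`. -/
def omega (T ρ₀ : ℝ) (ρ : ℝ → ℝ) (s : ℝ) : ℝ :=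
  if ρ₀ ≤ s then psiInv T ρ s - ρ (psiInv T ρ s) else -ρ₀

/-- `Ω'₁`. -/
def Omega1 (T R ρ₀ : ℝ) (ρ : ℝ → ℝ) : Set (ℝ × ℝ) :=
  {p ∈ Omega T R ρ | p.1 ≤ p.2 ∧ p.1 + p.2 ≤ ρ₀}

/-- `Ω'₂`. -/
def Omega2 (T R ρ₀ : ℝ) (ρ : ℝ → ℝ) : Set (ℝ × ℝ) :=
  {p ∈ Omega T R ρ | p.2 < p.1 ∧ p.1 + p.2 < ρ₀}

/-- `Ω'₃`. -/
def Omega3 (T R ρ₀ : ℝ) (ρ : ℝ → ℝ) : Set (ℝ × ℝ) :=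
  {p ∈ Omega T R ρ | p.1 < p.2 ∧ ρ₀ < p.1 + p.2}

/-- `Ω' = Ω'₁ ∪ Ω'₂ ∪ Ω'₃`. -/
def OmegaPrime (T R ρ₀ : ℝ) (ρ : ℝ → ℝ) : Set (ℝ × ℝ) :=
  Omega1 T R ρ₀ ρ ∪ Omega2 T R ρ₀ ρ ∪ Omega3 T R ρ₀ ρ

/-- The dependence cone
`C(t,r) = {(τ,σ) ∈ Ω : 0 ≤ τ ≤ t, r - t + τ ≤ σ ≤ r + t - τ}`. -/
def cone (T R : ℝ) (ρ : ℝ → ℝ) (t r : ℝ) : Set (ℝ × ℝ) :=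
  {q ∈ Omega T R ρ | 0 ≤ q.1 ∧ q.1 ≤ t ∧ r - t + q.1 ≤ q.2 ∧ q.2 ≤ r + t - q.1}

open Classical in
/-- The domain of integration `P(t,r)`; the last case is not used. -/
def regionP (T R ρ₀ : ℝ) (ρ : ℝ → ℝ) (t r : ℝ) : Set (ℝ × ℝ) :=
  if t < r ∧ t + r < ρ₀ then cone T R ρ t r
  else if r < t ∧ t + r < ρ₀ then cone T R ρ t r \ cone T R ρ (t - r) 0
  else if t < r ∧ ρ₀ < t + r then
    cone T R ρ t r \ cone T R ρ (psiInv T ρ (t + r)) (ρ (psiInv T ρ (t + r)))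
  else ∅

open Classical in
/-- The d'Alembert formula, on `Ω'`, for the undamped wave with the data `z`, `h₀`, `h₁` and with
zero boundary value on the front. -/
def dAlembert (T R ρ₀ : ℝ) (ρ z h₀ h₁ : ℝ → ℝ) (p : ℝ × ℝ) : ℝ :=
  if p ∈ Omega1 T R ρ₀ ρ then
    (1 / 2) * h₀ (p.2 - p.1) + (1 / 2) * h₀ (p.2 + p.1)
      + (1 / 2) * ∫ s in (p.2 - p.1)..(p.2 + p.1), h₁ s
  else if p ∈ Omega2 T R ρ₀ ρ then
    z (p.1 - p.2) - (1 / 2) * h₀ (p.1 - p.2) + (1 / 2) * h₀ (p.2 + p.1)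
      + (1 / 2) * ∫ s in (p.1 - p.2)..(p.1 + p.2), h₁ s
  else if p ∈ Omega3 T R ρ₀ ρ then
    (1 / 2) * h₀ (p.2 - p.1) - (1 / 2) * h₀ (-omega T ρ₀ ρ (p.2 + p.1))
      + (1 / 2) * ∫ s in (p.2 - p.1)..(-omega T ρ₀ ρ (p.2 + p.1)), h₁ s
  else 0

/-- The representation formula, almost everywhere in `Ω'`. -/
def RepresentationFormula (T R ρ₀ α : ℝ) (ρ z h₀ h₁ : ℝ → ℝ) (h : ℝ × ℝ → ℝ) : Prop :=
  ∀ᵐ p ∂(volume.restrict (OmegaPrime T R ρ₀ ρ)),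
    IntegrableOn (fun q => potential α R q.2 * h q) (regionP T R ρ₀ ρ p.1 p.2) ∧
    h p = dAlembert T R ρ₀ ρ z h₀ h₁ p
      + (1 / 2) * ∫ q in regionP T R ρ₀ ρ p.1 p.2, potential α R q.2 * h q

/-- `h ∈ C⁰([0,T]; W^{1,2}(0,R))`: the maps `t ↦ h(t,·)` and `t ↦ h_r(t,·)` (weak derivative of
`h(t,·)` on `(0,R)`) are continuous from `[0,T]` to `L²(0,R)`. -/
def InC0W12 (T R : ℝ) (h : ℝ × ℝ → ℝ) : Prop :=
  ∃ H K : ℝ → Lp ℝ 2 ((volume : Measure ℝ).restrict (Ioo 0 R)),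
    ContinuousOn H (Icc 0 T) ∧ ContinuousOn K (Icc 0 T) ∧
    ∀ t ∈ Icc 0 T,
      (H t =ᵐ[volume.restrict (Ioo 0 R)] fun r => h (t, r)) ∧
      HasWeakDeriv (Ioo 0 R) 1 (fun r => h (t, r)) (K t)

/-- `h ∈ C¹([0,T]; L²(0,R))`. -/
def InC1L2 (T R : ℝ) (h : ℝ × ℝ → ℝ) : Prop :=
  ∃ H : ℝ → Lp ℝ 2 ((volume : Measure ℝ).restrict (Ioo 0 R)),
    ContDiffOn ℝ 1 H (Icc 0 T) ∧
    ∀ t ∈ Icc 0 T, H t =ᵐ[volume.restrict (Ioo 0 R)] fun r => h (t, r)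

end Debonding

end

/-! In the characteristic coordinates `x = t - r`, `y = t + r` the equation reads `4 ∂ₓ∂_y h = V h`,
where `V` is the potential. Solutions therefore have the form `a x + b y + G x y`, where `G x y` is
the integral of `V h / 4`, cut off outside `Ω`, over the quadrant `(-∞, x] × (-∞, y]`.

Existence. The condition on `r = 0` gives `a x = z x - b x - G x x`. Since the front is strictly
slower than characteristics, the line of constant `y` meets it exactly once, at `x = κ y`
(`reflect`), and the condition there becomes `b y = b (κ y) - z (κ y) + G (κ y) (κ y) - G (κ y) y`.
As `κ y ≤ y - 2 ρ₀`, finitely many steps of this recursion reach the range where `b` is given by the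
initial data (`frontSum_eq`, `waveForm_front`). Hence `h` is a fixed point of an explicit affine map
on continuous functions on the closure of `Ω`. A point at time `t` only involves `G` at points with
`x + y ≤ 2 t`, so the map contracts in the norm weighted by `exp (-2 l t)` for large `l`
(`exists_waveMap_fixedPoint`).

Regularity. The profiles `a`, `b` are of class `W^{1,2}` because the reflection is nondecreasing and
1-Lipschitz. `G` is `C¹` because a characteristic line meets the boundary of `Ω`, where the source
may jump, in a null set. The first derivatives of the wave are thus translates of fixed `L²`
functions plus continuous terms, so they depend continuously on time in `L²`. The wave vanishes on
the front, so its extension by zero has no jump (`indicator_sub_space`, `indicator_sub_time`).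
Eliminating `a` or `b` by means of the boundary conditions gives the representation formula: the
quadrants, intersected with `Ω`, are the dependence cones.

Uniqueness. The difference `W` of two solutions has zero data and remains a weak solution when
extended by zero to negative times (`weak_eq_extend`). It satisfies an almost everywhere
parallelogram identity: the alternating sum of `W` over the corners of a characteristic
parallelogram is a double integral of `V W` (`ae_parallelogram_identity`). If `W = 0` before `t₁`,
parallelograms of side `δ` reach back into that region. Near the lateral boundaries a corner is
placed in a thin layer instead, where the mean of `|W|` tends to zero by the trace condition
(`ae_eq_zero_of_layer`). Then `|W|` is bounded by the double integral up to time `t₁ + δ`, and an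
`L¹` contraction makes it vanish there (`vanishing_slab`). Steps of length `δ` exhaust the domain.
-/

noncomputable section

namespace Debonding

set_option linter.unusedSectionVars false

/-! ### Weak derivatives and weak wave equations as finite differences along segments. -/

section Translation

variable {E : Type*} [NormedAddCommGroup E] [NormedSpace ℝ E] [FiniteDimensional ℝ E]
  [MeasureSpace E] [BorelSpace E] [(volume : Measure E).IsAddHaarMeasure]

lemma IsTestFun.continuous {U : Set E} {φ : E → ℝ} (h : IsTestFun U φ) : Continuous φ :=
  h.smooth.continuous

lemma IsTestFun.dirDeriv {U : Set E} {φ : E → ℝ} (h : IsTestFun U φ) (v : E) :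
    IsTestFun U (dirDeriv v φ) where
  smooth := by
    unfold Debonding.dirDeriv
    exact (h.smooth.fderiv_right (m := ∞) (by simp)).clm_apply contDiff_const
  compact := h.compact.fderiv_apply (𝕜 := ℝ) v
  support := (tsupport_fderiv_apply_subset ℝ v).trans h.support

lemma tsupport_comp_add_right (φ : E → ℝ) (v : E) :
    tsupport (fun x => φ (x + v)) = (fun x => x + v) ⁻¹' tsupport φ := by
  have := (Homeomorph.addRight v).preimage_closure (Function.support φ)
  simp only [tsupport]
  exact this.symm

lemma IsTestFun.translate {U V : Set E} {φ : E → ℝ} (h : IsTestFun V φ) (v : E)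
    (hv : ∀ x ∈ V, x - v ∈ U) : IsTestFun U (fun x => φ (x + v)) where
  smooth := h.smooth.comp (contDiff_id.add contDiff_const)
  compact := h.compact.comp_homeomorph (Homeomorph.addRight v)
  support := by
    rw [tsupport_comp_add_right]
    intro x hx
    simpa using hv _ (h.support hx)

lemma IsTestFun.bounded {U : Set E} {φ : E → ℝ} (h : IsTestFun U φ) :
    ∃ C, 0 ≤ C ∧ ∀ x, ‖φ x‖ ≤ C := by
  obtain ⟨C, hC⟩ := h.compact.exists_bound_of_continuous h.continuous
  exact ⟨C, (norm_nonneg _).trans (hC 0), hC⟩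

lemma dirDeriv_translate (φ : E → ℝ) (v w : E) :
    dirDeriv v (fun x => φ (x + w)) = fun x => dirDeriv v φ (x + w) := by
  ext x
  simp [dirDeriv, fderiv_comp_add_right]

lemma integrable_mul_translate {f φ : E → ℝ} {U : Set E} (hf : Integrable f) (h : IsTestFun U φ)
    (w : E) : Integrable (fun x => f x * φ (x + w)) := by
  obtain ⟨C, -, hC⟩ := h.bounded
  exact hf.mul_bdd (c := C) (h.continuous.comp (by fun_prop)).aestronglyMeasurable
    (Eventually.of_forall fun x => hC _)

lemma continuous_integral_mul_translate {f φ : E → ℝ} {U : Set E} (hf : Integrable f)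
    (h : IsTestFun U φ) : Continuous (fun w => ∫ x, f x * φ (x + w)) := by
  obtain ⟨C, -, hC⟩ := h.bounded
  refine continuous_of_dominated (bound := fun x => ‖f x‖ * C)
    (fun w => (integrable_mul_translate hf h w).aestronglyMeasurable)
    (fun w => Eventually.of_forall fun x => ?_) (hf.norm.mul_const C)
    (Eventually.of_forall fun x => continuous_const.mul (h.continuous.comp (by fun_prop)))
  rw [norm_mul]
  exact mul_le_mul_of_nonneg_left (hC _) (norm_nonneg _)

lemma hasDerivAt_integral_mul_translate {f φ : E → ℝ} {U : Set E} (hf : Integrable f)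
    (h : IsTestFun U φ) (v w : E) (s : ℝ) :
    HasDerivAt (fun s : ℝ => ∫ x, f x * φ (x + s • v + w))
      (∫ x, f x * dirDeriv v φ (x + s • v + w)) s := by
  obtain ⟨C, -, hC⟩ := (h.dirDeriv v).bounded
  have key : ∀ (x : E) (s : ℝ), HasDerivAt (fun s : ℝ => f x * φ (x + s • v + w))
      (f x * dirDeriv v φ (x + s • v + w)) s := by
    intro x s
    refine HasDerivAt.const_mul _ ?_
    have h1 : HasDerivAt (fun s : ℝ => x + s • v + w) v s := by
      simpa using (((hasDerivAt_id s).smul_const v).const_add x).add_const w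
    exact ((h.smooth.differentiable (by simp)) _).hasFDerivAt.comp_hasDerivAt s h1
  refine (hasDerivAt_integral_of_dominated_loc_of_deriv_le (bound := fun x => ‖f x‖ * C)
    (F' := fun s x => f x * dirDeriv v φ (x + s • v + w))
    (Filter.univ_mem) (Eventually.of_forall fun s => ?_) ?_ ?_
    (Eventually.of_forall fun x s _ => ?_) (hf.norm.mul_const C)
    (Eventually.of_forall fun x s _ => key x s)).2
  · simpa [add_assoc] using (integrable_mul_translate hf h (s • v + w)).aestronglyMeasurable
  · simpa [add_assoc] using (integrable_mul_translate hf h (s • v + w))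
  · simpa [add_assoc] using
      (integrable_mul_translate hf (h.dirDeriv v) (s • v + w)).aestronglyMeasurable
  · rw [norm_mul]
    exact mul_le_mul_of_nonneg_left (hC _) (norm_nonneg _)

/-- The translation acts on the smooth factor, so the fundamental theorem of calculus applies
although `f` is merely integrable. -/
lemma integral_mul_translate_sub {f φ : E → ℝ} {U : Set E} (hf : Integrable f)
    (h : IsTestFun U φ) (v w : E) (s : ℝ) :
    (∫ x, f x * φ (x + s • v + w)) - ∫ x, f x * φ (x + w) =
      ∫ τ in (0 : ℝ)..s, ∫ x, f x * dirDeriv v φ (x + τ • v + w) := by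
  rw [intervalIntegral.integral_eq_sub_of_hasDerivAt
    (fun τ _ => hasDerivAt_integral_mul_translate hf h v w τ)]
  · simp
  · refine Continuous.intervalIntegrable ?_ _ _
    have := (continuous_integral_mul_translate hf (h.dirDeriv v)).comp
      (by fun_prop : Continuous fun τ : ℝ => τ • v + w)
    simpa [Function.comp_def, add_assoc] using this

/-- The average of `f` over the segment from `x` to `x - s v`, times `s`. -/
def lineInt (s : ℝ) (v : E) (f : E → ℝ) (x : E) : ℝ := ∫ τ in (0 : ℝ)..s, f (x - τ • v)

lemma integral_mul_translate (f φ : E → ℝ) (w : E) :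
    ∫ x, f x * φ (x + w) = ∫ x, f (x - w) * φ x := by
  have := integral_sub_right_eq_self (μ := (volume : Measure E)) (fun x => f x * φ (x + w)) w
  rw [← this]; simp

/-- The shear `(τ, x) ↦ (τ, x - τ • v)` preserves the product measure, so the composition is
integrable although `f` is measurable only up to a null set. -/
lemma integrable_uncurry_translate {f : E → ℝ} (hf : Integrable f) (s : ℝ) (v : E) :
    Integrable (fun p : E × ℝ => f (p.1 - p.2 • v)) (volume.prod (volume.restrict (Ioc 0 s))) := by
  have hm : MeasurePreserving (fun p : ℝ × E => (p.1, p.2 - p.1 • v))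
      ((volume.restrict (Ioc 0 s)).prod volume) ((volume.restrict (Ioc 0 s)).prod volume) := by
    refine MeasurePreserving.skew_product (f := id) (g := fun τ x => x - τ • v)
      (MeasurePreserving.id _) (by fun_prop) ?_
    exact Eventually.of_forall fun τ => (measurePreserving_sub_right volume (τ • v)).map_eq
  have h2 : Integrable (fun p : ℝ × E => f p.2) ((volume.restrict (Ioc 0 s)).prod volume) :=
    hf.comp_snd _
  have h3 := hm.integrable_comp_of_integrable h2
  exact h3.swap

lemma integrable_lineInt {f : E → ℝ} (hf : Integrable f) {s : ℝ} (hs : 0 ≤ s) (v : E) :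
    Integrable (lineInt s v f) := by
  have := (integrable_uncurry_translate hf s v).integral_prod_left
  exact this.congr (ae_of_all _ fun x => by simp [lineInt, intervalIntegral.integral_of_le hs])

lemma integral_lineInt_mul {f φ : E → ℝ} {U : Set E} (hf : Integrable f) (h : IsTestFun U φ)
    {s : ℝ} (hs : 0 ≤ s) (v w : E) :
    ∫ τ in (0 : ℝ)..s, ∫ x, f x * φ (x + τ • v + w) = ∫ x, lineInt s v f x * φ (x + w) := by
  obtain ⟨C, -, hC⟩ := h.bounded
  have h1 : ∀ τ : ℝ, ∫ x, f x * φ (x + τ • v + w) = ∫ x, f (x - τ • v) * φ (x + w) := by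
    intro τ
    rw [← integral_mul_translate f (fun x => φ (x + w)) (τ • v)]
  simp_rw [h1, lineInt, intervalIntegral.integral_of_le hs, ← integral_mul_const]
  have := (integrable_uncurry_translate hf s v).mul_bdd (c := C)
    (g := fun p : E × ℝ => φ (p.1 + w))
    (h.continuous.comp (by fun_prop)).aestronglyMeasurable (Eventually.of_forall fun x => hC _)
  exact (integral_integral_swap this).symm

lemma setIntegral_mul_eq_indicator {U : Set E} (hU : IsOpen U) (f ψ : E → ℝ) :
    ∫ x in U, f x * ψ x = ∫ x, U.indicator f x * ψ x := by
  rw [← integral_indicator hU.measurableSet]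
  congr 1
  ext x
  by_cases hx : x ∈ U <;> simp [hx]

/-- A weak derivative is a difference quotient in integrated form, almost everywhere. -/
theorem HasWeakDeriv.ae_sub_eq_lineInt {U V : Set E} (hU : IsOpen U) (hV : IsOpen V)
    {f g : E → ℝ} {v : E} (hf : IntegrableOn f U) (hg : IntegrableOn g U)
    (h : HasWeakDeriv U v f g) {s : ℝ} (hs : 0 ≤ s)
    (hVU : ∀ x ∈ V, ∀ τ ∈ Icc 0 s, x - τ • v ∈ U) :
    ∀ᵐ x, x ∈ V → f x - f (x - s • v) = lineInt s v g x := by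
  have hf' : Integrable (U.indicator f) := hf.integrable_indicator hU.measurableSet
  have hg' : Integrable (U.indicator g) := hg.integrable_indicator hU.measurableSet
  have h1 : Integrable (fun x => U.indicator f (x - s • v)) := hf'.comp_sub_right _
  have h2 := integrable_lineInt hg' hs v
  have key : ∀ᵐ x, x ∈ V →
      (U.indicator f x - U.indicator f (x - s • v)) - lineInt s v (U.indicator g) x = 0 := by
    -- It suffices to test with `φ` supported in `V`. The translates of `φ` by `τ ∈ [0, s]` are then
    -- admissible in `U`, and the weak identity is integrated over `τ`.
    refine hV.ae_eq_zero_of_integral_contDiff_smul_eq_zero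
      (((hf'.sub h1).sub h2).locallyIntegrable.locallyIntegrableOn V) ?_
    intro φ hφ1 hφ2 hφ3
    have hφ : IsTestFun V φ := ⟨hφ1, hφ2, hφ3⟩
    have e1 := integral_mul_translate_sub hf' hφ v 0 s
    have e2 : ∀ τ ∈ uIcc 0 s, ∫ x, U.indicator f x * dirDeriv v φ (x + τ • v + 0) =
        -∫ x, U.indicator g x * φ (x + τ • v + 0) := by
      intro τ hτ
      rw [uIcc_of_le hs] at hτ
      have ht : IsTestFun U (fun x => φ (x + τ • v)) :=
        hφ.translate (τ • v) (fun x hx => hVU x hx τ hτ)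
      have := h _ ht
      rw [dirDeriv_translate, setIntegral_mul_eq_indicator hU,
        setIntegral_mul_eq_indicator hU] at this
      simpa using this
    rw [intervalIntegral.integral_congr e2, intervalIntegral.integral_neg,
      integral_lineInt_mul hg' hφ hs] at e1
    simp only [add_zero] at e1
    rw [integral_mul_translate] at e1
    have i1 := integrable_mul_translate hf' hφ 0
    have i2 := integrable_mul_translate h1 hφ 0
    have i3 := integrable_mul_translate h2 hφ 0
    simp only [add_zero] at i1 i2 i3
    have e3 : ∀ x, φ x • (U.indicator f x - U.indicator f (x - s • v)
        - lineInt s v (U.indicator g) x) = (U.indicator f x * φ x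
          - U.indicator f (x - s • v) * φ x) - lineInt s v (U.indicator g) x * φ x := by
      intro x; simp only [smul_eq_mul]; ring
    simp only [e3]
    have i12 : Integrable (fun x => U.indicator f x * φ x - U.indicator f (x - s • v) * φ x) :=
      i1.sub i2
    rw [integral_sub i12 i3, integral_sub i1 i2]
    linarith
  filter_upwards [key] with x hx hxV
  have := hx hxV
  have m0 := hVU x hxV 0 ⟨le_rfl, hs⟩
  have m1 := hVU x hxV s ⟨hs, le_rfl⟩
  simp only [zero_smul, sub_zero] at m0
  rw [indicator_of_mem m0, indicator_of_mem m1] at this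
  have e : lineInt s v (U.indicator g) x = lineInt s v g x := by
    refine intervalIntegral.integral_congr fun τ hτ => ?_
    rw [uIcc_of_le hs] at hτ
    exact indicator_of_mem (hVU x hxV τ hτ) _
  linarith

/-- A weak solution of `∂_u ∂_v f = g` satisfies the parallelogram identity. -/
theorem ae_parallelogram_identity {U V : Set E} (hU : IsOpen U) (hV : IsOpen V)
    {f g : E → ℝ} {u v : E} (hf : IntegrableOn f U) (hg : IntegrableOn g U)
    (h : ∀ φ, IsTestFun U φ → ∫ x in U, f x * dirDeriv u (dirDeriv v φ) x = ∫ x in U, g x * φ x)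
    {s s' : ℝ} (hs : 0 ≤ s) (hs' : 0 ≤ s')
    (hVU : ∀ x ∈ V, ∀ τ ∈ Icc 0 s, ∀ τ' ∈ Icc 0 s', x - τ • v - τ' • u ∈ U) :
    ∀ᵐ x, x ∈ V → f x - f (x - s • v) - f (x - s' • u) + f (x - s • v - s' • u) =
      lineInt s v (lineInt s' u (U.indicator g)) x := by
  set f' := U.indicator f with hf'def
  have hf' : Integrable f' := hf.integrable_indicator hU.measurableSet
  have hg' : Integrable (U.indicator g) := hg.integrable_indicator hU.measurableSet
  have h1 : Integrable (fun x => f' (x - s • v)) := hf'.comp_sub_right _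
  have h2 : Integrable (fun x => f' (x - s' • u)) := hf'.comp_sub_right _
  have h3 : Integrable (fun x => f' (x - s • v - s' • u)) := h2.comp_sub_right (s • v)
  have h4' := integrable_lineInt hg' hs' u
  have h4 := integrable_lineInt h4' hs v
  have key : ∀ᵐ x, x ∈ V → (f' x - f' (x - s • v) - f' (x - s' • u) + f' (x - s • v - s' • u))
      - lineInt s v (lineInt s' u (U.indicator g)) x = 0 := by
    refine hV.ae_eq_zero_of_integral_contDiff_smul_eq_zero
      (((((hf'.sub h1).sub h2).add h3).sub h4).locallyIntegrable.locallyIntegrableOn V) ?_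
    intro φ hφ1 hφ2 hφ3
    have hφ : IsTestFun V φ := ⟨hφ1, hφ2, hφ3⟩
    have hd := hφ.dirDeriv v
    -- The second difference is the difference of two `v`-differences, based at `0` and at `s' • u`.
    -- The `u`-difference that remains falls on `dirDeriv v φ`, where the equation applies.
    have e0 := integral_mul_translate_sub hf' hφ v 0 s
    have e1 := integral_mul_translate_sub hf' hφ v (s' • u) s
    have e2 : ∀ τ ∈ uIcc 0 s, (∫ x, f' x * dirDeriv v φ (x + τ • v + s' • u)) -
        ∫ x, f' x * dirDeriv v φ (x + τ • v + 0) =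
        ∫ x, lineInt s' u (U.indicator g) x * φ (x + τ • v + 0) := by
      intro τ hτ
      rw [uIcc_of_le hs] at hτ
      have e3 := integral_mul_translate_sub hf' hd u (τ • v) s'
      have e4 : ∀ τ' ∈ uIcc 0 s', ∫ x, f' x * dirDeriv u (dirDeriv v φ) (x + τ' • u + τ • v) =
          ∫ x, U.indicator g x * φ (x + τ' • u + τ • v) := by
        intro τ' hτ'
        rw [uIcc_of_le hs'] at hτ'
        have ht : IsTestFun U (fun x => φ (x + (τ' • u + τ • v))) := by
          refine hφ.translate _ (fun x hx => ?_)
          have := hVU x hx τ hτ τ' hτ'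
          rwa [sub_sub, add_comm] at this
        have := h _ ht
        rw [dirDeriv_translate, dirDeriv_translate, setIntegral_mul_eq_indicator hU,
          setIntegral_mul_eq_indicator hU] at this
        simpa only [add_assoc] using this
      rw [intervalIntegral.integral_congr e4, integral_lineInt_mul hg' hφ hs'] at e3
      simpa [add_right_comm] using e3
    have cont : ∀ w : E, IntervalIntegrable
        (fun τ : ℝ => ∫ x, f' x * dirDeriv v φ (x + τ • v + w)) volume 0 s := by
      intro w
      refine Continuous.intervalIntegrable ?_ _ _
      have := (continuous_integral_mul_translate hf' hd).comp
        (by fun_prop : Continuous fun τ : ℝ => τ • v + w)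
      simpa [Function.comp_def, add_assoc] using this
    have e5 := intervalIntegral.integral_sub (cont (s' • u)) (cont 0)
    rw [intervalIntegral.integral_congr e2, integral_lineInt_mul h4' hφ hs, ← e0, ← e1] at e5
    simp only [add_zero] at e5
    have r1 := integral_mul_translate f' φ (s • v)
    have r2 := integral_mul_translate f' φ (s' • u)
    have r3 := integral_mul_translate f' φ (s • v + s' • u)
    simp only [← add_assoc, ← sub_sub] at r3
    rw [r1, r2, r3] at e5
    have i0 := integrable_mul_translate hf' hφ 0
    have i1 := integrable_mul_translate h1 hφ 0
    have i2 := integrable_mul_translate h2 hφ 0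
    have i3 := integrable_mul_translate h3 hφ 0
    have i4 := integrable_mul_translate h4 hφ 0
    simp only [add_zero] at i0 i1 i2 i3 i4
    have e3 : ∀ x, φ x • ((f' x - f' (x - s • v) - f' (x - s' • u) + f' (x - s • v - s' • u))
      - lineInt s v (lineInt s' u (U.indicator g)) x) = (((f' x * φ x - f' (x - s • v) * φ x)
        - f' (x - s' • u) * φ x) + f' (x - s • v - s' • u) * φ x)
          - lineInt s v (lineInt s' u (U.indicator g)) x * φ x := by
      intro x; simp only [smul_eq_mul]; ring
    simp only [e3]
    have j1 : Integrable (fun x => f' x * φ x - f' (x - s • v) * φ x) := i0.sub i1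
    have j2 : Integrable (fun x => f' x * φ x - f' (x - s • v) * φ x
      - f' (x - s' • u) * φ x) := j1.sub i2
    have j3 : Integrable (fun x => f' x * φ x - f' (x - s • v) * φ x
      - f' (x - s' • u) * φ x + f' (x - s • v - s' • u) * φ x) := j2.add i3
    rw [integral_sub j3 i4, integral_add j2 i3, integral_sub j1 i2, integral_sub i0 i1]
    linarith
  filter_upwards [key] with x hx hxV
  have := hx hxV
  have m0 := hVU x hxV 0 ⟨le_rfl, hs⟩ 0 ⟨le_rfl, hs'⟩
  have m1 := hVU x hxV s ⟨hs, le_rfl⟩ 0 ⟨le_rfl, hs'⟩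
  have m2 := hVU x hxV 0 ⟨le_rfl, hs⟩ s' ⟨hs', le_rfl⟩
  have m3 := hVU x hxV s ⟨hs, le_rfl⟩ s' ⟨hs', le_rfl⟩
  simp only [zero_smul, sub_zero] at m0 m1 m2
  rw [hf'def, indicator_of_mem m0, indicator_of_mem m1, indicator_of_mem m2,
    indicator_of_mem m3] at this
  linarith

/-- A function which is a primitive along the segments in `U` of direction `v` has a weak
derivative. -/
theorem hasWeakDeriv_of_sub_eq_lineInt {U : Set E} (hU : IsOpen U) {f g : E → ℝ} {v : E}
    (hf : IntegrableOn f U) (hg : IntegrableOn g U)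
    (h : ∀ x, ∀ s, 0 < s → (∀ τ ∈ Icc 0 s, x - τ • v ∈ U) →
      f x - f (x - s • v) = lineInt s v g x) :
    HasWeakDeriv U v f g := by
  intro φ hφ
  have hf' : Integrable (U.indicator f) := hf.integrable_indicator hU.measurableSet
  have hg' : Integrable (U.indicator g) := hg.integrable_indicator hU.measurableSet
  rw [setIntegral_mul_eq_indicator hU, setIntegral_mul_eq_indicator hU]
  obtain ⟨δ, hδ, hδU⟩ := hφ.compact.exists_cthickening_subset_open hU hφ.support
  -- `J'(0)` is computed twice: by differentiating `φ`, and by moving the translation onto `f`. The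
  -- hypothesis concerns `s > 0` only, which yields a right derivative; this suffices because `J` is
  -- differentiable.
  set J : ℝ → ℝ := fun s => ∫ x, U.indicator f x * φ (x + s • v + 0) with hJ
  set m : ℝ → ℝ := fun s => ∫ x, U.indicator g x * φ (x + s • v + 0) with hm
  have hmc : Continuous m := by
    have := (continuous_integral_mul_translate hg' hφ).comp
      (by fun_prop : Continuous fun τ : ℝ => τ • v + 0)
    simpa [Function.comp_def, add_assoc, hm] using this
  have d1 : HasDerivAt J (∫ x, U.indicator f x * dirDeriv v φ (x + (0 : ℝ) • v + 0)) 0 :=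
    hasDerivAt_integral_mul_translate hf' hφ v 0 0
  have hsmall : ∀ᶠ s in 𝓝[>] (0 : ℝ), J s = J 0 - ∫ τ in (0 : ℝ)..s, m τ := by
    have hsv : ∀ᶠ s : ℝ in 𝓝[>] (0 : ℝ), ‖s • v‖ < δ := by
      have : Tendsto (fun s : ℝ => ‖s • v‖) (𝓝 0) (𝓝 0) := by
        have : Continuous (fun s : ℝ => ‖s • v‖) := by fun_prop
        simpa using this.tendsto 0
      exact (this.eventually_lt_const hδ).filter_mono nhdsWithin_le_nhds
    filter_upwards [hsv, self_mem_nhdsWithin] with s hsv hs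
    have hs : 0 < s := hs
    rw [hm, integral_lineInt_mul hg' hφ hs.le, hJ]
    simp only [add_zero, zero_smul]
    rw [integral_mul_translate]
    have i1 := integrable_mul_translate (hf'.comp_sub_right (s • v)) hφ 0
    have i2 := integrable_mul_translate (integrable_lineInt hg' hs.le v) hφ 0
    have i3 := integrable_mul_translate hf' hφ 0
    simp only [add_zero] at i1 i2 i3
    rw [← integral_sub i3 i2]
    congr 1
    ext x
    by_cases hx : φ x = 0
    · simp [hx]
    have hxK : x ∈ tsupport φ := subset_tsupport _ hx
    have hseg : ∀ τ ∈ Icc 0 s, x - τ • v ∈ U := by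
      intro τ hτ
      refine hδU (Metric.mem_cthickening_of_dist_le _ x δ _ hxK ?_)
      rw [dist_eq_norm, sub_sub_cancel_left, norm_neg]
      refine le_trans ?_ hsv.le
      rw [norm_smul, norm_smul]
      gcongr
      rw [Real.norm_of_nonneg hτ.1, Real.norm_of_nonneg hs.le]
      exact hτ.2
    have e : lineInt s v (U.indicator g) x = lineInt s v g x := by
      refine intervalIntegral.integral_congr fun τ hτ => ?_
      rw [uIcc_of_le hs.le] at hτ
      exact indicator_of_mem (hseg τ hτ) _
    have m0 := hseg 0 ⟨le_rfl, hs.le⟩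
    simp only [zero_smul, sub_zero] at m0
    rw [e, ← h x s hs hseg, indicator_of_mem m0, indicator_of_mem (hseg s ⟨hs.le, le_rfl⟩)]
    ring
  have d2 : HasDerivWithinAt (fun s => J 0 - ∫ τ in (0 : ℝ)..s, m τ) (-m 0) (Ioi 0) 0 := by
    have := (intervalIntegral.integral_hasDerivAt_right (hmc.intervalIntegrable 0 0)
      hmc.stronglyMeasurable.stronglyMeasurableAtFilter hmc.continuousAt).const_sub (J 0)
    exact this.hasDerivWithinAt
  have d3 : HasDerivWithinAt J (-m 0) (Ioi 0) 0 :=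
    d2.congr_of_eventuallyEq hsmall (by simp)
  have := (uniqueDiffWithinAt_Ioi (0 : ℝ)).eq_deriv _ d1.hasDerivWithinAt d3
  simpa [hm] using this

end Translation

end Debonding

namespace Debonding

/-! ### Functions of class `W^{1,2}` on the line, through a control function. -/

section SobolevLine

/-- `f` belongs to `W^{1,2}` of every bounded interval, expressed by a control function for the
difference quotients. -/
def IsH1 (f : ℝ → ℝ) : Prop :=
  ∃ Γ : ℝ → ℝ, Monotone Γ ∧ Continuous Γ ∧
    ∀ x y, x ≤ y → (f y - f x) ^ 2 ≤ (y - x) * (Γ y - Γ x)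

lemma IsH1.add {f g : ℝ → ℝ} (hf : IsH1 f) (hg : IsH1 g) : IsH1 (fun x => f x + g x) := by
  obtain ⟨Γ, h1, h2, h3⟩ := hf
  obtain ⟨Δ, k1, k2, k3⟩ := hg
  refine ⟨fun x => 2 * Γ x + 2 * Δ x, ?_, by fun_prop, fun x y hxy => ?_⟩
  · exact (h1.const_mul (by norm_num)).add (k1.const_mul (by norm_num))
  · nlinarith [h3 x y hxy, k3 x y hxy, sq_nonneg ((f y - f x) - (g y - g x))]

lemma IsH1.const_mul {f : ℝ → ℝ} (hf : IsH1 f) (c : ℝ) : IsH1 (fun x => c * f x) := by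
  obtain ⟨Γ, h1, h2, h3⟩ := hf
  refine ⟨fun x => c ^ 2 * Γ x, h1.const_mul (sq_nonneg c), by fun_prop, fun x y hxy => ?_⟩
  have := mul_le_mul_of_nonneg_left (h3 x y hxy) (sq_nonneg c)
  nlinarith

lemma IsH1.neg {f : ℝ → ℝ} (hf : IsH1 f) : IsH1 (fun x => -f x) := by
  simpa using hf.const_mul (-1)

lemma IsH1.sub {f g : ℝ → ℝ} (hf : IsH1 f) (hg : IsH1 g) : IsH1 (fun x => f x - g x) := by
  simpa [sub_eq_add_neg] using hf.add hg.neg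

/-- The control inequality passes through `w` with control function `Γ ∘ w`. This replaces the chain
rule for reflected profiles, where `w` may be constant on intervals. -/
lemma IsH1.comp {f w : ℝ → ℝ} (hf : IsH1 f) (hw : Monotone w)
    (hw1 : ∀ x y, x ≤ y → w y - w x ≤ y - x) : IsH1 (fun x => f (w x)) := by
  obtain ⟨Γ, h1, h2, h3⟩ := hf
  have hwc : Continuous w := by
    refine (LipschitzWith.of_le_add_mul 1 (f := w) fun x y => ?_).continuous
    rw [NNReal.coe_one, one_mul, Real.dist_eq]
    rcases le_total x y with h | h
    · linarith [hw h, abs_nonneg (x - y)]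
    · linarith [hw1 y x h, le_abs_self (x - y)]
  refine ⟨fun x => Γ (w x), h1.comp hw, by fun_prop, fun x y hxy => ?_⟩
  exact (h3 _ _ (hw hxy)).trans
    (mul_le_mul_of_nonneg_right (hw1 x y hxy) (sub_nonneg.2 (h1 (hw hxy))))

/-- Reflection. -/
lemma IsH1.comp_neg {f : ℝ → ℝ} (hf : IsH1 f) : IsH1 (fun x => f (-x)) := by
  obtain ⟨Γ, h1, h2, h3⟩ := hf
  refine ⟨fun x => -Γ (-x), fun x y hxy => neg_le_neg (h1 (neg_le_neg hxy)), by fun_prop,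
    fun x y hxy => ?_⟩
  have := h3 (-y) (-x) (neg_le_neg hxy)
  nlinarith

lemma IsH1.of_lipschitz {f : ℝ → ℝ} (L : ℝ) (h : ∀ x y, x ≤ y → |f y - f x| ≤ L * (y - x)) :
    IsH1 f := by
  refine ⟨fun x => L ^ 2 * x, fun x y hxy => by
    simpa using mul_le_mul_of_nonneg_left hxy (sq_nonneg L), by fun_prop, fun x y hxy => ?_⟩
  have h1 := h x y hxy
  have h2 : (f y - f x) ^ 2 ≤ (L * (y - x)) ^ 2 := by
    rw [← sq_abs]; gcongr
  nlinarith

lemma IsH1.const (c : ℝ) : IsH1 (fun _ => c) :=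
  IsH1.of_lipschitz 0 fun x y _ => by simp

lemma IsH1.continuous {f : ℝ → ℝ} (hf : IsH1 f) : Continuous f := by
  obtain ⟨Γ, h1, h2, h3⟩ := hf
  have key : ∀ x y, |f y - f x| ≤ Real.sqrt (|y - x| * |Γ y - Γ x|) := by
    intro x y
    apply Real.abs_le_sqrt
    rcases le_total x y with h | h
    · rw [abs_of_nonneg (sub_nonneg.2 h), abs_of_nonneg (sub_nonneg.2 (h1 h))]
      exact h3 x y h
    · rw [abs_of_nonpos (sub_nonpos.2 h), abs_of_nonpos (sub_nonpos.2 (h1 h))]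
      have := h3 y x h
      nlinarith
  rw [continuous_iff_continuousAt]
  intro x
  rw [ContinuousAt, tendsto_iff_dist_tendsto_zero]
  have hc : Continuous fun y => Real.sqrt (|y - x| * |Γ y - Γ x|) := by fun_prop
  have := hc.tendsto x
  simp only [sub_self, abs_zero, mul_zero, Real.sqrt_zero] at this
  exact squeeze_zero (fun _ => dist_nonneg) (fun y => by rw [Real.dist_eq]; exact key x y) this

/-- The increments of `Γ` are the masses of disjoint intervals under its Stieltjes measure. -/
lemma sum_sub_le_of_disjoint {Γ : ℝ → ℝ} (h1 : Monotone Γ) (h2 : Continuous Γ) {a b : ℝ}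
    (hab : a ≤ b) {n : ℕ} {I : ℕ → ℝ × ℝ}
    (hI : (n, I) ∈ AbsolutelyContinuousOnInterval.disjWithin a b) :
    ∑ i ∈ Finset.range n, |Γ (I i).2 - Γ (I i).1| ≤ Γ b - Γ a := by
  let S : StieltjesFunction ℝ := ⟨Γ, h1, fun x => h2.continuousWithinAt⟩
  have e : ∀ i, S.measure (uIoc (I i).1 (I i).2) = ENNReal.ofReal |Γ (I i).2 - Γ (I i).1| := by
    intro i
    rcases le_total (I i).1 (I i).2 with h | h
    · rw [uIoc_of_le h, S.measure_Ioc, abs_of_nonneg (sub_nonneg.2 (h1 h))]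
    · rw [uIoc_of_ge h, S.measure_Ioc, abs_of_nonpos (sub_nonpos.2 (h1 h)), neg_sub]
  have h3 : S.measure (⋃ i ∈ Finset.range n, uIoc (I i).1 (I i).2) ≤ S.measure (Ioc a b) := by
    refine measure_mono ?_
    rw [← uIoc_of_le hab]
    exact AbsolutelyContinuousOnInterval.biUnion_uIoc_subset_of_mem_disjWithin hI
  rw [measure_biUnion_finset hI.2 (fun i _ => measurableSet_uIoc), S.measure_Ioc,
    Finset.sum_congr rfl (fun i _ => e i), ← ENNReal.ofReal_sum_of_nonneg
      (fun i _ => abs_nonneg _)] at h3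
  exact (ENNReal.ofReal_le_ofReal_iff (sub_nonneg.2 (h1 hab))).1 h3

/-- Weighted AM-GM gives `|Δf| ≤ (κ⁻¹ |Δx| + κ |ΔΓ|) / 2`. The increments of `Γ` sum to at most `Γ b
- Γ a`, so a small `κ` controls the second sum, and then a small total length controls the first. -/
lemma IsH1.absolutelyContinuous {f : ℝ → ℝ} (hf : IsH1 f) {a b : ℝ} (hab : a ≤ b) :
    AbsolutelyContinuousOnInterval f a b := by
  obtain ⟨Γ, h1, h2, h3⟩ := hf
  rw [absolutelyContinuousOnInterval_iff]
  intro ε hε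
  have hΓ : 0 ≤ Γ b - Γ a := sub_nonneg.2 (h1 hab)
  set κ : ℝ := ε / (Γ b - Γ a + 1) with hκ
  have hκ0 : 0 < κ := by positivity
  refine ⟨κ * ε, by positivity, fun ⟨n, I⟩ hI hlen => ?_⟩
  have hs := sum_sub_le_of_disjoint h1 h2 hab hI
  have hp : ∀ i ∈ Finset.range n, dist (f (I i).1) (f (I i).2) ≤
      (1 / 2) * (κ⁻¹ * dist (I i).1 (I i).2 + κ * |Γ (I i).2 - Γ (I i).1|) := by
    intro i _
    set x := (I i).1
    set y := (I i).2
    have h4 : (f x - f y) ^ 2 ≤ |x - y| * |Γ y - Γ x| := by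
      rcases le_total x y with h | h
      · rw [abs_of_nonpos (sub_nonpos.2 h), abs_of_nonneg (sub_nonneg.2 (h1 h))]
        nlinarith [h3 x y h]
      · rw [abs_of_nonneg (sub_nonneg.2 h), abs_of_nonpos (sub_nonpos.2 (h1 h))]
        nlinarith [h3 y x h]
    rw [Real.dist_eq, Real.dist_eq]
    refine abs_le_of_sq_le_sq (h4.trans ?_) (by positivity)
    have : |x - y| * |Γ y - Γ x| = (κ⁻¹ * |x - y|) * (κ * |Γ y - Γ x|) := by
      field_simp
    rw [this]
    nlinarith [sq_nonneg (κ⁻¹ * |x - y| - κ * |Γ y - Γ x|)]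
  refine (Finset.sum_le_sum hp).trans_lt ?_
  rw [← Finset.mul_sum, Finset.sum_add_distrib, ← Finset.mul_sum, ← Finset.mul_sum]
  have e1 : κ⁻¹ * ∑ i ∈ Finset.range n, dist (I i).1 (I i).2 < ε := by
    rw [inv_mul_lt_iff₀ hκ0]; exact hlen
  have e2 : κ * ∑ i ∈ Finset.range n, |Γ (I i).2 - Γ (I i).1| ≤ ε := by
    calc _ ≤ κ * (Γ b - Γ a + 1) := by gcongr; linarith
      _ = ε := by rw [hκ]; field_simp
  linarith

lemma IsH1.intervalIntegrable_deriv {f : ℝ → ℝ} (hf : IsH1 f) (a b : ℝ) :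
    IntervalIntegrable (deriv f) volume a b := by
  rcases le_total a b with h | h
  · exact (hf.absolutelyContinuous h).intervalIntegrable_deriv
  · exact (hf.absolutelyContinuous h).intervalIntegrable_deriv.symm

lemma IsH1.integral_deriv {f : ℝ → ℝ} (hf : IsH1 f) (a b : ℝ) :
    ∫ x in a..b, deriv f x = f b - f a := by
  rcases le_total a b with h | h
  · exact (hf.absolutelyContinuous h).integral_deriv_eq_sub
  · rw [intervalIntegral.integral_symm, (hf.absolutelyContinuous h).integral_deriv_eq_sub]; ring

/-- Divided by `(y - x) ^ 2`, the control inequality gives `f' ^ 2 ≤ Γ'` almost everywhere, and the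
derivative of a monotone function is integrable. -/
lemma IsH1.memLp_deriv {f : ℝ → ℝ} (hf : IsH1 f) (a b : ℝ) :
    MemLp (deriv f) 2 (volume.restrict (Icc a b)) := by
  rcases lt_or_ge b a with h | hab
  · simp [Icc_eq_empty_of_lt h]
  have hac := hf.absolutelyContinuous hab
  obtain ⟨Γ, h1, h2, h3⟩ := hf
  rw [memLp_two_iff_integrable_sq (measurable_deriv f).aestronglyMeasurable]
  have hi : IntegrableOn (deriv Γ) (Icc a b) := by
    rw [integrableOn_Icc_iff_integrableOn_Ioc, ← intervalIntegrable_iff_integrableOn_Ioc_of_le hab]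
    exact (h1.monotoneOn _).intervalIntegrable_deriv
  refine Integrable.mono' hi ((measurable_deriv f).pow_const 2).aestronglyMeasurable ?_
  rw [ae_restrict_iff' measurableSet_Icc]
  filter_upwards [h1.ae_differentiableAt, hac.ae_differentiableAt] with x hx1 hx2 hx
  rw [uIcc_of_le hab] at hx2
  rw [Real.norm_of_nonneg (sq_nonneg _)]
  have t1 := (hasDerivAt_iff_tendsto_slope.1 (hx2 hx).hasDerivAt).mono_left
    (nhdsWithin_mono x (fun y (hy : x < y) => ne_of_gt hy) : 𝓝[>] x ≤ _)
  have t2 := (hasDerivAt_iff_tendsto_slope.1 hx1.hasDerivAt).mono_left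
    (nhdsWithin_mono x (fun y (hy : x < y) => ne_of_gt hy) : 𝓝[>] x ≤ _)
  refine le_of_tendsto_of_tendsto (t1.pow 2) t2 ?_
  filter_upwards [self_mem_nhdsWithin] with y hy
  have hy : 0 < y - x := sub_pos.2 hy
  have h4 := h3 x y (by linarith)
  rw [slope_def_field, slope_def_field, div_pow, div_le_div_iff₀ (by positivity) hy]
  nlinarith

/-- Primitives of square integrable functions. -/
lemma IsH1.of_primitive {f g : ℝ → ℝ} {a b : ℝ} (hab : a ≤ b)
    (hg : MemLp g 2 (volume.restrict (Ioo a b)))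
    (hf : ∀ x ∈ Icc a b, ∀ y ∈ Icc a b, x ≤ y → f y - f x = ∫ s in x..y, g s) :
    IsH1 (fun x => f (max a (min x b))) := by
  have hg' : MemLp g 2 (volume.restrict (Ioc a b)) := by
    rwa [← restrict_Ioo_eq_restrict_Ioc]
  have hsq : IntervalIntegrable (fun s => g s ^ 2) volume a b := by
    rw [intervalIntegrable_iff_integrableOn_Ioc_of_le hab]
    exact hg'.integrable_sq
  have hi : IntervalIntegrable g volume a b := by
    rw [intervalIntegrable_iff_integrableOn_Ioc_of_le hab]
    exact hg'.integrable (by norm_num)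
  set cl : ℝ → ℝ := fun x => max a (min x b) with hcl
  have hclm : Monotone cl := fun x y h => max_le_max le_rfl (min_le_min h le_rfl)
  have hmem : ∀ x, cl x ∈ Icc a b := fun x => ⟨le_max_left _ _, max_le hab (min_le_right _ _)⟩
  have hsub : ∀ x ∈ Icc a b, ∀ y ∈ Icc a b, uIcc x y ⊆ uIcc a b := by
    intro x hx y hy
    rw [uIcc_of_le hab]
    exact uIcc_subset_Icc hx hy
  -- The control function is the primitive of `g ^ 2`, frozen outside `[a, b]` as `f` is; the
  -- control inequality is then Cauchy-Schwarz.
  set P : ℝ → ℝ := fun x => ∫ s in a..x, g s ^ 2 with hP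
  have hPsub : ∀ x ∈ Icc a b, ∀ y ∈ Icc a b, P y - P x = ∫ s in x..y, g s ^ 2 := by
    intro x hx y hy
    have ha : a ∈ Icc a b := ⟨le_rfl, hab⟩
    exact intervalIntegral.integral_interval_sub_left (hsq.mono_set (hsub _ ha _ hy))
      (hsq.mono_set (hsub _ ha _ hx))
  refine ⟨fun x => P (cl x), fun x y hxy => ?_, ?_, fun x y hxy => ?_⟩
  · rw [← sub_nonneg, hPsub _ (hmem x) _ (hmem y)]
    exact intervalIntegral.integral_nonneg (hclm hxy) fun s _ => sq_nonneg _
  · have h1 : ContinuousOn P (Icc a b) := by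
      have := intervalIntegral.continuousOn_primitive_interval' hsq (left_mem_uIcc)
      rwa [uIcc_of_le hab] at this
    have : Continuous cl := by fun_prop
    exact h1.comp_continuous this hmem
  · have h1 : 0 ≤ P (cl y) - P (cl x) := by
      rw [hPsub _ (hmem x) _ (hmem y)]
      exact intervalIntegral.integral_nonneg (hclm hxy) fun s _ => sq_nonneg _
    have h2 : cl y - cl x ≤ y - x := by
      simp only [hcl, max_def, min_def]; split_ifs <;> linarith
    refine le_trans ?_ (mul_le_mul_of_nonneg_right h2 h1)
    have hle := hclm hxy
    rw [hPsub _ (hmem x) _ (hmem y), hf _ (hmem x) _ (hmem y) hle]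
    generalize hX : cl x = X at *
    generalize hY : cl y = Y at *
    have mX : X ∈ Icc a b := hX ▸ hmem x
    have mY : Y ∈ Icc a b := hY ▸ hmem y
    have i1 := hi.mono_set (hsub _ mX _ mY)
    have i2 := hsq.mono_set (hsub _ mX _ mY)
    rcases hle.eq_or_lt with h | h
    · simp [h]
    -- variance inequality
    set A := ∫ s in X..Y, g s with hA
    have h3 : 0 ≤ ∫ s in X..Y, (g s - A / (Y - X)) ^ 2 :=
      intervalIntegral.integral_nonneg hle fun s _ => sq_nonneg _
    have e : ∀ s, (g s - A / (Y - X)) ^ 2 =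
        (g s ^ 2 - (2 * (A / (Y - X))) * g s) + (A / (Y - X)) ^ 2 := fun s => by ring
    simp only [e] at h3
    rw [intervalIntegral.integral_add (i2.sub (i1.const_mul _)) (by simp),
      intervalIntegral.integral_sub i2 (i1.const_mul _), intervalIntegral.integral_const_mul,
      intervalIntegral.integral_const, ← hA, smul_eq_mul] at h3
    have hd : 0 < Y - X := sub_pos.2 h
    have e2 : (Y - X) * ((∫ s in X..Y, g s ^ 2) - 2 * (A / (Y - X)) * A
        + (Y - X) * (A / (Y - X)) ^ 2) = (Y - X) * (∫ s in X..Y, g s ^ 2) - A ^ 2 := by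
      field_simp; ring
    have := mul_nonneg hd.le h3
    rw [e2] at this
    linarith

/-- A continuous function of class `W^{1,2}(a,b)` is the primitive of its weak derivative. -/
lemma MemW12Interval.exists_primitive {f : ℝ → ℝ} {a b : ℝ} (hab : a < b)
    (h : MemW12Interval a b f) (hc : ContinuousOn f (Icc a b)) :
    ∃ g, MemLp g 2 (volume.restrict (Ioo a b)) ∧
      ∀ x ∈ Icc a b, ∀ y ∈ Icc a b, x ≤ y → f y - f x = ∫ s in x..y, g s := by
  obtain ⟨hf, g, hg, hw⟩ := h
  refine ⟨g, hg, ?_⟩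
  have hgi : IntegrableOn g (Ioo a b) := hg.integrable (by norm_num)
  have hi : IntervalIntegrable g volume a b := by
    rw [intervalIntegrable_iff_integrableOn_Ioc_of_le hab.le]
    rwa [← integrableOn_Ioc_iff_integrableOn_Ioo] at hgi
  have hfi : IntegrableOn f (Ioo a b) := hf.integrable (by norm_num)
  set P : ℝ → ℝ := fun x => ∫ s in a..x, g s with hP
  have hPc : ContinuousOn P (Icc a b) := by
    have := intervalIntegral.continuousOn_primitive_interval' hi (left_mem_uIcc)
    rwa [uIcc_of_le hab.le] at this
  have hsub : ∀ x ∈ Icc a b, ∀ y ∈ Icc a b, uIcc x y ⊆ uIcc a b := by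
    intro x hx y hy
    rw [uIcc_of_le hab.le]
    exact uIcc_subset_Icc hx hy
  have hPsub : ∀ x ∈ Icc a b, ∀ y ∈ Icc a b, P y - P x = ∫ s in x..y, g s := by
    intro x hx y hy
    have ha : a ∈ Icc a b := ⟨le_rfl, hab.le⟩
    exact intervalIntegral.integral_interval_sub_left (hi.mono_set (hsub _ ha _ hy))
      (hi.mono_set (hsub _ ha _ hx))
  have hq : ContinuousOn (fun x => f x - P x) (Icc a b) := hc.sub hPc
  -- `f - P` is invariant almost everywhere under each shift inside the interval, and continuity
  -- removes the exceptional set.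
  have hstep : ∀ x ∈ Ioo a b, ∀ y ∈ Ioo a b, x ≤ y → f y - P y = f x - P x := by
    intro x hx y hy hxy
    set s := y - x with hs
    have hs0 : 0 ≤ s := sub_nonneg.2 hxy
    have hae := hw.ae_sub_eq_lineInt isOpen_Ioo (isOpen_Ioo (a := a + s) (b := b)) hfi hgi hs0
      (fun x hx τ hτ => by
        simp only [smul_eq_mul, mul_one, mem_Ioo, mem_Icc] at *
        constructor <;> linarith [hx.1, hx.2, hτ.1, hτ.2])
    have hEq : EqOn (fun y => f y - P y) (fun y => f (y - s) - P (y - s)) (Ioo (a + s) b) := by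
      refine Measure.eqOn_open_of_ae_eq (μ := volume) ?_ isOpen_Ioo ?_ ?_
      · refine (ae_restrict_iff' measurableSet_Ioo).2 ?_
        filter_upwards [hae] with t ht htm
        have h1 := ht htm
        simp only [lineInt, smul_eq_mul, mul_one] at h1
        rw [intervalIntegral.integral_comp_sub_left (fun τ => g τ) t, sub_zero,
          ← hPsub _ ⟨by linarith [htm.1], by linarith [htm.2]⟩ _
            ⟨by linarith [htm.1], by linarith [htm.2]⟩] at h1
        linarith
      · exact hq.mono fun t ht => ⟨by linarith [ht.1], ht.2.le⟩
      · exact hq.comp (by fun_prop) fun t ht => ⟨by linarith [ht.1], by linarith [ht.2]⟩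
    have := hEq (x := y) ⟨by linarith [hx.1], hy.2⟩
    simpa [hs] using this
  set m := (a + b) / 2
  have hm : m ∈ Ioo a b := ⟨by simp only [m]; linarith, by simp only [m]; linarith⟩
  have hconst : EqOn (fun x => f x - P x) (fun _ => f m - P m) (Icc a b) := by
    have : EqOn (fun x => f x - P x) (fun _ => f m - P m) (Ioo a b) := by
      intro x hx
      rcases le_total x m with h | h
      · exact (hstep x hx m hm h).symm
      · exact hstep m hm x hx h
    refine this.of_subset_closure hq continuousOn_const Ioo_subset_Icc_self ?_
    rw [closure_Ioo hab.ne]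
  intro x hx y hy hxy
  rw [← hPsub x hx y hy]
  have h1 := hconst hx
  have h2 := hconst hy
  simp only at h1 h2
  linarith

end SobolevLine

end Debonding

namespace Debonding

/-! ### The front, its hitting time and the reflection of characteristics. -/

section Front

/-- Fronts on the whole line: nondecreasing, strictly slower than characteristics, and bounded
below by a positive constant. -/
structure IsSlowFront (ρ₀ : ℝ) (q : ℝ → ℝ) : Prop where
  pos : 0 < ρ₀
  mono : Monotone q
  slow : ∀ s t, s < t → q t - q s < t - s
  le : ∀ t, ρ₀ ≤ q t

/-- The extension of the front by constants. -/
def extendFront (T : ℝ) (ρ : ℝ → ℝ) (t : ℝ) : ℝ := ρ (max 0 (min t T))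

lemma extendFront_of_mem {T : ℝ} {ρ : ℝ → ℝ} {t : ℝ} (ht : t ∈ Icc 0 T) :
    extendFront T ρ t = ρ t := by
  rw [extendFront, min_eq_left ht.2, max_eq_right ht.1]

lemma extendFront_of_nonpos {T : ℝ} {ρ : ℝ → ℝ} {t : ℝ} (hT : 0 < T) (ht : t ≤ 0) :
    extendFront T ρ t = ρ 0 := by
  rw [extendFront, min_eq_left (by linarith), max_eq_left ht]

lemma extendFront_of_ge {T : ℝ} {ρ : ℝ → ℝ} {t : ℝ} (hT : 0 < T) (ht : T ≤ t) :
    extendFront T ρ t = ρ T := by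
  rw [extendFront, min_eq_right ht, max_eq_right hT.le]

/-- Both bounds come from integrating the speed. The second one is strict because the speed is below
`1` at almost every time of an interval of positive length. -/
lemma IsFront.sub_mem {T R ρ₀ : ℝ} {ρ : ℝ → ℝ} (h : IsFront T R ρ₀ ρ) {s t : ℝ} (hs : 0 ≤ s)
    (hst : s < t) (ht : t ≤ T) : 0 ≤ ρ t - ρ s ∧ ρ t - ρ s < t - s := by
  obtain ⟨K, hK⟩ := h.lipschitz
  have hac : AbsolutelyContinuousOnInterval ρ s t := by
    refine (hK.mono ?_).absolutelyContinuousOnInterval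
    rw [uIcc_of_le hst.le]
    exact Icc_subset_Icc hs ht
  have hi := hac.intervalIntegrable_deriv
  rw [← hac.integral_deriv_eq_sub]
  have hsp : ∀ᵐ x ∂volume.restrict (Ioc s t), 0 ≤ deriv ρ x ∧ deriv ρ x < 1 := by
    rw [← restrict_Ioo_eq_restrict_Ioc]
    exact ae_restrict_of_ae_restrict_of_subset (Ioo_subset_Ioo hs ht) h.speed
  constructor
  · refine intervalIntegral.integral_nonneg_of_ae_restrict hst.le ?_
    rw [← restrict_Ioc_eq_restrict_Icc]
    filter_upwards [hsp] with x hx using hx.1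
  · have : ∫ x in s..t, deriv ρ x < ∫ x in s..t, (1 : ℝ) := by
      refine intervalIntegral.integral_lt_integral_of_ae_le_of_measure_setOfPred_lt_ne_zero hst.le hi
        (by simp) (by filter_upwards [hsp] with x hx using hx.2.le) ?_
      have : volume.restrict (Ioc s t) {x | deriv ρ x < 1} = volume.restrict (Ioc s t) univ := by
        refine measure_congr ?_
        filter_upwards [hsp] with x hx
        exact eq_iff_iff.2 ⟨fun _ => trivial, fun _ => hx.2⟩
      rw [this]
      simp [hst]
    simpa using this

lemma IsFront.isSlowFront {T R ρ₀ : ℝ} {ρ : ℝ → ℝ} (hT : 0 < T) (hρ₀ : 0 < ρ₀)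
    (h : IsFront T R ρ₀ ρ) : IsSlowFront ρ₀ (extendFront T ρ) := by
  have hcl : ∀ t, max 0 (min t T) ∈ Icc 0 T :=
    fun t => ⟨le_max_left _ _, max_le hT.le (min_le_right _ _)⟩
  have hclm : ∀ s t : ℝ, s ≤ t → max 0 (min s T) ≤ max 0 (min t T) :=
    fun s t h => max_le_max le_rfl (min_le_min h le_rfl)
  refine ⟨hρ₀, fun s t hst => ?_, fun s t hst => ?_, fun t => (h.mapsTo (hcl t)).1⟩
  · rcases (hclm s t hst).eq_or_lt with e | e
    · simp [extendFront, e]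
    · have := (h.sub_mem (hcl s).1 e (hcl t).2).1
      simp only [extendFront]; linarith
  · rcases (hclm s t hst.le).eq_or_lt with e | e
    · simp [extendFront, e, hst]
    · have := (h.sub_mem (hcl s).1 e (hcl t).2).2
      have h2 : max 0 (min t T) - max 0 (min s T) ≤ t - s := by
        simp only [max_def, min_def]; split_ifs <;> linarith
      simp only [extendFront]; linarith

namespace IsSlowFront

variable {ρ₀ : ℝ} {q : ℝ → ℝ}

lemma sub_le (h : IsSlowFront ρ₀ q) {s t : ℝ} (hst : s ≤ t) : q t - q s ≤ t - s := by
  rcases hst.eq_or_lt with e | e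
  · simp [e]
  · exact (h.slow s t e).le

lemma continuous (h : IsSlowFront ρ₀ q) : Continuous q := by
  refine (LipschitzWith.of_le_add_mul 1 fun x y => ?_).continuous
  rw [NNReal.coe_one, one_mul, Real.dist_eq]
  rcases le_total x y with e | e
  · linarith [h.mono e, abs_nonneg (x - y)]
  · linarith [h.sub_le e, le_abs_self (x - y)]

lemma exists_time (h : IsSlowFront ρ₀ q) (y : ℝ) : ∃ t, t + q t = y := by
  -- At `t = y - q y ≤ y` monotonicity gives `t + q t ≤ y`; at `t = y` positivity of `q` gives `t +
  -- q t ≥ y`.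
  have hc : ContinuousOn (fun t => t + q t) (Icc (y - q y) y) :=
    (continuous_id.add h.continuous).continuousOn
  have h0 : 0 ≤ q y := h.pos.le.trans (h.le y)
  obtain ⟨t, -, ht⟩ := intermediate_value_Icc (by linarith) hc
    (show y ∈ Icc _ _ from ⟨by
      have := h.mono (show y - q y ≤ y by linarith); linarith, by linarith⟩)
  exact ⟨t, ht⟩

end IsSlowFront

open Classical in
/-- The time at which the front meets the characteristic `t + r = y`. -/
def hitTime (q : ℝ → ℝ) (y : ℝ) : ℝ := if h : ∃ t, t + q t = y then h.choose else 0

/-- The retarded time of the characteristic reflected by the front. -/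
def reflect (q : ℝ → ℝ) (y : ℝ) : ℝ := hitTime q y - q (hitTime q y)

namespace IsSlowFront

variable {ρ₀ : ℝ} {q : ℝ → ℝ}

lemma hitTime_add (h : IsSlowFront ρ₀ q) (y : ℝ) : hitTime q y + q (hitTime q y) = y := by
  rw [hitTime, dif_pos (h.exists_time y)]
  exact (h.exists_time y).choose_spec

lemma add_strictMono (h : IsSlowFront ρ₀ q) : StrictMono fun t => t + q t :=
  fun _ _ hst => add_lt_add_of_lt_of_le hst (h.mono hst.le)

lemma sub_strictMono (h : IsSlowFront ρ₀ q) : StrictMono fun t => t - q t := by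
  intro s t hst
  have := h.slow s t hst
  change s - q s < t - q t
  linarith

lemma hitTime_eq (h : IsSlowFront ρ₀ q) (t : ℝ) : hitTime q (t + q t) = t :=
  h.add_strictMono.injective (h.hitTime_add _)

lemma hitTime_mono (h : IsSlowFront ρ₀ q) : Monotone (hitTime q) := by
  intro y y' hy
  by_contra! hlt
  have := h.add_strictMono hlt
  simp only [h.hitTime_add] at this
  linarith

lemma reflect_eq (h : IsSlowFront ρ₀ q) (y : ℝ) : reflect q y = y - 2 * q (hitTime q y) := by
  have := h.hitTime_add y
  rw [reflect]; linarith

lemma reflect_add (h : IsSlowFront ρ₀ q) (y : ℝ) : reflect q y + y = 2 * hitTime q y := by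
  have := h.hitTime_add y
  rw [reflect]; linarith

/-- This gap makes the number of reflections up to a given time finite. -/
lemma reflect_le (h : IsSlowFront ρ₀ q) (y : ℝ) : reflect q y ≤ y - 2 * ρ₀ := by
  rw [h.reflect_eq]; linarith [h.le (hitTime q y)]

lemma reflect_mono (h : IsSlowFront ρ₀ q) : Monotone (reflect q) := fun _ _ hy =>
  h.sub_strictMono.monotone (h.hitTime_mono hy)

/-- Together with `reflect_mono` this is what `IsH1.comp` asks of the reflection. It holds because
`reflect q y` is `y` minus the nondecreasing term `2 * q (hitTime q y)`. -/
lemma reflect_sub_le (h : IsSlowFront ρ₀ q) (x y : ℝ) (hxy : x ≤ y) :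
    reflect q y - reflect q x ≤ y - x := by
  rw [h.reflect_eq, h.reflect_eq]
  linarith [h.mono (h.hitTime_mono hxy)]

lemma reflect_continuous (h : IsSlowFront ρ₀ q) : Continuous (reflect q) := by
  refine (LipschitzWith.of_le_add_mul 1 fun x y => ?_).continuous
  rw [NNReal.coe_one, one_mul, Real.dist_eq]
  rcases le_total x y with e | e
  · linarith [h.reflect_mono e, abs_nonneg (x - y)]
  · linarith [h.reflect_sub_le y x e, le_abs_self (x - y)]

/-- A point is behind the front if and only if the characteristics through it say so. -/
lemma lt_iff_reflect_lt (h : IsSlowFront ρ₀ q) (t r : ℝ) : r < q t ↔ reflect q (t + r) < t - r := by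
  have e := h.reflect_add (t + r)
  have e1 : r < q t ↔ hitTime q (t + r) < t := by
    have h1 := h.hitTime_add (t + r)
    constructor
    · intro hr
      by_contra! hle
      have := h.add_strictMono.monotone hle
      linarith
    · intro hlt
      have := h.add_strictMono hlt
      linarith
  rw [e1]
  constructor <;> intro _ <;> linarith

end IsSlowFront

/-! ### The domain, its closure, and the functions `ψ⁻¹` and `ω`. -/

section Domain

variable {T R ρ₀ : ℝ} {ρ : ℝ → ℝ}

lemma IsFront.extendFront_zero (h : IsFront T R ρ₀ ρ) (hT : 0 < T) {t : ℝ} (ht : t ≤ 0) :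
    extendFront T ρ t = ρ₀ := by
  rw [extendFront_of_nonpos hT ht, h.initial]

lemma IsFront.extendFront_le (h : IsFront T R ρ₀ ρ) (hT : 0 < T) (hρ₀ : 0 < ρ₀) (t : ℝ) :
    extendFront T ρ t ≤ ρ T := by
  have h1 : extendFront T ρ (max t T) = ρ T := extendFront_of_ge hT (le_max_right _ _)
  rw [← h1]
  exact (h.isSlowFront hT hρ₀).mono (le_max_left _ _)

lemma IsFront.end_lt (h : IsFront T R ρ₀ ρ) (hT : 0 < T) : ρ T < R :=
  (h.mapsTo ⟨hT.le, le_rfl⟩).2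

lemma IsFront.mem_Omega (h : IsFront T R ρ₀ ρ) {p : ℝ × ℝ} :
    p ∈ Omega T R ρ ↔ 0 < p.1 ∧ p.1 < T ∧ 0 < p.2 ∧ p.2 < extendFront T ρ p.1 := by
  constructor
  · rintro ⟨⟨h1, h2⟩, h3, h4, h5⟩
    refine ⟨h1, h2, h4, ?_⟩
    rwa [extendFront_of_mem ⟨h1.le, h2.le⟩]
  · rintro ⟨h1, h2, h3, h4⟩
    rw [extendFront_of_mem ⟨h1.le, h2.le⟩] at h4
    exact ⟨⟨h1, h2⟩, ⟨h3, h4.trans (h.mapsTo ⟨h1.le, h2.le⟩).2⟩, h3, h4⟩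

lemma IsFront.isOpen_Omega (h : IsFront T R ρ₀ ρ) (hT : 0 < T) (hρ₀ : 0 < ρ₀) :
    IsOpen (Omega T R ρ) := by
  have e : Omega T R ρ = {p | 0 < p.1 ∧ p.1 < T ∧ 0 < p.2 ∧ p.2 < extendFront T ρ p.1} := by
    ext p; exact h.mem_Omega
  rw [e]
  have hc := (h.isSlowFront hT hρ₀).continuous
  exact (isOpen_lt continuous_const continuous_fst).inter <|
    (isOpen_lt continuous_fst continuous_const).inter <|
    (isOpen_lt continuous_const continuous_snd).inter <|
    isOpen_lt continuous_snd (hc.comp continuous_fst)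

/-- The closure of `Ω`. -/
def closedDomain (T : ℝ) (ρ : ℝ → ℝ) : Set (ℝ × ℝ) :=
  {p | 0 ≤ p.1 ∧ p.1 ≤ T ∧ 0 ≤ p.2 ∧ p.2 ≤ extendFront T ρ p.1}

lemma IsFront.isCompact_closedDomain (h : IsFront T R ρ₀ ρ) (hT : 0 < T) (hρ₀ : 0 < ρ₀) :
    IsCompact (closedDomain T ρ) := by
  have hc := (h.isSlowFront hT hρ₀).continuous
  have hcl : IsClosed (closedDomain T ρ) :=
    (isClosed_le continuous_const continuous_fst).inter <|
    (isClosed_le continuous_fst continuous_const).inter <|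
    (isClosed_le continuous_const continuous_snd).inter <|
    isClosed_le continuous_snd (hc.comp continuous_fst)
  refine (isCompact_Icc (a := (0 : ℝ)) (b := T)).prod (isCompact_Icc (a := (0 : ℝ)) (b := ρ T))
    |>.of_isClosed_subset hcl ?_
  rintro p ⟨h1, h2, h3, h4⟩
  exact ⟨⟨h1, h2⟩, h3, h4.trans (h.extendFront_le hT hρ₀ _)⟩

lemma IsFront.closure_Omega (h : IsFront T R ρ₀ ρ) (hT : 0 < T) (hρ₀ : 0 < ρ₀) :
    closure (Omega T R ρ) = closedDomain T ρ := by
  have hs := h.isSlowFront hT hρ₀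
  refine Subset.antisymm (closure_minimal ?_ (h.isCompact_closedDomain hT hρ₀).isClosed) ?_
  · intro p hp
    obtain ⟨h1, h2, h3, h4⟩ := h.mem_Omega.1 hp
    exact ⟨h1.le, h2.le, h3.le, h4.le⟩
  · rintro ⟨t, r⟩ ⟨h1, h2, h3, h4⟩
    simp only at h1 h2 h3 h4
    -- The new `r` lies at least `ε * ρ₀ / 2` behind the old front, while the time shift lowers the
    -- front by at most `κ * ε * T / 2`; the choice gives `κ * T < ρ₀ / 2`.
    set κ := ρ₀ / (2 * T + ρ₀) with hκ
    have hκ0 : 0 < κ := by positivity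
    have hκ1 : κ < 1 := by rw [hκ, div_lt_one (by positivity)]; linarith
    have hκT : κ * T < ρ₀ / 2 := by
      rw [hκ, div_mul_eq_mul_div, div_lt_div_iff₀ (by positivity) (by norm_num)]
      nlinarith
    have htend : Tendsto (fun ε : ℝ => (t + κ * ε * (T / 2 - t), (1 - ε) * r + ε * (ρ₀ / 2)))
        (𝓝[>] 0) (𝓝 (t, r)) := by
      have : Continuous fun ε : ℝ => (t + κ * ε * (T / 2 - t), (1 - ε) * r + ε * (ρ₀ / 2)) := by
        fun_prop
      have := this.tendsto 0
      simp only [mul_zero, zero_mul, add_zero, sub_zero, one_mul] at this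
      exact this.mono_left nhdsWithin_le_nhds
    refine mem_closure_of_tendsto htend ?_
    have hev : ∀ᶠ ε : ℝ in 𝓝[>] 0, ε < 1 :=
      (eventually_lt_nhds (by norm_num)).filter_mono nhdsWithin_le_nhds
    filter_upwards [hev, self_mem_nhdsWithin] with ε hε1 hε0
    have hε0 : 0 < ε := hε0
    rw [h.mem_Omega]
    have hκε : κ * ε < 1 := by nlinarith
    have hκε0 : 0 < κ * ε := by positivity
    refine ⟨?_, ?_, ?_, ?_⟩
    · simp only; nlinarith
    · simp only; nlinarith
    · simp only; nlinarith
    · simp only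
      have hlow : extendFront T ρ t - κ * ε * (T / 2) ≤
          extendFront T ρ (t + κ * ε * (T / 2 - t)) := by
        rcases le_total t (T / 2) with hh | hh
        · have : t ≤ t + κ * ε * (T / 2 - t) := by nlinarith
          have h5 := hs.mono this
          nlinarith
        · have : t + κ * ε * (T / 2 - t) ≤ t := by nlinarith
          have h5 := hs.sub_le this
          nlinarith
      have h6 := hs.le t
      nlinarith

/-- On this range the equation for the hitting time has a solution in `[0, T]`, and injectivity
forces the choice made by `Function.invFunOn`. -/
lemma psiInv_eq (h : IsFront T R ρ₀ ρ) (hT : 0 < T) (hρ₀ : 0 < ρ₀) {s : ℝ} (h1 : ρ₀ ≤ s)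
    (h2 : s ≤ T + ρ T) :
    psiInv T ρ s = hitTime (extendFront T ρ) s ∧ hitTime (extendFront T ρ) s ∈ Icc 0 T := by
  have hs := h.isSlowFront hT hρ₀
  have hmem : hitTime (extendFront T ρ) s ∈ Icc 0 T := by
    have e0 : hitTime (extendFront T ρ) ρ₀ = 0 := by
      have := hs.hitTime_eq 0
      rwa [h.extendFront_zero hT le_rfl, zero_add] at this
    have e1 : hitTime (extendFront T ρ) (T + ρ T) = T := by
      have := hs.hitTime_eq T
      rwa [extendFront_of_ge hT le_rfl] at this
    exact ⟨e0.symm.le.trans (hs.hitTime_mono h1), (hs.hitTime_mono h2).trans e1.le⟩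
  refine ⟨?_, hmem⟩
  have hex : ∃ t ∈ Icc 0 T, (fun t => t + ρ t) t = s := by
    refine ⟨_, hmem, ?_⟩
    have := hs.hitTime_add s
    rwa [extendFront_of_mem hmem] at this
  have m1 := Function.invFunOn_mem hex
  have m2 := Function.invFunOn_eq hex
  refine hs.add_strictMono.injective ?_
  rw [hs.hitTime_add, psiInv, extendFront_of_mem m1]
  exact m2

lemma omega_eq (h : IsFront T R ρ₀ ρ) (hT : 0 < T) (hρ₀ : 0 < ρ₀) {s : ℝ} (h1 : ρ₀ ≤ s)
    (h2 : s ≤ T + ρ T) : omega T ρ₀ ρ s = reflect (extendFront T ρ) s := by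
  obtain ⟨e1, e2⟩ := psiInv_eq h hT hρ₀ h1 h2
  rw [omega, if_pos h1, e1, reflect, extendFront_of_mem e2]

lemma reflect_initial (h : IsFront T R ρ₀ ρ) (hT : 0 < T) (hρ₀ : 0 < ρ₀) :
    reflect (extendFront T ρ) ρ₀ = -ρ₀ := by
  have := (h.isSlowFront hT hρ₀).hitTime_eq 0
  rw [h.extendFront_zero hT le_rfl, zero_add] at this
  rw [reflect, this, h.extendFront_zero hT le_rfl, zero_sub]

end Domain

end Front

end Debonding

namespace Debonding

/-! ### Traces as means over thin boundary layers. -/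

section Layers

lemma eventually_essZeroRight {P : ℝ → Prop} (h : ∀ᶠ ε in essZeroRight, P ε) :
    ∃ η > 0, ∀ᵐ ε : ℝ, ε ∈ Ioo 0 η → P ε := by
  rw [essZeroRight, eventually_inf] at h
  obtain ⟨s, hs, t, ht, hst⟩ := h
  obtain ⟨η, hη, hη2⟩ := mem_nhdsGT_iff_exists_Ioo_subset.1 hs
  refine ⟨η, hη, ?_⟩
  filter_upwards [ht] with ε hε hεη
  exact hst ε ⟨hη2 hεη, hε⟩

/-- If `h` and `h'` have the same trace on `γ 0`, the mean of `|h' - h|` over the layer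
`⋃ ε < η, γ ε` tends to zero. -/
lemma layer_tendsto {U : Set (ℝ × ℝ)} (hU : MeasurableSet U) {h h' W : ℝ × ℝ → ℝ}
    {γ : ℝ → ℝ → ℝ × ℝ} {g : ℝ → ℝ} {a b ε₀ : ℝ} (hε₀ : 0 < ε₀)
    (hh : AEStronglyMeasurable h (volume.restrict U))
    (hh' : AEStronglyMeasurable h' (volume.restrict U))
    (hg : AEStronglyMeasurable g (volume.restrict (Ioo a b)))
    (hγ : Measure.QuasiMeasurePreserving (fun p : ℝ × ℝ => γ p.1 p.2) volume volume)
    (hmem : ∀ ε ∈ Ioo 0 ε₀, ∀ s ∈ Ioo a b, γ ε s ∈ U)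
    (ht : HasTrace a b γ h g) (ht' : HasTrace a b γ h' g) (hWm : Measurable W)
    (hW : ∀ᵐ p, p ∈ U → W p = h' p - h p) :
    Tendsto (fun η => (∫⁻ p in Ioo 0 η ×ˢ Ioo a b, ‖W (γ p.1 p.2)‖ₑ) / ENNReal.ofReal η)
      (𝓝[>] 0) (𝓝 0) := by
  have key : ∀ {f : ℝ × ℝ → ℝ}, AEStronglyMeasurable f (volume.restrict U) →
      ∀ᵐ ε : ℝ, ε ∈ Ioo 0 ε₀ →
        AEStronglyMeasurable (fun s => f (γ ε s) - g s) (volume.restrict (Ioo a b)) := by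
    intro f hf
    have h1 : ∀ᵐ p, p ∈ U → f p = hf.mk f p := (ae_restrict_iff' hU).1 hf.ae_eq_mk
    have h2 := Measure.ae_ae_of_ae_prod (hγ.ae h1)
    filter_upwards [h2] with ε hε hεm
    refine AEStronglyMeasurable.sub ?_ hg
    refine ⟨fun s => hf.mk f (γ ε s), ?_, ?_⟩
    · exact (hf.stronglyMeasurable_mk.comp_measurable hγ.measurable).comp_measurable
        measurable_prodMk_left
    · refine (ae_restrict_iff' measurableSet_Ioo).2 ?_
      filter_upwards [hε] with s hs hsm using hs (hmem ε hεm s hsm)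
  have hWγ := Measure.ae_ae_of_ae_prod (hγ.ae hW)
  set C : ℝ≥0∞ := volume.restrict (Ioo a b) univ ^ (1 / (1 : ℝ≥0∞).toReal - 1 / (2 : ℝ≥0∞).toReal)
    with hC
  have hCtop : C ≠ ⊤ := by
    refine (ENNReal.rpow_lt_top_of_nonneg (by norm_num) ?_).ne
    simp
  have hsum : Tendsto (fun ε => C * (eLpNorm (fun s => h' (γ ε s) - g s) 2 (volume.restrict (Ioo a b))
      + eLpNorm (fun s => h (γ ε s) - g s) 2 (volume.restrict (Ioo a b)))) essZeroRight (𝓝 0) := by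
    have := ENNReal.Tendsto.const_mul (a := C) (Tendsto.add ht' ht) (Or.inr hCtop)
    simpa using this
  rw [ENNReal.tendsto_nhds_zero]
  intro δ hδ
  obtain ⟨η, hη, hηε⟩ := eventually_essZeroRight (ENNReal.tendsto_nhds_zero.1 hsum δ hδ)
  have hmin : 0 < min η ε₀ := lt_min hη hε₀
  filter_upwards [Ioo_mem_nhdsGT hmin] with κ hκ
  have hκ1 : κ < η := hκ.2.trans_le (min_le_left _ _)
  have hκ2 : κ < ε₀ := hκ.2.trans_le (min_le_right _ _)
  have hm : Measurable (fun p : ℝ × ℝ => ‖W (γ p.1 p.2)‖ₑ) := (hWm.comp hγ.measurable).enorm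
  have hprod : (volume : Measure (ℝ × ℝ)).restrict (Ioo 0 κ ×ˢ Ioo a b) =
      (volume.restrict (Ioo 0 κ)).prod (volume.restrict (Ioo a b)) := by
    rw [Measure.prod_restrict]; rfl
  rw [hprod, lintegral_prod _ hm.aemeasurable]
  refine ENNReal.div_le_of_le_mul ?_
  calc ∫⁻ ε in Ioo 0 κ, ∫⁻ s in Ioo a b, ‖W (γ ε s)‖ₑ
      ≤ ∫⁻ ε in Ioo 0 κ, δ := by
        refine lintegral_mono_ae ((ae_restrict_iff' measurableSet_Ioo).2 ?_)
        filter_upwards [hηε, key hh, key hh', hWγ] with ε h1 h2 h3 h4 hε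
        have hε0 : ε ∈ Ioo 0 ε₀ := ⟨hε.1, hε.2.trans hκ2⟩
        refine le_trans ?_ (h1 ⟨hε.1, hε.2.trans hκ1⟩)
        have m2 := h2 hε0
        have m3 := h3 hε0
        calc ∫⁻ s in Ioo a b, ‖W (γ ε s)‖ₑ
            ≤ ∫⁻ s in Ioo a b, (‖h' (γ ε s) - g s‖ₑ + ‖h (γ ε s) - g s‖ₑ) := by
              refine lintegral_mono_ae ((ae_restrict_iff' measurableSet_Ioo).2 ?_)
              filter_upwards [h4] with s hs hsm
              rw [hs (hmem ε hε0 s hsm)]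
              have : h' (γ ε s) - h (γ ε s) = (h' (γ ε s) - g s) - (h (γ ε s) - g s) := by ring
              rw [this]
              exact enorm_sub_le
          _ = eLpNorm (fun s => h' (γ ε s) - g s) 1 (volume.restrict (Ioo a b))
              + eLpNorm (fun s => h (γ ε s) - g s) 1 (volume.restrict (Ioo a b)) := by
              rw [lintegral_add_left' m3.enorm, eLpNorm_one_eq_lintegral_enorm,
                eLpNorm_one_eq_lintegral_enorm]
          _ ≤ _ := by
              rw [mul_add, mul_comm C, mul_comm C]
              exact add_le_add
                (eLpNorm_le_eLpNorm_mul_rpow_measure_univ (by norm_num) m3)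
                (eLpNorm_le_eLpNorm_mul_rpow_measure_univ (by norm_num) m2)
    _ = δ * ENNReal.ofReal κ := by simp

/-- A function which is controlled along translates by its values in a thin layer vanishes if the
means over the layer tend to zero. -/
lemma ae_eq_zero_of_layer {f k : ℝ × ℝ → ℝ≥0∞} (hk : Measurable k)
    {N : Set (ℝ × ℝ)} {V L : ℝ → Set (ℝ × ℝ)} {S η₀ c : ℝ} (hc : 0 < c) (hη₀ : 0 < η₀)
    (u : ℝ × ℝ)
    (hN : MeasurableSet N) (hVm : MeasurableSet {p : (ℝ × ℝ) × ℝ | p.1 ∈ V p.2})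
    (hLm : ∀ η, MeasurableSet (L η))
    (hL : Tendsto (fun η => (∫⁻ p in L η, f p) / ENNReal.ofReal η) (𝓝[>] 0) (𝓝 0))
    (hkf : ∀ s ∈ Ioo 0 S, ∀ᵐ p, p ∈ N → p ∈ V s → k p ≤ f (p - s • u))
    (hvol : ∀ p ∈ N, ∀ η ∈ Ioo 0 η₀,
      ENNReal.ofReal (c * η) ≤ volume {s | s ∈ Ioo 0 S ∧ p ∈ V s ∧ p - s • u ∈ L η}) :
    ∀ᵐ p, p ∈ N → k p = 0 := by
  have hkey : ∀ η ∈ Ioo 0 η₀, (∫⁻ p in N, k p) * ENNReal.ofReal c ≤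
      ENNReal.ofReal S * ((∫⁻ p in L η, f p) / ENNReal.ofReal η) := by
    intro η hη
    -- Double counting of the pairs `(p, s)` that carry `p` into the layer: each `p ∈ N` has at
    -- least `c * η` such `s`, and for each `s` translation invariance bounds the slice by the
    -- integral of `f` over `L η`. The factor `η` is the one by which `hL` divides.
    set A : Set ((ℝ × ℝ) × ℝ) := {x | x.2 ∈ Ioo 0 S ∧ x.1 ∈ V x.2 ∧ x.1 - x.2 • u ∈ L η} with hA
    have hAm : MeasurableSet A := by
      refine (measurable_snd measurableSet_Ioo).inter (hVm.inter ?_)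
      have : Measurable (fun x : (ℝ × ℝ) × ℝ => x.1 - x.2 • u) := by fun_prop
      exact this (hLm η)
    have hG : Measurable (A.indicator fun x : (ℝ × ℝ) × ℝ => k x.1) :=
      (hk.comp measurable_fst).indicator hAm
    have e1 : (∫⁻ p in N, k p) * ENNReal.ofReal (c * η) ≤
        ∫⁻ p in N, ∫⁻ s, A.indicator (fun x : (ℝ × ℝ) × ℝ => k x.1) (p, s) := by
      rw [← lintegral_mul_const _ hk]
      refine setLIntegral_mono' hN fun p hp => ?_
      have : ∀ s, A.indicator (fun x : (ℝ × ℝ) × ℝ => k x.1) (p, s) =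
          {s | s ∈ Ioo 0 S ∧ p ∈ V s ∧ p - s • u ∈ L η}.indicator (fun _ => k p) s := by
        intro s
        simp only [indicator]
        rfl
      simp only [this]
      rw [lintegral_indicator_const]
      · exact mul_le_mul_right (hvol p hp η hη) _
      · exact measurable_prodMk_left hAm
    have e2 : ∫⁻ p in N, ∫⁻ s, A.indicator (fun x : (ℝ × ℝ) × ℝ => k x.1) (p, s) =
        ∫⁻ s, ∫⁻ p in N, A.indicator (fun x : (ℝ × ℝ) × ℝ => k x.1) (p, s) :=
      lintegral_lintegral_swap hG.aemeasurable
    have e3 : ∫⁻ s, ∫⁻ p in N, A.indicator (fun x : (ℝ × ℝ) × ℝ => k x.1) (p, s) ≤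
        ∫⁻ s, (Ioo 0 S).indicator (fun _ => ∫⁻ p in L η, f p) s := by
      refine lintegral_mono fun s => ?_
      by_cases hs : s ∈ Ioo 0 S
      · rw [indicator_of_mem hs]
        calc _ ≤ ∫⁻ p in N, (L η).indicator f (p - s • u) := by
              refine lintegral_mono_ae ((ae_restrict_iff' hN).2 ?_)
              filter_upwards [hkf s hs] with p hp hpN
              by_cases hpA : (p, s) ∈ A
              · rw [indicator_of_mem hpA, indicator_of_mem hpA.2.2]
                exact hp hpN hpA.2.1
              · rw [indicator_of_notMem hpA]; exact zero_le
          _ ≤ ∫⁻ p, (L η).indicator f (p - s • u) := setLIntegral_le_lintegral _ _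
          _ = ∫⁻ p, (L η).indicator f p := lintegral_sub_right_eq_self _ _
          _ = _ := lintegral_indicator (hLm η) f
      · have : ∀ p, A.indicator (fun x : (ℝ × ℝ) × ℝ => k x.1) (p, s) = 0 :=
          fun p => indicator_of_notMem (fun h => hs h.1) _
        simp [this]
    have e4 : ∫⁻ s, (Ioo 0 S).indicator (fun _ => ∫⁻ p in L η, f p) s =
        (∫⁻ p in L η, f p) * ENNReal.ofReal S := by
      rw [lintegral_indicator_const measurableSet_Ioo]; simp
    have e5 := e1.trans (e2.le.trans (e3.trans e4.le))
    rw [ENNReal.ofReal_mul hc.le, ← mul_assoc] at e5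
    rw [← mul_div_assoc, mul_comm (ENNReal.ofReal S), ENNReal.le_div_iff_mul_le]
    · exact e5
    · left; simpa using hη.1
    · left; simp
  have hlim : (∫⁻ p in N, k p) * ENNReal.ofReal c ≤ 0 := by
    have t := ENNReal.Tendsto.const_mul (a := ENNReal.ofReal S) hL (Or.inr (by simp))
    rw [mul_zero] at t
    refine ge_of_tendsto t ?_
    filter_upwards [Ioo_mem_nhdsGT hη₀] with η hη using hkey η hη
  have h0 : ∫⁻ p in N, k p = 0 := by
    have := le_antisymm hlim zero_le
    rcases mul_eq_zero.1 this with h | h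
    · exact h
    · simp at h; linarith
  rw [lintegral_eq_zero_iff hk] at h0
  exact (ae_restrict_iff' hN).1 h0

end Layers

end Debonding

namespace Debonding

/-! ### The wave operator in characteristic directions, and a cutoff in time. -/

section Box

lemma dirDeriv_comm {φ : ℝ × ℝ → ℝ} (h : ContDiff ℝ ∞ φ) (a b : ℝ × ℝ) :
    dirDeriv a (dirDeriv b φ) = dirDeriv b (dirDeriv a φ) := by
  have hd : Differentiable ℝ (fderiv ℝ φ) :=
    (h.fderiv_right (m := ∞) (by simp)).differentiable (by simp)
  ext x
  have e : ∀ a b : ℝ × ℝ, dirDeriv a (dirDeriv b φ) x = fderiv ℝ (fderiv ℝ φ) x a b := by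
    intro a b
    have h1 := (hd x).hasFDerivAt.clm_apply (hasFDerivAt_const b x)
    have h2 : fderiv ℝ (dirDeriv b φ) x = _ := h1.fderiv
    rw [dirDeriv, h2]
    simp
  rw [e, e]
  refine (h.contDiffAt.isSymmSndFDerivAt ?_).eq a b
  simp only [minSmoothness_of_isRCLikeNormedField]
  exact (WithTop.coe_le_coe.2 le_top : ((2 : ℕ∞) : WithTop ℕ∞) ≤ ((⊤ : ℕ∞) : WithTop ℕ∞))

lemma dirDeriv_fun_add {f g : ℝ × ℝ → ℝ} (v : ℝ × ℝ) {x : ℝ × ℝ} (hf : DifferentiableAt ℝ f x)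
    (hg : DifferentiableAt ℝ g x) :
    dirDeriv v (fun y => f y + g y) x = dirDeriv v f x + dirDeriv v g x := by
  have : fderiv ℝ (fun y => f y + g y) x = _ := (hf.hasFDerivAt.add hg.hasFDerivAt).fderiv
  rw [dirDeriv, this]
  simp [dirDeriv]

/-- The wave operator as a composition of characteristic derivatives. -/
lemma dirDeriv_char_eq {φ : ℝ × ℝ → ℝ} (h : ContDiff ℝ ∞ φ) (x : ℝ × ℝ) :
    dirDeriv ((1 : ℝ), (-1 : ℝ)) (dirDeriv ((1 : ℝ), (1 : ℝ)) φ) x =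
      dirDeriv (1, 0) (dirDeriv (1, 0) φ) x - dirDeriv (0, 1) (dirDeriv (0, 1) φ) x := by
  have hd : ∀ v, Differentiable ℝ (dirDeriv v φ) := fun v =>
    ((h.fderiv_right (m := ∞) (by simp)).clm_apply contDiff_const).differentiable (by simp)
  have e1 : dirDeriv ((1 : ℝ), (1 : ℝ)) φ = fun y => dirDeriv (1, 0) φ y + dirDeriv (0, 1) φ y := by
    ext y
    simp only [dirDeriv, ← map_add]
    simp
  have e2 : ∀ f : ℝ × ℝ → ℝ, ∀ x, dirDeriv ((1 : ℝ), (-1 : ℝ)) f x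
      = dirDeriv (1, 0) f x - dirDeriv (0, 1) f x := by
    intro f x
    simp only [dirDeriv, ← map_sub]
    simp
  have e3 : ∀ v, dirDeriv v (fun y => dirDeriv (1, 0) φ y + dirDeriv (0, 1) φ y) x =
      dirDeriv v (dirDeriv (1, 0) φ) x + dirDeriv v (dirDeriv (0, 1) φ) x :=
    fun v => dirDeriv_fun_add v (hd _ x) (hd _ x)
  rw [e1, e2, e3, e3, dirDeriv_comm h (0, 1) (1, 0)]
  ring

lemma dirDeriv_time_mul {χ : ℝ → ℝ} {φ : ℝ × ℝ → ℝ} (hχ : Differentiable ℝ χ)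
    (h : Differentiable ℝ φ) (a b : ℝ) :
    dirDeriv (a, b) (fun p : ℝ × ℝ => χ p.1 * φ p) =
      fun p => a * (deriv χ p.1 * φ p) + χ p.1 * dirDeriv (a, b) φ p := by
  ext p
  have h1 : HasFDerivAt (fun p : ℝ × ℝ => χ p.1)
      ((deriv χ p.1) • ContinuousLinearMap.fst ℝ ℝ ℝ) p :=
    (hχ p.1).hasDerivAt.comp_hasFDerivAt p hasFDerivAt_fst
  have h2 := h1.mul (h p).hasFDerivAt
  have h3 : fderiv ℝ (fun p : ℝ × ℝ => χ p.1 * φ p) p = _ := h2.fderiv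
  rw [dirDeriv, h3]
  simp [dirDeriv]
  ring

/-- A smooth cutoff of the half line `t > ε`. -/
def timeCutoff (ε t : ℝ) : ℝ := Real.smoothTransition (t / ε - 1)

lemma timeCutoff_contDiff (ε : ℝ) : ContDiff ℝ ∞ (timeCutoff ε) :=
  Real.smoothTransition.contDiff.comp (by fun_prop)

lemma timeCutoff_eq_zero {ε t : ℝ} (hε : 0 < ε) (ht : t ≤ ε) : timeCutoff ε t = 0 := by
  refine Real.smoothTransition.zero_of_nonpos ?_
  rw [sub_nonpos, div_le_one hε]; exact ht

lemma timeCutoff_eq_one {ε t : ℝ} (hε : 0 < ε) (ht : 2 * ε ≤ t) : timeCutoff ε t = 1 := by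
  refine Real.smoothTransition.one_of_one_le ?_
  rw [le_sub_iff_add_le, le_div_iff₀ hε]; linarith

lemma abs_timeCutoff_le (ε t : ℝ) : |timeCutoff ε t| ≤ 1 := by
  rw [timeCutoff, abs_of_nonneg (Real.smoothTransition.nonneg _)]
  exact Real.smoothTransition.le_one _

lemma deriv_timeCutoff_eq_zero {ε t : ℝ} (hε : 0 < ε) (ht : t < ε ∨ 2 * ε < t) :
    deriv (timeCutoff ε) t = 0 := by
  rcases ht with ht | ht
  · have : timeCutoff ε =ᶠ[𝓝 t] fun _ => 0 := by
      filter_upwards [Iio_mem_nhds ht] with s hs using timeCutoff_eq_zero hε (le_of_lt hs)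
    rw [this.deriv_eq]; simp
  · have : timeCutoff ε =ᶠ[𝓝 t] fun _ => 1 := by
      filter_upwards [Ioi_mem_nhds ht] with s hs using timeCutoff_eq_one hε (le_of_lt hs)
    rw [this.deriv_eq]; simp

/-- The cutoff is a fixed transition rescaled by `ε`, and the derivative of the transition is
bounded on a compact interval containing the zone where it varies. -/
lemma exists_deriv_timeCutoff_le :
    ∃ C, 0 ≤ C ∧ ∀ ε, 0 < ε → ∀ t, |deriv (timeCutoff ε) t| ≤ C / ε := by
  have hcs : ContDiff ℝ ∞ Real.smoothTransition := Real.smoothTransition.contDiff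
  have hc : Continuous (deriv Real.smoothTransition) := hcs.continuous_deriv (by simp)
  obtain ⟨C, hC⟩ := (isCompact_Icc (a := (-1 : ℝ)) (b := 2)).exists_bound_of_continuousOn
    hc.continuousOn
  have hC0 : 0 ≤ C := (norm_nonneg _).trans (hC 0 (by norm_num))
  refine ⟨C, hC0, fun ε hε t => ?_⟩
  by_cases ht : t < ε ∨ 2 * ε < t
  · rw [deriv_timeCutoff_eq_zero hε ht]; simp; positivity
  · push Not at ht
    have h1 : HasDerivAt (timeCutoff ε) (deriv Real.smoothTransition (t / ε - 1) * (1 / ε)) t := by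
      refine HasDerivAt.comp t (h₂ := Real.smoothTransition) (h := fun t => t / ε - 1)
        ((hcs.differentiable (by simp)) _).hasDerivAt ?_
      exact ((hasDerivAt_id t).div_const ε).sub_const 1
    rw [h1.deriv, abs_mul, abs_of_pos (show 0 < 1 / ε by positivity), div_eq_mul_one_div C]
    gcongr
    refine hC _ ⟨?_, ?_⟩
    · have := (one_le_div hε).2 ht.1; linarith
    · have := (div_le_iff₀ hε).2 ht.2; linarith

end Box

/-! ### Extension of a zero-data solution to negative times. -/

section Extension

variable {T R ρ₀ : ℝ} {ρ : ℝ → ℝ}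

/-- The domain extended to negative times. -/
def pastDomain (T : ℝ) (q : ℝ → ℝ) : Set (ℝ × ℝ) := {p | p.1 < T ∧ 0 < p.2 ∧ p.2 < q p.1}

lemma isOpen_pastDomain {q : ℝ → ℝ} (hq : Continuous q) (T : ℝ) : IsOpen (pastDomain T q) :=
  (isOpen_lt continuous_fst continuous_const).inter <|
    (isOpen_lt continuous_const continuous_snd).inter <|
    isOpen_lt continuous_snd (hq.comp continuous_fst)

lemma IsTestFun.slice {U : Set (ℝ × ℝ)} {φ : ℝ × ℝ → ℝ} (h : IsTestFun U φ) (t : ℝ) {I : Set ℝ}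
    (hI : ∀ r, (t, r) ∈ tsupport φ → r ∈ I) : IsTestFun I (fun r => φ (t, r)) where
  smooth := h.smooth.comp (by fun_prop)
  compact := h.compact.comp_isClosedEmbedding
    (Topology.IsClosedEmbedding.of_continuous_injective_isClosedMap (by fun_prop)
      (fun _ _ e => (Prod.mk.inj e).2) (isClosedMap_prodMk_left t))
  support := by
    refine (closure_minimal (t := {r | (t, r) ∈ tsupport φ}) ?_ ?_).trans hI
    · intro r hr
      exact subset_tsupport _ hr
    · exact (isClosed_tsupport φ).preimage (by fun_prop)

/-- Makes smallness in the dual norm uniform over all time slices of one test function. -/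
lemma IsTestFun.exists_w12Norm_slice_le {U : Set (ℝ × ℝ)} {φ : ℝ × ℝ → ℝ} (h : IsTestFun U φ)
    {a b : ℝ} : ∃ M, 0 < M ∧ ∀ t, w12Norm a b (fun r => φ (t, r)) ≤ M := by
  obtain ⟨C, hC0, hC⟩ := h.bounded
  obtain ⟨D, hD0, hD⟩ := (h.dirDeriv (0, 1)).bounded
  refine ⟨Real.sqrt (C ^ 2 * volume.real (Ioo a b) + D ^ 2 * volume.real (Ioo a b) + 1),
    by positivity, fun t => ?_⟩
  refine Real.sqrt_le_sqrt ?_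
  have e : ∀ r, deriv (fun r => φ (t, r)) r = Debonding.dirDeriv (0, 1) φ (t, r) := by
    intro r
    have h1 : HasDerivAt (fun r : ℝ => (t, r)) ((0 : ℝ), (1 : ℝ)) r :=
      (hasDerivAt_const r t).prodMk (hasDerivAt_id r)
    exact (((h.smooth.differentiable (by simp)) _).hasFDerivAt.comp_hasDerivAt r h1).deriv
  have key : ∀ {f : ℝ → ℝ} {C : ℝ}, (∀ r, ‖f r‖ ≤ C) →
      ∫ r in Ioo a b, f r ^ 2 ≤ C ^ 2 * volume.real (Ioo a b) := by
    intro f C hf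
    refine (le_abs_self _).trans (norm_setIntegral_le_of_norm_le_const
      (μ := (volume : Measure ℝ)) (f := fun r => f r ^ 2) (C := C ^ 2) measure_Ioo_lt_top ?_)
    intro r _
    rw [norm_pow]
    gcongr
    exact hf r
  have k1 := key (f := fun r => φ (t, r)) fun r => hC (t, r)
  have k2 := key (f := fun r => deriv (fun r => φ (t, r)) r) fun r => by rw [e]; exact hD (t, r)
  linarith

/-- A solution with zero data, extended by zero to negative times, is a solution. -/
theorem weak_eq_extend (hρ : IsFront T R ρ₀ ρ) (hT : 0 < T) (hρ₀ : 0 < ρ₀)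
    {V : ℝ → ℝ} {VM : ℝ} (hVm : Measurable V) (hV : ∀ p ∈ Omega T R ρ, |V p.2| ≤ VM)
    {W Wt : ℝ × ℝ → ℝ} (hWi : Integrable W) (hWt : IntegrableOn Wt (Omega T R ρ))
    (hweak : HasWeakDeriv (Omega T R ρ) (1, 0) W Wt)
    (heq : ∀ φ, IsTestFun (Omega T R ρ) φ → ∫ p in Omega T R ρ, W p *
        (dirDeriv (1, 0) (dirDeriv (1, 0) φ) p - dirDeriv (0, 1) (dirDeriv (0, 1) φ) p
          - V p.2 * φ p) = 0)
    (hlayer : Tendsto (fun η => (∫⁻ p in Ioo 0 η ×ˢ Ioo 0 ρ₀, ‖W p‖ₑ) / ENNReal.ofReal η)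
      (𝓝[>] 0) (𝓝 0))
    (hvel : ∀ δ > 0, ∃ η > 0, ∀ᵐ t : ℝ, t ∈ Ioo 0 η → ∀ ψ, IsTestFun (Ioo 0 ρ₀) ψ →
      ∀ M > 0, w12Norm 0 ρ₀ ψ ≤ M → |∫ r in Ioo 0 ρ₀, Wt (t, r) * ψ r| ≤ M * δ)
    {φ : ℝ × ℝ → ℝ} (hφ : IsTestFun (pastDomain T (extendFront T ρ)) φ) :
    ∫ p in Omega T R ρ, W p *
      (dirDeriv (1, 0) (dirDeriv (1, 0) φ) p - dirDeriv (0, 1) (dirDeriv (0, 1) φ) p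
          - V p.2 * φ p) = 0 := by
  set Ω := Omega T R ρ with hΩ
  have hΩo : IsOpen Ω := hρ.isOpen_Omega hT hρ₀
  set B : ℝ × ℝ → ℝ := fun p => dirDeriv (1, 0) (dirDeriv (1, 0) φ) p
    - dirDeriv (0, 1) (dirDeriv (0, 1) φ) p - V p.2 * φ p with hB
  obtain ⟨C, hC0, hC⟩ := exists_deriv_timeCutoff_le
  obtain ⟨D, hD0, hD⟩ := (hφ.dirDeriv (1, 0)).bounded
  obtain ⟨D0, hD00, hDφ⟩ := hφ.bounded
  obtain ⟨M, hM0, hM⟩ := hφ.exists_w12Norm_slice_le (a := 0) (b := ρ₀)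
  -- near the initial time the support is inside the initial interval
  obtain ⟨ε₀, hε₀, hsupp⟩ : ∃ ε₀ > 0, ∀ p ∈ tsupport φ, p.1 < ε₀ → p.2 < ρ₀ := by
    have hK : IsCompact (tsupport φ ∩ {p | ρ₀ ≤ p.2}) :=
      hφ.compact.isCompact.inter_right (isClosed_le continuous_const continuous_snd)
    rcases (tsupport φ ∩ {p | ρ₀ ≤ p.2}).eq_empty_or_nonempty with h | h
    · refine ⟨1, one_pos, fun p hp _ => ?_⟩
      by_contra! hle
      exact (h ▸ (⟨hp, hle⟩ : p ∈ tsupport φ ∩ {p | ρ₀ ≤ p.2}) : p ∈ (∅ : Set _))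
    · obtain ⟨p₀, hp₀, hmin⟩ := hK.exists_isMinOn h continuous_fst.continuousOn
      refine ⟨p₀.1, ?_, fun p hp hlt => ?_⟩
      · by_contra! hle
        have := (hφ.support hp₀.1).2.2
        rw [hρ.extendFront_zero hT hle] at this
        exact absurd hp₀.2 (not_le.2 this)
      · by_contra! hle
        exact absurd (hmin ⟨hp, hle⟩) (not_le.2 hlt)
  have hW1 : IntegrableOn W Ω := hWi.integrableOn
  have hVφ : ∃ C, ∀ p ∈ Ω, ‖B p‖ ≤ C := by
    obtain ⟨c1, -, h1⟩ := ((hφ.dirDeriv (1, 0)).dirDeriv (1, 0)).bounded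
    obtain ⟨c2, -, h2⟩ := ((hφ.dirDeriv (0, 1)).dirDeriv (0, 1)).bounded
    refine ⟨c1 + c2 + VM * D0, fun p hp => ?_⟩
    refine (norm_sub_le _ _).trans (add_le_add ((norm_sub_le _ _).trans
      (add_le_add (h1 p) (h2 p))) ?_)
    rw [norm_mul]
    exact mul_le_mul (hV p hp) (hDφ p) (norm_nonneg _) ((abs_nonneg _).trans (hV p hp))
  obtain ⟨CB, hCB⟩ := hVφ
  have hBm : Measurable B := by
    have m1 := ((hφ.dirDeriv (1, 0)).dirDeriv (1, 0)).continuous.measurable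
    have m2 := ((hφ.dirDeriv (0, 1)).dirDeriv (0, 1)).continuous.measurable
    have m3 := hφ.continuous.measurable
    exact (m1.sub m2).sub ((hVm.comp measurable_snd).mul m3)
  -- the identity for the truncated test function
  have hid : ∀ ε, 0 < ε → ∫ p in Ω, W p * (timeCutoff ε p.1 * B p) =
      (∫ p in Ω, Wt p * (deriv (timeCutoff ε) p.1 * φ p))
        - ∫ p in Ω, W p * (deriv (timeCutoff ε) p.1 * dirDeriv (1, 0) φ p) := by
    intro ε hε
    have hχ := timeCutoff_contDiff ε
    have hχd : Differentiable ℝ (timeCutoff ε) := hχ.differentiable (by simp)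
    have hχ' : ContDiff ℝ ∞ (deriv (timeCutoff ε)) := by
      have := contDiff_infty_iff_deriv.1 hχ
      exact this.2
    have mk : ∀ {χ : ℝ → ℝ}, ContDiff ℝ ∞ χ → (∀ t < ε, χ t = 0) → ∀ {ψ : ℝ × ℝ → ℝ},
        IsTestFun (pastDomain T (extendFront T ρ)) ψ → IsTestFun Ω (fun p => χ p.1 * ψ p) := by
      intro χ hχ h0 ψ hψ
      refine ⟨(hχ.comp contDiff_fst).mul hψ.smooth, hψ.compact.mul_left, ?_⟩
      intro p hp
      have h1 : p ∈ tsupport ψ := closure_mono (Function.support_mul_subset_right _ _) hp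
      have h2 : p ∈ {p : ℝ × ℝ | ε ≤ p.1} := by
        refine closure_minimal (t := {p : ℝ × ℝ | ε ≤ p.1}) ?_
          (isClosed_le continuous_const continuous_fst) hp
        intro p' hp'
        by_contra hlt
        exact hp' (by simp [h0 p'.1 (not_le.1 hlt)])
      obtain ⟨k1, k2, k3⟩ := hψ.support h1
      exact hρ.mem_Omega.2 ⟨hε.trans_le h2, k1, k2, k3⟩
    have t1 := mk hχ (fun t ht => timeCutoff_eq_zero hε ht.le) hφ
    have t2 := mk hχ' (fun t ht => deriv_timeCutoff_eq_zero hε (Or.inl ht)) hφ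
    have hφd := hφ.smooth.differentiable (by simp)
    have hφtd := (hφ.dirDeriv (1, 0)).smooth.differentiable (by simp)
    have hφrd := (hφ.dirDeriv (0, 1)).smooth.differentiable (by simp)
    have i1 := heq _ t1
    have i2 := hweak _ t2
    have d1 : dirDeriv (1, 0) (fun p : ℝ × ℝ => timeCutoff ε p.1 * φ p) = fun p =>
        (fun p : ℝ × ℝ => deriv (timeCutoff ε) p.1 * φ p) p
          + (fun p : ℝ × ℝ => timeCutoff ε p.1 * dirDeriv (1, 0) φ p) p := by
      rw [dirDeriv_time_mul hχd hφd]; simp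
    -- The second time derivative is kept as `∂ₜ(χ' φ) + χ' φₜ + χ φₜₜ`. The first term is
    -- integrated by parts onto `Wt`, so `χ''`, of order `ε⁻²`, is never estimated.
    have d2 : dirDeriv (1, 0) (dirDeriv (1, 0) (fun p : ℝ × ℝ => timeCutoff ε p.1 * φ p)) =
        fun p => dirDeriv (1, 0) (fun p : ℝ × ℝ => deriv (timeCutoff ε) p.1 * φ p) p
          + (deriv (timeCutoff ε) p.1 * dirDeriv (1, 0) φ p
            + timeCutoff ε p.1 * dirDeriv (1, 0) (dirDeriv (1, 0) φ) p) := by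
      rw [d1]
      ext p
      have a1 : DifferentiableAt ℝ (fun p : ℝ × ℝ => deriv (timeCutoff ε) p.1 * φ p) p :=
        (t2.smooth.differentiable (by simp)) p
      have a2 : DifferentiableAt ℝ (fun p : ℝ × ℝ => timeCutoff ε p.1 * dirDeriv (1, 0) φ p) p :=
        ((mk hχ (fun t ht => timeCutoff_eq_zero hε ht.le)
          (hφ.dirDeriv (1, 0))).smooth.differentiable (by simp)) p
      have e := congrFun (dirDeriv_time_mul hχd hφtd 1 0) p
      rw [one_mul] at e
      rw [← e]
      exact dirDeriv_fun_add _ a1 a2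
    have d3 : dirDeriv (0, 1) (dirDeriv (0, 1) (fun p : ℝ × ℝ => timeCutoff ε p.1 * φ p)) =
        fun p => timeCutoff ε p.1 * dirDeriv (0, 1) (dirDeriv (0, 1) φ) p := by
      rw [dirDeriv_time_mul hχd hφd]
      simp only [zero_mul, zero_add]
      rw [dirDeriv_time_mul hχd hφrd]
      simp
    rw [d2, d3] at i1
    have hi2 : IntegrableOn (fun p => W p *
        dirDeriv (1, 0) (fun p : ℝ × ℝ => deriv (timeCutoff ε) p.1 * φ p) p) Ω := by
      obtain ⟨c, -, hc⟩ := (t2.dirDeriv (1, 0)).bounded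
      exact hW1.mul_bdd (c := c) (t2.dirDeriv (1, 0)).continuous.aestronglyMeasurable
        (ae_of_all _ hc)
    have hi3 : IntegrableOn (fun p => W p * (timeCutoff ε p.1 * B p)) Ω := by
      refine hW1.mul_bdd (c := 1 * CB)
        ((hχ.continuous.measurable.comp measurable_fst).mul hBm).aestronglyMeasurable
        ((ae_restrict_iff' hΩo.measurableSet).2 (ae_of_all _ fun p hp => ?_))
      rw [norm_mul]
      exact mul_le_mul (abs_timeCutoff_le _ _) (hCB p hp) (norm_nonneg _) zero_le_one
    have hi4 : IntegrableOn (fun p => W p *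
        (deriv (timeCutoff ε) p.1 * dirDeriv (1, 0) φ p)) Ω := by
      have t3 := mk hχ' (fun t ht => deriv_timeCutoff_eq_zero hε (Or.inl ht)) (hφ.dirDeriv (1, 0))
      obtain ⟨c, -, hc⟩ := t3.bounded
      exact hW1.mul_bdd (c := c) t3.continuous.aestronglyMeasurable (ae_of_all _ hc)
    have e : ∀ p, W p * (dirDeriv (1, 0) (fun p : ℝ × ℝ => deriv (timeCutoff ε) p.1 * φ p) p
          + (deriv (timeCutoff ε) p.1 * dirDeriv (1, 0) φ p
            + timeCutoff ε p.1 * dirDeriv (1, 0) (dirDeriv (1, 0) φ) p)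
          - timeCutoff ε p.1 * dirDeriv (0, 1) (dirDeriv (0, 1) φ) p
          - V p.2 * (timeCutoff ε p.1 * φ p)) =
        W p * dirDeriv (1, 0) (fun p : ℝ × ℝ => deriv (timeCutoff ε) p.1 * φ p) p
          + W p * (deriv (timeCutoff ε) p.1 * dirDeriv (1, 0) φ p)
          + W p * (timeCutoff ε p.1 * B p) := by
      intro p; simp only [hB]; ring
    simp only [e] at i1
    have hi24 : IntegrableOn (fun p =>
      W p * dirDeriv (1, 0) (fun p : ℝ × ℝ => deriv (timeCutoff ε) p.1 * φ p) p
          + W p * (deriv (timeCutoff ε) p.1 * dirDeriv (1, 0) φ p)) Ω := hi2.add hi4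
    rw [integral_add hi24 hi3, integral_add hi2 hi4, i2] at i1
    linarith
  -- the left hand side converges
  have hlim : Tendsto (fun ε => ∫ p in Ω, W p * (timeCutoff ε p.1 * B p)) (𝓝[>] 0)
      (𝓝 (∫ p in Ω, W p * B p)) := by
    refine tendsto_integral_filter_of_dominated_convergence (fun p => ‖W p‖ * CB) ?_ ?_
      (hW1.norm.mul_const CB) ?_
    · refine Eventually.of_forall fun ε => ?_
      exact hW1.aestronglyMeasurable.mul
        ((((timeCutoff_contDiff ε).continuous.measurable.comp measurable_fst).mul
          hBm).aestronglyMeasurable)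
    · refine Eventually.of_forall fun ε => (ae_restrict_iff' hΩo.measurableSet).2
        (ae_of_all _ fun p hp => ?_)
      rw [norm_mul, norm_mul]
      refine mul_le_mul_of_nonneg_left ?_ (norm_nonneg _)
      calc _ ≤ 1 * ‖B p‖ := mul_le_mul_of_nonneg_right (abs_timeCutoff_le _ _) (norm_nonneg _)
        _ ≤ CB := by rw [one_mul]; exact hCB p hp
    · refine (ae_restrict_iff' hΩo.measurableSet).2 (ae_of_all _ fun p hp => ?_)
      have hp1 : 0 < p.1 := (hρ.mem_Omega.1 hp).1
      refine tendsto_const_nhds.congr' ?_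
      filter_upwards [Ioo_mem_nhdsGT (show 0 < p.1 / 2 by positivity)] with ε hε
      rw [timeCutoff_eq_one hε.1 (by linarith [hε.2]), one_mul]
  -- the right hand side tends to zero
  have hset : ∀ ε, 0 < ε → 3 * ε < T → 3 * ε < ε₀ → ∀ (f ψ : ℝ × ℝ → ℝ), tsupport ψ ⊆ tsupport φ →
      ∫ p in Ω, f p * (deriv (timeCutoff ε) p.1 * ψ p) =
        ∫ p in Ioo 0 (3 * ε) ×ˢ Ioo 0 ρ₀, f p * (deriv (timeCutoff ε) p.1 * ψ p) := by
    intro ε hε hεT hεε f ψ hψ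
    refine setIntegral_eq_of_subset_of_forall_sdiff_eq_zero hΩo.measurableSet ?_ ?_
    · rintro p ⟨h1, h2⟩
      exact hρ.mem_Omega.2 ⟨h1.1, h1.2.trans hεT, h2.1,
        h2.2.trans_le ((hρ.isSlowFront hT hρ₀).le _)⟩
    · rintro p ⟨hp, hpn⟩
      by_cases hψp : ψ p = 0
      · simp [hψp]
      have hpK : p ∈ tsupport φ := hψ (subset_tsupport _ hψp)
      obtain ⟨h1, h2, h3, h4⟩ := hρ.mem_Omega.1 hp
      -- The layer has width `3 * ε` although `χ'` lives on `[ε, 2 * ε]`: this gives the strict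
      -- inequality `2 * ε < p.1` under which `χ' = 0` is available.
      have : 3 * ε ≤ p.1 := by
        by_contra! hlt
        exact hpn ⟨⟨h1, hlt⟩, h3, hsupp p hpK (hlt.trans hεε)⟩
      rw [deriv_timeCutoff_eq_zero hε (Or.inr (by linarith))]
      simp
  have hzero : Tendsto (fun ε => ∫ p in Ω, W p * (timeCutoff ε p.1 * B p)) (𝓝[>] 0) (𝓝 0) := by
    have hlim1 : Tendsto (fun ε => ∫ p in Ω, W p * (deriv (timeCutoff ε) p.1 * dirDeriv (1, 0) φ p))
        (𝓝[>] 0) (𝓝 0) := by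
      have ht3 : Tendsto (fun ε : ℝ => 3 * ε) (𝓝[>] 0) (𝓝[>] 0) := by
        refine tendsto_nhdsWithin_iff.2 ⟨?_, ?_⟩
        · have : Continuous (fun ε : ℝ => 3 * ε) := by fun_prop
          have := this.tendsto 0
          rw [mul_zero] at this
          exact this.mono_left nhdsWithin_le_nhds
        · filter_upwards [self_mem_nhdsWithin] with ε hε
          have : (0 : ℝ) < ε := hε
          simpa using this
      -- The bound `C / ε` on `χ'` is `3 * C` divided by the width `3 * ε` of the layer, so the
      -- integral is dominated by a constant times the mean of `|W|`.
      have hl := ENNReal.Tendsto.const_mul (a := ENNReal.ofReal (3 * C * D)) (hlayer.comp ht3)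
        (Or.inr (by simp))
      rw [mul_zero] at hl
      rw [tendsto_zero_iff_enorm_tendsto_zero]
      refine tendsto_of_tendsto_of_tendsto_of_le_of_le' tendsto_const_nhds hl
        (Eventually.of_forall fun _ => zero_le) ?_
      filter_upwards [Ioo_mem_nhdsGT (show 0 < min (T / 3) (ε₀ / 3) by positivity)] with ε hε
      have h1 : 3 * ε < T := by linarith [hε.2.trans_le (min_le_left _ _)]
      have h2 : 3 * ε < ε₀ := by linarith [hε.2.trans_le (min_le_right _ _)]
      have hε0 : 0 < ε := hε.1
      rw [hset ε hε0 h1 h2 W (dirDeriv (1, 0) φ) (tsupport_fderiv_apply_subset ℝ _)]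
      refine (enorm_integral_le_lintegral_enorm _).trans ?_
      have e : ENNReal.ofReal (3 * C * D) * ((∫⁻ p in Ioo 0 (3 * ε) ×ˢ Ioo 0 ρ₀, ‖W p‖ₑ)
          / ENNReal.ofReal (3 * ε)) =
          ∫⁻ p in Ioo 0 (3 * ε) ×ˢ Ioo 0 ρ₀, ENNReal.ofReal (C / ε * D) * ‖W p‖ₑ := by
        rw [lintegral_const_mul' _ _ (by simp), ← mul_div_assoc, mul_comm,
          mul_div_assoc, mul_comm, ← ENNReal.ofReal_div_of_pos (by positivity)]
        congr 2
        field_simp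
      simp only [Function.comp_def]
      rw [e]
      refine lintegral_mono fun p => ?_
      rw [enorm_mul, mul_comm]
      gcongr
      rw [← ofReal_norm, norm_mul]
      refine ENNReal.ofReal_le_ofReal ?_
      exact mul_le_mul (hC ε hε0 _) (hD p) (norm_nonneg _) (by positivity)
    have hlim2 : Tendsto (fun ε => ∫ p in Ω, Wt p * (deriv (timeCutoff ε) p.1 * φ p))
        (𝓝[>] 0) (𝓝 0) := by
      rw [Metric.tendsto_nhds]
      intro δ hδ
      -- Each slice contributes at most `C / ε * M` times this quantity, over a time interval of
      -- length `3 * ε`; the product stays below `δ`.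
      have hδ' : 0 < δ / (3 * (C + 1) * M + 1) := by positivity
      obtain ⟨η, hη, hηv⟩ := hvel _ hδ'
      filter_upwards [Ioo_mem_nhdsGT
        (show 0 < min (min (T / 3) (ε₀ / 3)) (η / 3) by positivity)] with ε hε
      have h1 : 3 * ε < T := by
        linarith [hε.2.trans_le ((min_le_left _ _).trans (min_le_left _ _))]
      have h2 : 3 * ε < ε₀ := by
        linarith [hε.2.trans_le ((min_le_left _ _).trans (min_le_right _ _))]
      have h3 : 3 * ε < η := by linarith [hε.2.trans_le (min_le_right _ _)]
      have hε0 : 0 < ε := hε.1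
      have hsub : Ioo 0 (3 * ε) ×ˢ Ioo 0 ρ₀ ⊆ Ω := by
        rintro p ⟨h4, h5⟩
        exact hρ.mem_Omega.2 ⟨h4.1, h4.2.trans h1, h5.1,
          h5.2.trans_le ((hρ.isSlowFront hT hρ₀).le _)⟩
      have hint : IntegrableOn (fun p => Wt p * (deriv (timeCutoff ε) p.1 * φ p))
          (Ioo 0 (3 * ε) ×ˢ Ioo 0 ρ₀) := by
        refine (hWt.mono_set hsub).mul_bdd (c := C / ε * D0) ?_ (ae_of_all _ fun p => ?_)
        · exact (((timeCutoff_contDiff ε).continuous_deriv (by simp)).measurable.comp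
            measurable_fst).mul hφ.continuous.measurable |>.aestronglyMeasurable
        · rw [norm_mul]
          exact mul_le_mul (hC ε hε0 _) (hDφ p) (norm_nonneg _) (by positivity)
      rw [hset ε hε0 h1 h2 Wt φ subset_rfl, dist_zero_right]
      have e := setIntegral_prod (μ := (volume : Measure ℝ)) (ν := (volume : Measure ℝ))
        (fun p : ℝ × ℝ => Wt p * (deriv (timeCutoff ε) p.1 * φ p)) hint
      rw [← Measure.volume_eq_prod] at e
      rw [e]
      have hb : ∀ᵐ t ∂(volume.restrict (Ioo 0 (3 * ε))),
          ‖∫ r in Ioo 0 ρ₀, Wt (t, r) * (deriv (timeCutoff ε) t * φ (t, r))‖ ≤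
            C / ε * (M * (δ / (3 * (C + 1) * M + 1))) := by
        refine (ae_restrict_iff' measurableSet_Ioo).2 ?_
        filter_upwards [hηv] with t ht htm
        have hts : IsTestFun (Ioo 0 ρ₀) (fun r => φ (t, r)) :=
          hφ.slice t fun r hr => ⟨(hφ.support hr).2.1, hsupp _ hr (htm.2.trans h2)⟩
        have := ht ⟨htm.1, htm.2.trans h3⟩ _ hts M hM0 (hM t)
        have e2 : ∀ r, Wt (t, r) * (deriv (timeCutoff ε) t * φ (t, r)) =
            deriv (timeCutoff ε) t * (Wt (t, r) * φ (t, r)) := fun r => by ring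
        simp only [e2]
        rw [integral_const_mul, norm_mul]
        exact mul_le_mul (hC ε hε0 t) this (norm_nonneg _) (by positivity)
      have hb2 := norm_integral_le_of_norm_le_const hb
      refine hb2.trans_lt ?_
      have e3 : (volume.restrict (Ioo 0 (3 * ε))).real univ = 3 * ε := by
        simp [Measure.real]; positivity
      rw [e3]
      have e4 : C / ε * (M * (δ / (3 * (C + 1) * M + 1))) * (3 * ε) =
          δ * (3 * C * M) / (3 * (C + 1) * M + 1) := by field_simp
      rw [e4, div_lt_iff₀ (by positivity)]
      have : 3 * C * M < 3 * (C + 1) * M + 1 := by nlinarith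
      exact mul_lt_mul_of_pos_left this hδ
    have := hlim2.sub hlim1
    rw [sub_zero] at this
    refine this.congr' ?_
    filter_upwards [self_mem_nhdsWithin] with ε hε
    exact (hid ε hε).symm
  exact tendsto_nhds_unique hlim hzero

end Extension

end Debonding

namespace Debonding

/-! ### Propagation of zero through a short time slab. -/

section Uniqueness

variable {T R ρ₀ : ℝ} {ρ : ℝ → ℝ}

lemma enorm_lineInt_lineInt_le {F F' : ℝ × ℝ → ℝ} (hFF : ∀ p, ‖F p‖ₑ ≤ ‖F' p‖ₑ) {s s' δ : ℝ}
    (hs : s ∈ Icc 0 δ) (hs' : s' ∈ Icc 0 δ) (v u : ℝ × ℝ) (p : ℝ × ℝ) :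
    ‖lineInt s v (lineInt s' u F) p‖ₑ ≤
      ∫⁻ τ in Icc 0 δ, ∫⁻ τ' in Icc 0 δ, ‖F' (p - τ • v - τ' • u)‖ₑ := by
  have sub : ∀ {s : ℝ}, s ∈ Icc 0 δ → Ioc 0 s ⊆ Icc 0 δ := fun hs x hx =>
    ⟨hx.1.le, hx.2.trans hs.2⟩
  rw [lineInt, intervalIntegral.integral_of_le hs.1]
  refine (enorm_integral_le_lintegral_enorm _).trans ((lintegral_mono_set (sub hs)).trans ?_)
  refine lintegral_mono fun τ => ?_
  rw [lineInt, intervalIntegral.integral_of_le hs'.1]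
  refine (enorm_integral_le_lintegral_enorm _).trans ((lintegral_mono_set (sub hs')).trans ?_)
  exact lintegral_mono fun τ' => hFF _

/-- If a solution with zero data vanishes up to the time `t₁`, it vanishes a little longer. -/
theorem vanishing_slab (hρ : IsFront T R ρ₀ ρ) (hT : 0 < T) (hρ₀ : 0 < ρ₀)
    {V : ℝ → ℝ} {VM : ℝ} (hVm : Measurable V) (hVM : 0 ≤ VM)
    (hV : ∀ p ∈ Omega T R ρ, |V p.2| ≤ VM)
    {W : ℝ × ℝ → ℝ} (hW0 : ∀ p, p ∉ Omega T R ρ → W p = 0) (hWm : Measurable W)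
    (hWi : Integrable W)
    (heq : ∀ φ, IsTestFun (pastDomain T (extendFront T ρ)) φ →
      ∫ p in pastDomain T (extendFront T ρ),
        W p * dirDeriv ((1 : ℝ), (-1 : ℝ)) (dirDeriv ((1 : ℝ), (1 : ℝ)) φ) p =
      ∫ p in pastDomain T (extendFront T ρ), (V p.2 * W p) * φ p)
    (hleft : Tendsto (fun η => (∫⁻ p in {p : ℝ × ℝ | 0 < p.2 ∧ p.2 < η}, ‖W p‖ₑ)
      / ENNReal.ofReal η) (𝓝[>] 0) (𝓝 0))
    (hfront : Tendsto (fun η => (∫⁻ p in {p : ℝ × ℝ | extendFront T ρ p.1 - η < p.2 ∧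
      p.2 < extendFront T ρ p.1}, ‖W p‖ₑ) / ENNReal.ofReal η) (𝓝[>] 0) (𝓝 0))
    {δ : ℝ} (hδ : 0 < δ) (hδρ : 2 * δ < ρ₀) (hδV : VM * δ ^ 2 ≤ 1 / 2) {t₁ : ℝ}
    (hz : ∀ᵐ p : ℝ × ℝ, p.1 < t₁ → W p = 0) :
    ∀ᵐ p : ℝ × ℝ, p.1 < t₁ + δ → W p = 0 := by
  set q := extendFront T ρ with hq
  have hs := hρ.isSlowFront hT hρ₀
  have hqc : Continuous q := hs.continuous
  set v : ℝ × ℝ := ((1 : ℝ), (1 : ℝ)) with hv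
  set u : ℝ × ℝ := ((1 : ℝ), (-1 : ℝ)) with hu
  set F : ℝ × ℝ → ℝ := fun p => V p.2 * W p with hF
  have hFm : Measurable F := (hVm.comp measurable_snd).mul hWm
  have hFb : ∀ p, ‖F p‖ ≤ VM * ‖W p‖ := by
    intro p
    by_cases hp : p ∈ Omega T R ρ
    · rw [hF, norm_mul]
      exact mul_le_mul_of_nonneg_right (hV p hp) (norm_nonneg _)
    · simp [hF, hW0 p hp]
  have hFi : Integrable F := Integrable.mono' (hWi.norm.const_mul VM) hFm.aestronglyMeasurable
    (ae_of_all _ hFb)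
  -- `M` dominates the double integral in the parallelogram identity for all sides `s, s' ≤ δ` at
  -- once.
  set M : ℝ × ℝ → ℝ≥0∞ :=
    fun p => ∫⁻ τ in Icc 0 δ, ∫⁻ τ' in Icc 0 δ, ‖F (p - τ • v - τ' • u)‖ₑ with hM
  have hMm : Measurable M := by
    have h1 : Measurable fun x : ((ℝ × ℝ) × ℝ) × ℝ => ‖F (x.1.1 - x.1.2 • v - x.2 • u)‖ₑ :=
      (hFm.comp (by fun_prop)).enorm
    exact (h1.lintegral_prod_right' (ν := volume.restrict (Icc 0 δ))).lintegral_prod_right'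
      (ν := volume.restrict (Icc 0 δ))
  -- For these points the whole parallelogram of sides `s`, `s'` stays in the domain. As `q` is
  -- nondecreasing and 1-Lipschitz, only the corner `p - s' • u` has to be compared with the front.
  set Vs : ℝ → ℝ → Set (ℝ × ℝ) := fun s s' => {p | p.1 < T ∧ s < p.2 ∧ p.2 + s' < q (p.1 - s')}
    with hVs
  have hpar : ∀ s ∈ Icc 0 δ, ∀ s' ∈ Icc 0 δ, ∀ᵐ p, p ∈ Vs s s' →
      ‖W p - W (p - s • v) - W (p - s' • u) + W (p - s • v - s' • u)‖ₑ ≤ M p := by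
    intro s hs1 s' hs1'
    have hVo : IsOpen (Vs s s') := by
      have h1 : Continuous fun p : ℝ × ℝ => q (p.1 - s') := by fun_prop
      exact (isOpen_lt continuous_fst continuous_const).inter
        ((isOpen_lt continuous_const continuous_snd).inter (isOpen_lt (by fun_prop) h1))
    have := ae_parallelogram_identity (isOpen_pastDomain hqc T) hVo (u := u) (v := v)
      hWi.integrableOn hFi.integrableOn heq hs1.1 hs1'.1 (by
        rintro ⟨t, r⟩ ⟨h1, h2, h3⟩ τ hτ τ' hτ'
        simp only [hv, hu, Prod.smul_mk, smul_eq_mul, mul_one, mul_neg, Prod.mk_sub_mk,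
          pastDomain, mem_ofPred_eq] at *
        refine ⟨by linarith [hτ.1, hτ'.1], by linarith [hτ.2, hτ'.1], ?_⟩
        have e1 := hs.mono (show t - s' ≤ t - τ' by linarith [hτ'.2])
        have e2 := hs.sub_le (show t - τ - τ' ≤ t - τ' by linarith [hτ.1])
        linarith [hτ'.2])
    filter_upwards [this] with p hp hpV
    rw [hp hpV]
    refine enorm_lineInt_lineInt_le (fun p => ?_) hs1 hs1' v u p
    by_cases h : p ∈ pastDomain T q <;> simp [h]
  have hzt : ∀ w : ℝ × ℝ, ∀ᵐ p : ℝ × ℝ, (p - w).1 < t₁ → W (p - w) = 0 := fun w =>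
    (measurePreserving_sub_right volume w).quasiMeasurePreserving.ae hz
  -- the three regions
  have hC : ∀ s ∈ Icc 0 δ, ∀ᵐ p : ℝ × ℝ, p.1 < t₁ + δ → p ∈ Vs s δ →
      ‖W p‖ₑ ≤ M p + ‖W (p - s • v)‖ₑ := by
    intro s hs1
    filter_upwards [hpar s hs1 δ ⟨hδ.le, le_rfl⟩, hzt (δ • u), hzt (s • v + δ • u)]
      with p h1 h2 h3 hp hpV
    -- The two corners shifted by `δ • u` lie before `t₁`, where `W` vanishes.
    have h4 := h1 hpV
    rw [sub_sub p] at h4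
    rw [h2 (by simp [hu]; linarith), h3 (by simp [hu, hv]; linarith [hs1.1]), sub_zero,
      add_zero] at h4
    have : W p = (W p - W (p - s • v)) + W (p - s • v) := by ring
    calc ‖W p‖ₑ = ‖(W p - W (p - s • v)) + W (p - s • v)‖ₑ := by rw [← this]
      _ ≤ _ := (enorm_add_le _ _).trans (add_le_add h4 le_rfl)
  have hB : ∀ s ∈ Icc 0 δ, ∀ᵐ p : ℝ × ℝ, p.1 < t₁ + δ → p ∈ Vs δ s →
      ‖W p‖ₑ ≤ M p + ‖W (p - s • u)‖ₑ := by
    intro s hs1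
    filter_upwards [hpar δ ⟨hδ.le, le_rfl⟩ s hs1, hzt (δ • v), hzt (δ • v + s • u)]
      with p h1 h2 h3 hp hpV
    have h4 := h1 hpV
    rw [sub_sub p (δ • v)] at h4
    rw [h2 (by simp [hv]; linarith), h3 (by simp [hu, hv]; linarith [hs1.1]), sub_zero,
      add_zero] at h4
    have : W p = (W p - W (p - s • u)) + W (p - s • u) := by ring
    calc ‖W p‖ₑ = ‖(W p - W (p - s • u)) + W (p - s • u)‖ₑ := by rw [← this]
      _ ≤ _ := (enorm_add_le _ _).trans (add_le_add h4 le_rfl)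
  have hA : ∀ᵐ p : ℝ × ℝ, p.1 < t₁ + δ → p ∈ Vs δ δ → ‖W p‖ₑ ≤ M p := by
    filter_upwards [hC δ ⟨hδ.le, le_rfl⟩, hzt (δ • v)] with p h1 h2 hp hpV
    have := h1 hp hpV
    rwa [h2 (by simp [hv]; linarith), enorm_zero, add_zero] at this
  -- Truncated subtraction: `‖W p‖ₑ - M p = 0` means `‖W p‖ₑ ≤ M p`, in the form required by
  -- `ae_eq_zero_of_layer`.
  have hkm : Measurable fun p => ‖W p‖ₑ - M p := hWm.enorm.sub hMm
  have hm1 : Measurable (fun p : ℝ × ℝ => p.1) := measurable_fst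
  have hm2 : Measurable (fun p : ℝ × ℝ => p.2) := measurable_snd
  -- Near `r = 0` the point `p - s • v` lies in the layer for `s ∈ (r - η, r)`. The lower bound `1 /
  -- (n + 1)` on `r` keeps these `s` positive, and `2 * δ < ρ₀` keeps the parallelogram behind the
  -- front.
  have hCz : ∀ n : ℕ, ∀ᵐ p : ℝ × ℝ, p ∈ {p : ℝ × ℝ | p.1 < t₁ + δ ∧ p.1 < T ∧ p.2 ≤ δ ∧
      1 / ((n : ℝ) + 1) ≤ p.2} → ‖W p‖ₑ - M p = 0 := by
    intro n
    have hn : (0 : ℝ) < 1 / ((n : ℝ) + 1) := by positivity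
    refine ae_eq_zero_of_layer (f := fun p => ‖W p‖ₑ) (k := fun p => ‖W p‖ₑ - M p)
      (V := fun s => Vs s δ) (L := fun η => {p | 0 < p.2 ∧ p.2 < η}) (S := δ)
      (η₀ := 1 / ((n : ℝ) + 1)) (c := 1) hkm one_pos hn v ?_ ?_ ?_ hleft ?_ ?_
    · exact (measurableSet_lt hm1 measurable_const).inter
        ((measurableSet_lt hm1 measurable_const).inter
        ((measurableSet_le hm2 measurable_const).inter (measurableSet_le measurable_const hm2)))
    · have h1 : Continuous fun p : (ℝ × ℝ) × ℝ => q (p.1.1 - δ) := by fun_prop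
      have o1 : IsOpen {x : (ℝ × ℝ) × ℝ | x.1.1 < T} := isOpen_lt (by fun_prop) (by fun_prop)
      have o2 : IsOpen {x : (ℝ × ℝ) × ℝ | x.2 < x.1.2} := isOpen_lt (by fun_prop) (by fun_prop)
      have o3 : IsOpen {x : (ℝ × ℝ) × ℝ | x.1.2 + δ < q (x.1.1 - δ)} := isOpen_lt (by fun_prop) h1
      exact (o1.inter (o2.inter o3)).measurableSet
    · exact fun η => (measurableSet_lt measurable_const hm2).inter
        (measurableSet_lt hm2 measurable_const)
    · intro s hs1
      filter_upwards [hC s (Ioo_subset_Icc_self hs1)] with p hp hpN hpV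
      exact tsub_le_iff_left.2 (hp hpN.1 hpV)
    · rintro ⟨t, r⟩ ⟨h1, h2, h3, h4⟩ η hη
      simp only at h1 h2 h3 h4
      have hsub : Ioo (r - η) r ⊆ {s | s ∈ Ioo 0 δ ∧ (t, r) ∈ Vs s δ ∧
          (t, r) - s • v ∈ {p : ℝ × ℝ | 0 < p.2 ∧ p.2 < η}} := by
        intro s hs1
        have hqt := hs.le (t - δ)
        refine ⟨⟨by linarith [hs1.1, hη.2], by linarith [hs1.2]⟩, ⟨h2, hs1.2, ?_⟩, ?_, ?_⟩
        · simp only; linarith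
        · simp [hv]; linarith [hs1.2]
        · simp [hv]; linarith [hs1.1]
      refine le_trans ?_ (measure_mono hsub)
      rw [Real.volume_Ioo]; simp
  have hBz : ∀ n : ℕ, ∀ᵐ p : ℝ × ℝ, p ∈ {p : ℝ × ℝ | p.1 < t₁ + δ ∧ p.1 < T ∧ δ < p.2 ∧
      q (p.1 - δ) ≤ p.2 + δ ∧ p.2 + 1 / ((n : ℝ) + 1) ≤ q p.1} → ‖W p‖ₑ - M p = 0 := by
    intro n
    have hn : (0 : ℝ) < 1 / ((n : ℝ) + 1) := by positivity
    refine ae_eq_zero_of_layer (f := fun p => ‖W p‖ₑ) (k := fun p => ‖W p‖ₑ - M p)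
      (V := fun s => Vs δ s) (L := fun η => {p | q p.1 - η < p.2 ∧ p.2 < q p.1}) (S := δ)
      (η₀ := 1 / ((n : ℝ) + 1)) (c := 1 / 2) hkm (by norm_num) hn u ?_ ?_ ?_ hfront ?_ ?_
    · have h1 : Measurable fun p : ℝ × ℝ => q (p.1 - δ) := hqc.measurable.comp (by fun_prop)
      have h2 : Measurable fun p : ℝ × ℝ => q p.1 := hqc.measurable.comp (by fun_prop)
      exact (measurableSet_lt hm1 measurable_const).inter
        ((measurableSet_lt hm1 measurable_const).inter
        ((measurableSet_lt measurable_const hm2).inter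
        ((measurableSet_le h1 (by fun_prop)).inter (measurableSet_le (by fun_prop) h2))))
    · have h1 : Continuous fun p : (ℝ × ℝ) × ℝ => q (p.1.1 - p.2) := by fun_prop
      have o1 : IsOpen {x : (ℝ × ℝ) × ℝ | x.1.1 < T} := isOpen_lt (by fun_prop) (by fun_prop)
      have o2 : IsOpen {x : (ℝ × ℝ) × ℝ | δ < x.1.2} := isOpen_lt (by fun_prop) (by fun_prop)
      have o3 : IsOpen {x : (ℝ × ℝ) × ℝ | x.1.2 + x.2 < q (x.1.1 - x.2)} :=
        isOpen_lt (by fun_prop) h1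
      exact (o1.inter (o2.inter o3)).measurableSet
    · intro η
      have h2 : Measurable fun p : ℝ × ℝ => q p.1 := hqc.measurable.comp (by fun_prop)
      exact (measurableSet_lt (h2.sub_const η) hm2).inter (measurableSet_lt hm2 h2)
    · intro s hs1
      filter_upwards [hB s (Ioo_subset_Icc_self hs1)] with p hp hpN hpV
      exact tsub_le_iff_left.2 (hp hpN.1 hpV)
    · rintro ⟨t, r⟩ ⟨h1, h2, h3, h4, h5⟩ η hη
      simp only at h1 h2 h3 h4 h5
      -- `l s` is the distance of `p - s • u` behind the front. It decreases at a rate of at most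
      -- `2`, so it stays in `(0, η)` on an interval of length at least `η / 2`; hence `c = 1 / 2`.
      set l : ℝ → ℝ := fun s => q (t - s) - (r + s) with hl
      have hlc : Continuous l := by fun_prop
      have hl0 : η < l 0 := by simp only [hl, sub_zero, add_zero]; linarith [hη.2]
      have hlδ : l δ ≤ 0 := by simp only [hl]; linarith
      have hlanti : StrictAnti l := by
        intro a b hab
        have := hs.mono (show t - b ≤ t - a by linarith)
        simp only [hl]; linarith
      obtain ⟨s2, hs2, e2⟩ := intermediate_value_Icc' hδ.le hlc.continuousOn
        (show (0 : ℝ) ∈ Icc (l δ) (l 0) from ⟨hlδ, by linarith [hη.1]⟩)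
      obtain ⟨s1, hs1, e1⟩ := intermediate_value_Icc' hs2.1 hlc.continuousOn
        (show η ∈ Icc (l s2) (l 0) from ⟨by rw [e2]; exact hη.1.le, hl0.le⟩)
      have hsub : Ioo s1 s2 ⊆ {s | s ∈ Ioo 0 δ ∧ (t, r) ∈ Vs δ s ∧
          (t, r) - s • u ∈ {p : ℝ × ℝ | q p.1 - η < p.2 ∧ p.2 < q p.1}} := by
        intro s hs3
        have k1 : 0 < l s := e2 ▸ hlanti hs3.2
        have k2 : l s < η := e1 ▸ hlanti hs3.1
        simp only [hl] at k1 k2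
        refine ⟨⟨hs1.1.trans_lt hs3.1, hs3.2.trans_le hs2.2⟩, ⟨h2, h3, ?_⟩, ?_, ?_⟩
        · simp only; linarith
        · simp [hu]; linarith
        · simp [hu]; linarith
      refine le_trans ?_ (measure_mono hsub)
      rw [Real.volume_Ioo]
      refine ENNReal.ofReal_le_ofReal ?_
      have k := hs.sub_le (show t - s2 ≤ t - s1 by linarith [hs1.2])
      simp only [hl] at e1 e2
      linarith
  have hmain : ∀ᵐ p : ℝ × ℝ, p.1 < t₁ + δ → ‖W p‖ₑ ≤ M p := by
    filter_upwards [hA, ae_all_iff.2 hBz, ae_all_iff.2 hCz] with p a1 a2 a3 hp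
    by_cases hpΩ : p ∈ Omega T R ρ
    · obtain ⟨-, h2, h3, h4⟩ := hρ.mem_Omega.1 hpΩ
      rcases le_or_gt p.2 δ with hc | hc
      · obtain ⟨n, hn⟩ := exists_nat_one_div_lt h3
        exact tsub_eq_zero_iff_le.1 (a3 n ⟨hp, h2, hc, hn.le⟩)
      rcases lt_or_ge (p.2 + δ) (q (p.1 - δ)) with hd | hd
      · exact a1 hp ⟨h2, hc, hd⟩
      · obtain ⟨n, hn⟩ := exists_nat_one_div_lt (sub_pos.2 h4)
        exact tsub_eq_zero_iff_le.1 (a2 n ⟨hp, h2, hc, hd, by linarith⟩)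
    · rw [hW0 p hpΩ, enorm_zero]; exact zero_le
  -- contraction in `L¹`
  set D : Set (ℝ × ℝ) := {p | p.1 < t₁ + δ} with hD
  have hDm : MeasurableSet D := measurableSet_lt hm1 measurable_const
  have hFle : ∀ p, ‖F p‖ₑ ≤ ENNReal.ofReal VM * ‖W p‖ₑ := by
    intro p
    rw [← ofReal_norm, ← ofReal_norm, ← ENNReal.ofReal_mul hVM]
    exact ENNReal.ofReal_le_ofReal (hFb p)
  have hI : ∫⁻ p in D, ‖W p‖ₑ ≤ ENNReal.ofReal (1 / 2) * ∫⁻ p in D, ‖W p‖ₑ := by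
    calc ∫⁻ p in D, ‖W p‖ₑ ≤ ∫⁻ p in D, M p :=
          lintegral_mono_ae ((ae_restrict_iff' hDm).2 hmain)
      _ = ∫⁻ τ in Icc 0 δ, ∫⁻ p in D, ∫⁻ τ' in Icc 0 δ, ‖F (p - τ • v - τ' • u)‖ₑ := by
          have h1 : Measurable fun x : ((ℝ × ℝ) × ℝ) × ℝ => ‖F (x.1.1 - x.1.2 • v - x.2 • u)‖ₑ :=
            (hFm.comp (by fun_prop)).enorm
          exact lintegral_lintegral_swap
            (h1.lintegral_prod_right' (ν := volume.restrict (Icc 0 δ))).aemeasurable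
      _ = ∫⁻ τ in Icc 0 δ, ∫⁻ τ' in Icc 0 δ, ∫⁻ p in D, ‖F (p - τ • v - τ' • u)‖ₑ := by
          refine lintegral_congr fun τ => ?_
          have h1 : Measurable fun x : (ℝ × ℝ) × ℝ => ‖F (x.1 - τ • v - x.2 • u)‖ₑ :=
            (hFm.comp (by fun_prop)).enorm
          exact lintegral_lintegral_swap h1.aemeasurable
      _ ≤ ∫⁻ τ in Icc 0 δ, ∫⁻ τ' in Icc 0 δ, ENNReal.ofReal VM * ∫⁻ p in D, ‖W p‖ₑ := by
          refine setLIntegral_mono' measurableSet_Icc fun τ hτ => ?_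
          refine setLIntegral_mono' measurableSet_Icc fun τ' hτ' => ?_
          rw [← lintegral_const_mul' _ _ (by simp), ← lintegral_indicator hDm,
            ← lintegral_indicator hDm]
          calc ∫⁻ p, D.indicator (fun p => ‖F (p - τ • v - τ' • u)‖ₑ) p
              ≤ ∫⁻ p, D.indicator (fun p => ENNReal.ofReal VM * ‖W p‖ₑ)
                  (p - (τ • v + τ' • u)) := by
                refine lintegral_mono fun p => ?_
                by_cases hp : p ∈ D
                · have hp' : p - (τ • v + τ' • u) ∈ D := by
                    simp only [hD, mem_ofPred_eq] at hp ⊢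
                    simp [hv, hu]; linarith [hτ.1, hτ'.1]
                  rw [indicator_of_mem hp, indicator_of_mem hp', sub_sub]
                  exact hFle _
                · rw [indicator_of_notMem hp]; exact zero_le
            _ = _ := lintegral_sub_right_eq_self _ _
      _ = ENNReal.ofReal (VM * δ ^ 2) * ∫⁻ p in D, ‖W p‖ₑ := by
          rw [lintegral_const, lintegral_const]
          simp only [Measure.restrict_apply, MeasurableSet.univ, univ_inter, Real.volume_Icc,
            sub_zero]
          rw [ENNReal.ofReal_mul hVM, ENNReal.ofReal_pow hδ.le]
          ring
      _ ≤ _ := by gcongr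
  have hfin : ∫⁻ p in D, ‖W p‖ₑ ≠ ⊤ :=
    ((setLIntegral_le_lintegral _ _).trans_lt hWi.hasFiniteIntegral).ne
  have hzero : ∫⁻ p in D, ‖W p‖ₑ = 0 := by
    by_contra hne
    have h2 : ENNReal.ofReal (1 / 2) * ∫⁻ p in D, ‖W p‖ₑ < 1 * ∫⁻ p in D, ‖W p‖ₑ :=
      ENNReal.mul_lt_mul_left hne hfin (by
        rw [← ENNReal.ofReal_one]; exact (ENNReal.ofReal_lt_ofReal_iff one_pos).2 (by norm_num))
    rw [one_mul] at h2
    exact absurd hI (not_le.2 h2)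
  rw [lintegral_eq_zero_iff hWm.enorm] at hzero
  filter_upwards [(ae_restrict_iff' hDm).1 hzero] with p hp hpD
  simpa using hp hpD

end Uniqueness

end Debonding

namespace Debonding

/-! ### Uniqueness of the solution. -/

section SolutionUnique

variable {T R ρ₀ α : ℝ} {ρ z h₀ h₁ : ℝ → ℝ}

lemma w12Norm_const_mul (a b : ℝ) {ψ : ℝ → ℝ} {U : Set ℝ} (hψ : IsTestFun U ψ) {c : ℝ}
    (hc : 0 ≤ c) : w12Norm a b (fun r => c * ψ r) = c * w12Norm a b ψ := by
  have e : ∀ r, deriv (fun r => c * ψ r) r = c * deriv ψ r := fun r =>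
    deriv_const_mul c ((hψ.smooth.differentiable (by simp)) r)
  simp only [w12Norm, e, mul_pow, integral_const_mul]
  rw [← mul_add, Real.sqrt_mul (sq_nonneg c), Real.sqrt_sq hc]

/-- By homogeneity: `M⁻¹ * ψ` is admissible in the supremum that defines the dual norm. -/
lemma abs_integral_le_of_wNegNorm_le {a b c M : ℝ} {f ψ : ℝ → ℝ} (hc : 0 ≤ c)
    (h : wNegNorm a b f ≤ ENNReal.ofReal c) (hψ : IsTestFun (Ioo a b) ψ) (hM : 0 < M)
    (hψM : w12Norm a b ψ ≤ M) : |∫ r in Ioo a b, f r * ψ r| ≤ M * c := by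
  have ht : IsTestFun (Ioo a b) (fun r => M⁻¹ * ψ r) :=
    ⟨contDiff_const.mul hψ.smooth, hψ.compact.mul_left,
      (closure_mono (Function.support_mul_subset_right _ _)).trans hψ.support⟩
  have h1 : w12Norm a b (fun r => M⁻¹ * ψ r) ≤ 1 := by
    rw [w12Norm_const_mul a b hψ (by positivity), inv_mul_le_iff₀ hM, mul_one]; exact hψM
  have h2 : ENNReal.ofReal |∫ r in Ioo a b, f r * (M⁻¹ * ψ r)| ≤ ENNReal.ofReal c := by
    refine le_trans ?_ h
    rw [wNegNorm]
    exact le_iSup_of_le _ (le_iSup_of_le ht (le_iSup_of_le h1 le_rfl))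
  rw [ENNReal.ofReal_le_ofReal_iff hc] at h2
  have e : ∀ r, f r * (M⁻¹ * ψ r) = M⁻¹ * (f r * ψ r) := fun r => by ring
  simp only [e] at h2
  rwa [integral_const_mul, abs_mul, abs_of_pos (inv_pos.2 hM), inv_mul_le_iff₀ hM] at h2

lemma potential_measurable (α R : ℝ) : Measurable (potential α R) := by
  unfold potential
  fun_prop

lemma abs_potential_le {r r₁ : ℝ} (hr : r ≤ r₁) (hr₁ : r₁ < R) :
    |potential α R r| ≤ (1 / 4) * (α ^ 2 + 1 / (R - r₁) ^ 2) := by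
  have h1 : 0 < R - r₁ := sub_pos.2 hr₁
  rw [potential, abs_of_nonneg (by positivity)]
  gcongr

lemma IsFront.abs_potential_le (hρ : IsFront T R ρ₀ ρ) (hT : 0 < T) (hρ₀ : 0 < ρ₀) {p : ℝ × ℝ}
    (hp : p ∈ Omega T R ρ) :
    |potential α R p.2| ≤ (1 / 4) * (α ^ 2 + 1 / (R - ρ T) ^ 2) :=
  Debonding.abs_potential_le
    ((hρ.mem_Omega.1 hp).2.2.2.le.trans (hρ.extendFront_le hT hρ₀ _)) (hρ.end_lt hT)

lemma IsFront.volume_Omega_lt_top (hρ : IsFront T R ρ₀ ρ) (hT : 0 < T) (hρ₀ : 0 < ρ₀) :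
    volume (Omega T R ρ) < ⊤ := by
  refine (measure_mono ?_).trans_lt (hρ.isCompact_closedDomain hT hρ₀).measure_lt_top
  rw [← hρ.closure_Omega hT hρ₀]
  exact subset_closure

/-- Passes from a boundary layer to the rectangle of its parameters. As `W` vanishes off `U`, only
the points of the layer in `U` need parameters in `B`. -/
lemma lintegral_layer_le {W : ℝ × ℝ → ℝ} (hW : Measurable W) {U L B : Set (ℝ × ℝ)}
    (hW0 : ∀ p, p ∉ U → W p = 0) (hB : MeasurableSet B) (hL : MeasurableSet L)
    {γ : ℝ × ℝ → ℝ × ℝ} (hγ : MeasurePreserving γ)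
    (h : ∀ p, γ p ∈ L → γ p ∈ U → p ∈ B) :
    ∫⁻ p in L, ‖W p‖ₑ ≤ ∫⁻ p in B, ‖W (γ p)‖ₑ := by
  rw [← lintegral_indicator hL, ← lintegral_indicator hB,
    ← hγ.lintegral_comp (hW.enorm.indicator hL)]
  refine lintegral_mono fun p => ?_
  by_cases h1 : γ p ∈ L
  · by_cases h2 : γ p ∈ U
    · rw [indicator_of_mem h1, indicator_of_mem (h p h1 h2)]
    · rw [indicator_of_mem h1, hW0 _ h2, enorm_zero]; exact zero_le
  · rw [indicator_of_notMem h1]; exact zero_le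

/-- Solutions are unique. -/
theorem IsSolution.unique (hρ : IsFront T R ρ₀ ρ) (hT : 0 < T) (hρ₀ : 0 < ρ₀)
    (hz : AEStronglyMeasurable z (volume.restrict (Ioo 0 T)))
    (hh₀ : AEStronglyMeasurable h₀ (volume.restrict (Ioo 0 ρ₀)))
    (hh₁ : MemLp h₁ 2 (volume.restrict (Ioo 0 ρ₀))) {h h' : ℝ × ℝ → ℝ}
    (hs : IsSolution T R ρ₀ α ρ z h₀ h₁ h) (hs' : IsSolution T R ρ₀ α ρ z h₀ h₁ h') :
    h' =ᵐ[volume.restrict (Omega T R ρ)] h := by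
  obtain ⟨ht, hr, hW, heq, hl, hf, hb, hv⟩ := hs
  obtain ⟨ht', hr', hW', heq', hl', hf', hb', hv'⟩ := hs'
  set Ω := Omega T R ρ with hΩ
  set q := extendFront T ρ with hq
  have hsl := hρ.isSlowFront hT hρ₀
  have hqc : Continuous q := hsl.continuous
  have hΩo : IsOpen Ω := hρ.isOpen_Omega hT hρ₀
  have hΩm := hΩo.measurableSet
  have : IsFiniteMeasure (volume.restrict Ω) :=
    ⟨by rw [Measure.restrict_apply_univ]; exact hρ.volume_Omega_lt_top hT hρ₀⟩
  have int : ∀ {f : ℝ × ℝ → ℝ}, MemLp f 2 (volume.restrict Ω) → IntegrableOn f Ω :=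
    fun hf => hf.integrable (by norm_num)
  set H := hW.memLp.1.mk h with hH
  set H' := hW'.memLp.1.mk h' with hH'
  have eH : ∀ᵐ p, p ∈ Ω → h p = H p := (ae_restrict_iff' hΩm).1 hW.memLp.1.ae_eq_mk
  have eH' : ∀ᵐ p, p ∈ Ω → h' p = H' p := (ae_restrict_iff' hΩm).1 hW'.memLp.1.ae_eq_mk
  set W : ℝ × ℝ → ℝ := Ω.indicator fun p => H' p - H p with hWdef
  have hWm : Measurable W := ((hW'.memLp.1.stronglyMeasurable_mk.measurable).sub
    (hW.memLp.1.stronglyMeasurable_mk.measurable)).indicator hΩm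
  have hW0 : ∀ p, p ∉ Ω → W p = 0 := fun p hp => indicator_of_notMem hp _
  have hWe : ∀ᵐ p, p ∈ Ω → W p = h' p - h p := by
    filter_upwards [eH, eH'] with p h1 h2 hp
    rw [hWdef, indicator_of_mem hp, h1 hp, h2 hp]
  have hWer : ∀ᵐ p ∂volume.restrict Ω, W p = h' p - h p := (ae_restrict_iff' hΩm).2 hWe
  have hWi : Integrable W := by
    have h1 : IntegrableOn W Ω := ((int hW'.memLp).sub (int hW.memLp)).congr
      (by filter_upwards [hWer] with p hp using hp.symm)
    rwa [← integrable_indicator_iff hΩm, indicator_indicator, inter_self] at h1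
  have mulint : ∀ {f ψ : ℝ × ℝ → ℝ}, MemLp f 2 (volume.restrict Ω) → Measurable ψ →
      (∃ C, ∀ p ∈ Ω, ‖ψ p‖ ≤ C) → IntegrableOn (fun p => f p * ψ p) Ω := by
    rintro f ψ hf hψ ⟨C, hC⟩
    exact (int hf).mul_bdd (c := C) hψ.aestronglyMeasurable
      ((ae_restrict_iff' hΩm).2 (ae_of_all _ hC))
  have hweak : HasWeakDeriv Ω (1, 0) W (fun p => ht' p - ht p) := by
    intro φ hφ
    have b1 := (hφ.dirDeriv (1, 0)).bounded
    have b2 := hφ.bounded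
    have m1 := (hφ.dirDeriv (1, 0)).continuous.measurable
    have m2 := hφ.continuous.measurable
    obtain ⟨c1, -, k1⟩ := b1
    obtain ⟨c2, -, k2⟩ := b2
    have e1 := hW.weak_t φ hφ
    have e2 := hW'.weak_t φ hφ
    calc ∫ p in Ω, W p * dirDeriv (1, 0) φ p
        = ∫ p in Ω, (h' p * dirDeriv (1, 0) φ p - h p * dirDeriv (1, 0) φ p) := by
          refine integral_congr_ae ?_
          filter_upwards [hWer] with p hp
          rw [hp]; ring
      _ = -∫ p in Ω, (ht' p * φ p - ht p * φ p) := by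
          rw [integral_sub (mulint hW'.memLp m1 ⟨c1, fun p _ => k1 p⟩)
            (mulint hW.memLp m1 ⟨c1, fun p _ => k1 p⟩), e1, e2,
            integral_sub (mulint hW'.memLp_t m2 ⟨c2, fun p _ => k2 p⟩)
            (mulint hW.memLp_t m2 ⟨c2, fun p _ => k2 p⟩)]
          ring
      _ = _ := by simp only [sub_mul]
  set VM : ℝ := (1 / 4) * (α ^ 2 + 1 / (R - ρ T) ^ 2) with hVM
  have hVM0 : 0 ≤ VM := by positivity
  have hV : ∀ p ∈ Ω, |potential α R p.2| ≤ VM := fun p hp => hρ.abs_potential_le hT hρ₀ hp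
  have heqW : ∀ φ, IsTestFun Ω φ → ∫ p in Ω, W p *
        (dirDeriv (1, 0) (dirDeriv (1, 0) φ) p - dirDeriv (0, 1) (dirDeriv (0, 1) φ) p
          - potential α R p.2 * φ p) = 0 := by
    intro φ hφ
    obtain ⟨c1, -, k1⟩ := ((hφ.dirDeriv (1, 0)).dirDeriv (1, 0)).bounded
    obtain ⟨c2, -, k2⟩ := ((hφ.dirDeriv (0, 1)).dirDeriv (0, 1)).bounded
    obtain ⟨c3, -, k3⟩ := hφ.bounded
    have m1 := ((hφ.dirDeriv (1, 0)).dirDeriv (1, 0)).continuous.measurable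
    have m2 := ((hφ.dirDeriv (0, 1)).dirDeriv (0, 1)).continuous.measurable
    have m3 := hφ.continuous.measurable
    have mB : Measurable fun p : ℝ × ℝ => dirDeriv (1, 0) (dirDeriv (1, 0) φ) p
        - dirDeriv (0, 1) (dirDeriv (0, 1) φ) p - potential α R p.2 * φ p :=
      (m1.sub m2).sub (((potential_measurable α R).comp measurable_snd).mul m3)
    have bB : ∃ C, ∀ p ∈ Ω, ‖dirDeriv (1, 0) (dirDeriv (1, 0) φ) p
        - dirDeriv (0, 1) (dirDeriv (0, 1) φ) p - potential α R p.2 * φ p‖ ≤ C := by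
      refine ⟨c1 + c2 + VM * c3, fun p hp => ?_⟩
      refine (norm_sub_le _ _).trans (add_le_add ((norm_sub_le _ _).trans
        (add_le_add (k1 p) (k2 p))) ?_)
      rw [norm_mul]
      exact mul_le_mul (hV p hp) (k3 p) (norm_nonneg _) hVM0
    have e1 := heq φ hφ
    have e2 := heq' φ hφ
    have e3 := integral_sub (mulint hW'.memLp mB bB) (mulint hW.memLp mB bB)
    rw [e1, e2, sub_zero] at e3
    refine Eq.trans (integral_congr_ae ?_) e3
    filter_upwards [hWer] with p hp
    rw [hp]; ring
  -- the layers
  have lay1 := layer_tendsto (W := W) (γ := fun ε t => (t, ε)) hΩm hρ₀ hW.memLp.1 hW'.memLp.1 hz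
    (Measure.measurePreserving_swap (μ := (volume : Measure ℝ))
      (ν := (volume : Measure ℝ))).quasiMeasurePreserving
    (fun ε hε s hs => hρ.mem_Omega.2 ⟨hs.1, hs.2, hε.1, hε.2.trans_le (hsl.le _)⟩) hl hl' hWm hWe
  -- A shear followed by a reflection: the parallel curves behind the front flatten it without
  -- changing areas.
  have hγ2 : MeasurePreserving (fun p : ℝ × ℝ => (p.2, q p.2 - p.1)) := by
    have h1 : MeasurePreserving (fun p : ℝ × ℝ => (p.1, q p.1 - p.2))
        ((volume : Measure ℝ).prod volume) ((volume : Measure ℝ).prod volume) := by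
      refine MeasurePreserving.skew_product (f := id) (g := fun t ε => q t - ε)
        (MeasurePreserving.id _) ?_ (ae_of_all _ fun t => ?_)
      · exact ((hqc.comp continuous_fst).sub continuous_snd).measurable
      · exact (Measure.measurePreserving_sub_left volume (q t)).map_eq
    exact h1.comp Measure.measurePreserving_swap
  have toq : ∀ {f : ℝ × ℝ → ℝ}, HasTrace 0 T (fun ε t => (t, ρ t - ε)) f (fun _ => 0) →
      HasTrace 0 T (fun ε t => (t, q t - ε)) f (fun _ => 0) := by
    intro f hf
    refine hf.congr fun ε => ?_
    refine eLpNorm_congr_ae ((ae_restrict_iff' measurableSet_Ioo).2 (ae_of_all _ fun t ht => ?_))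
    simp only [hq, extendFront_of_mem (Ioo_subset_Icc_self ht)]
  have lay2 := layer_tendsto (W := W) (γ := fun ε t => (t, q t - ε)) hΩm hρ₀ hW.memLp.1
    hW'.memLp.1 aestronglyMeasurable_const hγ2.quasiMeasurePreserving
    (fun ε hε s hs => hρ.mem_Omega.2 ⟨hs.1, hs.2, by
      have := hsl.le s; simp only; linarith [hε.2], by simp only [← hq]; linarith [hε.1]⟩)
    (toq hf) (toq hf') hWm hWe
  have lay3 := layer_tendsto (W := W) (γ := fun ε r => (ε, r)) hΩm hT hW.memLp.1
    hW'.memLp.1 hh₀ (MeasurePreserving.id (volume : Measure (ℝ × ℝ))).quasiMeasurePreserving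
    (fun ε hε s hs => hρ.mem_Omega.2 ⟨hε.1, hε.2, hs.1, hs.2.trans_le (hsl.le _)⟩) hb hb' hWm hWe
  have hm1 : Measurable (fun p : ℝ × ℝ => p.1) := measurable_fst
  have hm2 : Measurable (fun p : ℝ × ℝ => p.2) := measurable_snd
  have hmq : Measurable (fun p : ℝ × ℝ => q p.1) := hqc.measurable.comp hm1
  have hleft : Tendsto (fun η => (∫⁻ p in {p : ℝ × ℝ | 0 < p.2 ∧ p.2 < η}, ‖W p‖ₑ)
      / ENNReal.ofReal η) (𝓝[>] 0) (𝓝 0) := by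
    refine tendsto_of_tendsto_of_tendsto_of_le_of_le tendsto_const_nhds lay1
      (fun _ => zero_le) (fun η => ENNReal.div_le_div_right ?_ _)
    refine lintegral_layer_le hWm hW0 (measurableSet_Ioo.prod measurableSet_Ioo)
      ((measurableSet_lt measurable_const hm2).inter (measurableSet_lt hm2 measurable_const))
      (γ := Prod.swap) Measure.measurePreserving_swap ?_
    rintro ⟨ε, t⟩ h1 h2
    obtain ⟨k1, k2, -, -⟩ := hρ.mem_Omega.1 h2
    exact ⟨h1, k1, k2⟩
  have hfront : Tendsto (fun η => (∫⁻ p in {p : ℝ × ℝ | q p.1 - η < p.2 ∧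
      p.2 < q p.1}, ‖W p‖ₑ) / ENNReal.ofReal η) (𝓝[>] 0) (𝓝 0) := by
    refine tendsto_of_tendsto_of_tendsto_of_le_of_le tendsto_const_nhds lay2
      (fun _ => zero_le) (fun η => ENNReal.div_le_div_right ?_ _)
    refine lintegral_layer_le hWm hW0 (measurableSet_Ioo.prod measurableSet_Ioo)
      ((measurableSet_lt (hmq.sub_const η) hm2).inter (measurableSet_lt hm2 hmq)) hγ2 ?_
    rintro ⟨ε, t⟩ ⟨h1, h1'⟩ h2
    obtain ⟨k1, k2, -, -⟩ := hρ.mem_Omega.1 h2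
    have h3 : q t - η < q t - ε := h1
    have h4 : q t - ε < q t := h1'
    exact ⟨⟨by simp only; linarith, by simp only; linarith⟩, k1, k2⟩
  -- The exceptional times do not depend on `ψ`, because the dual norm is already a supremum over
  -- test functions.
  have hvel : ∀ δ > 0, ∃ η > 0, ∀ᵐ t : ℝ, t ∈ Ioo 0 η → ∀ ψ, IsTestFun (Ioo 0 ρ₀) ψ →
      ∀ M > 0, w12Norm 0 ρ₀ ψ ≤ M → |∫ r in Ioo 0 ρ₀, (ht' (t, r) - ht (t, r)) * ψ r| ≤ M * δ := by
    intro δ hδ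
    have slices : ∀ {f : ℝ × ℝ → ℝ}, IntegrableOn f Ω →
        ∀ᵐ t : ℝ, t ∈ Ioo 0 T → IntegrableOn (fun r => f (t, r)) (Ioo 0 ρ₀) := by
      intro f hf
      have h1 : IntegrableOn f (Ioo 0 T ×ˢ Ioo 0 ρ₀) := hf.mono_set (by
        rintro p ⟨h1, h2⟩
        exact hρ.mem_Omega.2 ⟨h1.1, h1.2, h2.1, h2.2.trans_le (hsl.le _)⟩)
      rw [IntegrableOn, Measure.volume_eq_prod, ← Measure.prod_restrict] at h1
      exact (ae_restrict_iff' measurableSet_Ioo).1 h1.prod_right_ae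
    obtain ⟨η, hη, hη2⟩ := eventually_essZeroRight
      ((ENNReal.tendsto_nhds_zero.1 hv (ENNReal.ofReal (δ / 2)) (by simpa using hδ)).and
      (ENNReal.tendsto_nhds_zero.1 hv' (ENNReal.ofReal (δ / 2)) (by simpa using hδ)))
    refine ⟨min η T, lt_min hη hT, ?_⟩
    filter_upwards [hη2, slices (int hW.memLp_t), slices (int hW'.memLp_t)] with t k1 k2 k3 htm
      ψ hψ M hM hψM
    obtain ⟨l1, l2⟩ := k1 ⟨htm.1, htm.2.trans_le (min_le_left _ _)⟩
    have htT : t ∈ Ioo 0 T := ⟨htm.1, htm.2.trans_le (min_le_right _ _)⟩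
    have a1 := abs_integral_le_of_wNegNorm_le (by positivity) l1 hψ hM hψM
    have a2 := abs_integral_le_of_wNegNorm_le (by positivity) l2 hψ hM hψM
    have i1 : IntegrableOn h₁ (Ioo 0 ρ₀) := hh₁.integrable (by norm_num)
    obtain ⟨c, -, hc⟩ := hψ.bounded
    have mi : ∀ {f : ℝ → ℝ}, IntegrableOn f (Ioo 0 ρ₀) →
        IntegrableOn (fun r => f r * ψ r) (Ioo 0 ρ₀) := fun hf =>
      hf.mul_bdd (c := c) hψ.continuous.aestronglyMeasurable (ae_of_all _ hc)
    have e : ∫ r in Ioo 0 ρ₀, (ht' (t, r) - ht (t, r)) * ψ r =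
        (∫ r in Ioo 0 ρ₀, (ht' (t, r) - h₁ r) * ψ r)
          - ∫ r in Ioo 0 ρ₀, (ht (t, r) - h₁ r) * ψ r := by
      have j1 : IntegrableOn (fun r => (ht' (t, r) - h₁ r) * ψ r) (Ioo 0 ρ₀) :=
        mi ((k3 htT).sub i1)
      have j2 : IntegrableOn (fun r => (ht (t, r) - h₁ r) * ψ r) (Ioo 0 ρ₀) :=
        mi ((k2 htT).sub i1)
      rw [← integral_sub j1 j2]
      congr 1
      ext r
      ring
    rw [e]
    refine (abs_sub _ _).trans ?_
    linarith
  -- the extended equation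
  have hext : ∀ φ, IsTestFun (pastDomain T q) φ →
      ∫ p in pastDomain T q,
        W p * dirDeriv ((1 : ℝ), (-1 : ℝ)) (dirDeriv ((1 : ℝ), (1 : ℝ)) φ) p =
      ∫ p in pastDomain T q, (potential α R p.2 * W p) * φ p := by
    intro φ hφ
    have key := weak_eq_extend hρ hT hρ₀ (potential_measurable α R) hV hWi
      ((int hW'.memLp_t).sub (int hW.memLp_t)) hweak heqW lay3 hvel hφ
    obtain ⟨c1, -, k1⟩ := ((hφ.dirDeriv (1, 1)).dirDeriv (1, -1)).bounded
    obtain ⟨c3, -, k3⟩ := hφ.bounded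
    have m1 := ((hφ.dirDeriv (1, 1)).dirDeriv (1, -1)).continuous.measurable
    have m3 := hφ.continuous.measurable
    have hsub : Ω ⊆ pastDomain T q := fun p hp => by
      obtain ⟨-, j2, j3, j4⟩ := hρ.mem_Omega.1 hp
      exact ⟨j2, j3, j4⟩
    have hPm : MeasurableSet (pastDomain T q) := (isOpen_pastDomain hqc T).measurableSet
    have r1 : ∫ p in pastDomain T q,
        W p * dirDeriv ((1 : ℝ), (-1 : ℝ)) (dirDeriv ((1 : ℝ), (1 : ℝ)) φ) p =
        ∫ p in Ω, W p * dirDeriv ((1 : ℝ), (-1 : ℝ)) (dirDeriv ((1 : ℝ), (1 : ℝ)) φ) p :=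
      setIntegral_eq_of_subset_of_forall_sdiff_eq_zero hPm hsub
        fun p hp => by rw [hW0 p hp.2, zero_mul]
    have r2 : ∫ p in pastDomain T q, (potential α R p.2 * W p) * φ p =
        ∫ p in Ω, (potential α R p.2 * W p) * φ p :=
      setIntegral_eq_of_subset_of_forall_sdiff_eq_zero hPm hsub
        fun p hp => by rw [hW0 p hp.2, mul_zero, zero_mul]
    rw [r1, r2, ← sub_eq_zero]
    have i1 : IntegrableOn (fun p => W p *
        dirDeriv ((1 : ℝ), (-1 : ℝ)) (dirDeriv ((1 : ℝ), (1 : ℝ)) φ) p) Ω :=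
      hWi.integrableOn.mul_bdd (c := c1) m1.aestronglyMeasurable (ae_of_all _ k1)
    have i2 : IntegrableOn (fun p => (potential α R p.2 * W p) * φ p) Ω := by
      have : IntegrableOn (fun p => W p * (potential α R p.2 * φ p)) Ω := by
        refine hWi.integrableOn.mul_bdd (c := VM * c3)
          (((potential_measurable α R).comp hm2).mul m3).aestronglyMeasurable
          ((ae_restrict_iff' hΩm).2 (ae_of_all _ fun p hp => ?_))
        rw [norm_mul]
        exact mul_le_mul (hV p hp) (k3 p) (norm_nonneg _) hVM0
      refine this.congr (ae_of_all _ fun p => ?_)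
      simp only; ring
    rw [← integral_sub i1 i2, ← key]
    congr 1
    ext p
    rw [dirDeriv_char_eq hφ.smooth]
    ring
  -- steps in time
  obtain ⟨δ, hδ, hδρ, hδV⟩ : ∃ δ > 0, 2 * δ < ρ₀ ∧ VM * δ ^ 2 ≤ 1 / 2 := by
    -- The second entry ensures `δ ≤ 1` and `VM * δ ≤ 1 / 2`, hence the bound on `VM * δ ^ 2`.
    refine ⟨min (ρ₀ / 3) (1 / (2 * VM + 1)), by positivity, ?_, ?_⟩
    · linarith [min_le_left (ρ₀ / 3) (1 / (2 * VM + 1))]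
    · set d := min (ρ₀ / 3) (1 / (2 * VM + 1)) with hd
      have d1 : d ≤ 1 / (2 * VM + 1) := min_le_right _ _
      have d0 : 0 ≤ d := by positivity
      have d2 : d * (2 * VM + 1) ≤ 1 := by rwa [← le_div_iff₀ (by positivity)]
      have d3 : d ≤ 1 := by nlinarith
      nlinarith [mul_nonneg hVM0 d0]
  have hall : ∀ n : ℕ, ∀ᵐ p : ℝ × ℝ, p.1 < n * δ → W p = 0 := by
    intro n
    induction n with
    | zero =>
      refine ae_of_all _ fun p hp => hW0 p fun hpΩ => ?_
      have := (hρ.mem_Omega.1 hpΩ).1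
      simp at hp; linarith
    | succ n ih =>
      have := vanishing_slab hρ hT hρ₀ (potential_measurable α R) hVM0 hV hW0 hWm hWi hext hleft
        hfront hδ hδρ hδV ih
      push_cast
      rwa [add_one_mul]
  have hfin : ∀ᵐ p : ℝ × ℝ, W p = 0 := by
    filter_upwards [ae_all_iff.2 hall] with p hp
    obtain ⟨n, hn⟩ := exists_nat_gt (p.1 / δ)
    exact hp n (by rwa [div_lt_iff₀ hδ] at hn)
  rw [EventuallyEq, ae_restrict_iff' hΩm]
  filter_upwards [hfin, hWe] with p h1 h2 hp
  have := h2 hp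
  rw [h1] at this
  linarith

end SolutionUnique

end Debonding

namespace Debonding

/-! ### Quadrant integrals in characteristic coordinates. -/

section CharacteristicIntegral

/-- A bounded function of the characteristic coordinates `(x, y) = (t - r, t + r)`, with bounded
support, which is continuous at almost every point of each coordinate line. -/
structure IsSource (K M : ℝ) (Φ : ℝ × ℝ → ℝ) : Prop where
  K_nonneg : 0 ≤ K
  M_nonneg : 0 ≤ M
  measurable : Measurable Φ
  bound : ∀ p, |Φ p| ≤ M
  fst_mem : ∀ p, Φ p ≠ 0 → |p.1| ≤ K
  snd_mem : ∀ p, Φ p ≠ 0 → |p.2| ≤ K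
  continuousAt_snd : ∀ x, ∀ᵐ y : ℝ, ContinuousAt Φ (x, y)
  continuousAt_fst : ∀ y, ∀ᵐ x : ℝ, ContinuousAt Φ (x, y)

/-- The integral of `Φ` along the half line `{x} × (-∞, y]`. -/
def rowInt (Φ : ℝ × ℝ → ℝ) (x y : ℝ) : ℝ := ∫ η in Iic y, Φ (x, η)

/-- The integral of `Φ` along the half line `(-∞, x] × {y}`. -/
def colInt (Φ : ℝ × ℝ → ℝ) (x y : ℝ) : ℝ := ∫ ξ in Iic x, Φ (ξ, y)

/-- The integral of `Φ` over the quadrant `(-∞, x] × (-∞, y]`. -/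
def quadInt (Φ : ℝ × ℝ → ℝ) (x y : ℝ) : ℝ := ∫ p in Iic x ×ˢ Iic y, Φ p

variable {K M : ℝ} {Φ : ℝ × ℝ → ℝ}

lemma IsSource.swap (h : IsSource K M Φ) : IsSource K M (Φ ∘ Prod.swap) where
  K_nonneg := h.K_nonneg
  M_nonneg := h.M_nonneg
  measurable := h.measurable.comp measurable_swap
  bound p := h.bound _
  fst_mem p hp := h.snd_mem _ hp
  snd_mem p hp := h.fst_mem _ hp
  continuousAt_snd x := by
    filter_upwards [h.continuousAt_fst x] with y hy
    exact ContinuousAt.comp (f := Prod.swap) (g := Φ) (x := (x, y)) hy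
      continuous_swap.continuousAt
  continuousAt_fst x := by
    filter_upwards [h.continuousAt_snd x] with y hy
    exact ContinuousAt.comp (f := Prod.swap) (g := Φ) (x := (y, x)) hy
      continuous_swap.continuousAt

lemma IsSource.norm_le_indicator (h : IsSource K M Φ) (x η : ℝ) :
    ‖Φ (x, η)‖ ≤ (Icc (-K) K).indicator (fun _ => M) η := by
  by_cases h0 : Φ (x, η) = 0
  · rw [h0, norm_zero]
    exact indicator_nonneg (fun _ _ => h.M_nonneg) _
  · rw [indicator_of_mem (show η ∈ Icc (-K) K from abs_le.1 (h.snd_mem _ h0))]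
    exact h.bound _

lemma integrable_indicator_Icc_const (K M : ℝ) :
    Integrable ((Icc (-K) K).indicator (fun _ => M)) :=
  (integrable_indicator_iff measurableSet_Icc).2 (integrableOn_const (by simp))

lemma IsSource.integrable_row (h : IsSource K M Φ) (x : ℝ) : Integrable fun η => Φ (x, η) :=
  (integrable_indicator_Icc_const K M).mono'
    (h.measurable.comp measurable_prodMk_left).aestronglyMeasurable
    (ae_of_all _ (h.norm_le_indicator x))

lemma IsSource.integrable (h : IsSource K M Φ) : Integrable Φ := by
  have h1 : Integrable ((Icc (-K) K ×ˢ Icc (-K) K).indicator fun _ : ℝ × ℝ => M) :=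
    (integrable_indicator_iff (measurableSet_Icc.prod measurableSet_Icc)).2
      (integrableOn_const (isCompact_Icc.prod isCompact_Icc).measure_lt_top.ne)
  refine h1.mono' h.measurable.aestronglyMeasurable (ae_of_all _ fun p => ?_)
  by_cases h0 : Φ p = 0
  · rw [h0, norm_zero]
    exact indicator_nonneg (fun _ _ => h.M_nonneg) _
  · rw [indicator_of_mem (by exact ⟨abs_le.1 (h.fst_mem _ h0), abs_le.1 (h.snd_mem _ h0)⟩)]
    exact h.bound _

lemma IsSource.abs_rowInt_le (h : IsSource K M Φ) (x y : ℝ) : |rowInt Φ x y| ≤ 2 * K * M := by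
  calc |rowInt Φ x y| ≤ ∫ η in Iic y, ‖Φ (x, η)‖ := by
        rw [rowInt, ← Real.norm_eq_abs]
        exact norm_integral_le_integral_norm _
    _ ≤ ∫ η, ‖Φ (x, η)‖ := setIntegral_le_integral (h.integrable_row x).norm
        (ae_of_all _ fun _ => norm_nonneg _)
    _ ≤ ∫ η, (Icc (-K) K).indicator (fun _ => M) η :=
        integral_mono (h.integrable_row x).norm (integrable_indicator_Icc_const K M)
          (h.norm_le_indicator x)
    _ = 2 * K * M := by
        rw [integral_indicator measurableSet_Icc, setIntegral_const, smul_eq_mul,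
          Real.volume_real_Icc_of_le (by linarith [h.K_nonneg])]
        ring

/-- Dominated convergence: `continuousAt_snd` gives convergence of the integrand at almost every
`η`, although `Φ` may jump. This is what makes `quadInt` of class `C¹` rather than only Lipschitz.
-/
lemma IsSource.continuous_rowInt (h : IsSource K M Φ) :
    Continuous fun p : ℝ × ℝ => rowInt Φ p.1 p.2 := by
  have e : (fun p : ℝ × ℝ => rowInt Φ p.1 p.2) =
      fun p : ℝ × ℝ => ∫ η, (Iic p.2).indicator (fun η => Φ (p.1, η)) η := by
    ext p
    rw [integral_indicator measurableSet_Iic, rowInt]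
  rw [e, continuous_iff_continuousAt]
  rintro ⟨x₀, y₀⟩
  refine continuousAt_of_dominated (bound := (Icc (-K) K).indicator (fun _ => M))
    (Eventually.of_forall fun p => ?_) (Eventually.of_forall fun p => ae_of_all _ fun η => ?_)
    (integrable_indicator_Icc_const K M) ?_
  · exact ((h.measurable.comp measurable_prodMk_left).indicator
      measurableSet_Iic).aestronglyMeasurable
  · exact (norm_indicator_le_norm_self _ _).trans (h.norm_le_indicator _ _)
  · have hne : ∀ᵐ η : ℝ, η ≠ y₀ := by simp [ae_iff, measure_singleton]
    filter_upwards [h.continuousAt_snd x₀, hne] with η h1 h2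
    have h3 : ContinuousAt (fun p : ℝ × ℝ => Φ (p.1, η)) (x₀, y₀) :=
      ContinuousAt.comp (g := Φ) (f := fun p : ℝ × ℝ => (p.1, η)) (x := (x₀, y₀)) h1
        (by fun_prop)
    rcases lt_or_gt_of_ne h2 with h4 | h4
    · refine h3.congr ?_
      filter_upwards [continuous_snd.continuousAt.eventually (lt_mem_nhds h4)] with p hp
      rw [indicator_of_mem (show η ∈ Iic p.2 from le_of_lt hp)]
    · refine (continuousAt_const (y := (0 : ℝ))).congr ?_
      filter_upwards [continuous_snd.continuousAt.eventually (gt_mem_nhds h4)] with p hp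
      rw [indicator_of_notMem (show η ∉ Iic p.2 from not_le.2 hp)]

lemma IsSource.continuous_colInt (h : IsSource K M Φ) :
    Continuous fun p : ℝ × ℝ => colInt Φ p.1 p.2 :=
  h.swap.continuous_rowInt.comp continuous_swap

lemma IsSource.abs_colInt_le (h : IsSource K M Φ) (x y : ℝ) : |colInt Φ x y| ≤ 2 * K * M :=
  h.swap.abs_rowInt_le y x

lemma IsSource.integrable_rowInt (h : IsSource K M Φ) (y : ℝ) :
    Integrable fun ξ => rowInt Φ ξ y := by
  refine (integrable_indicator_Icc_const K (2 * K * M)).mono'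
    (h.continuous_rowInt.comp (Continuous.prodMk_left y)).aestronglyMeasurable
    (ae_of_all _ fun ξ => ?_)
  by_cases hξ : ξ ∈ Icc (-K) K
  · rw [indicator_of_mem hξ]
    exact h.abs_rowInt_le ξ y
  · have : ∀ η, Φ (ξ, η) = 0 := fun η => by
      by_contra h0
      exact hξ (abs_le.1 (h.fst_mem _ h0))
    simp [rowInt, this, indicator_of_notMem hξ]

lemma IsSource.quadInt_eq_rowInt (h : IsSource K M Φ) (x y : ℝ) :
    quadInt Φ x y = ∫ ξ in Iic x, rowInt Φ ξ y := by
  rw [quadInt, Measure.volume_eq_prod, setIntegral_prod _ h.integrable.integrableOn]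
  rfl

lemma quadInt_swap (Φ : ℝ × ℝ → ℝ) (x y : ℝ) :
    quadInt (Φ ∘ Prod.swap) y x = quadInt Φ x y := by
  rw [quadInt, quadInt, Measure.volume_eq_prod, ← preimage_swap_prod]
  exact (Measure.measurePreserving_swap).setIntegral_preimage_emb
    (MeasurableEquiv.prodComm).measurableEmbedding _ _

lemma IsSource.quadInt_sub_fst (h : IsSource K M Φ) (x x' y : ℝ) :
    quadInt Φ x' y - quadInt Φ x y = ∫ ξ in x..x', rowInt Φ ξ y := by
  rw [h.quadInt_eq_rowInt, h.quadInt_eq_rowInt]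
  exact intervalIntegral.integral_Iic_sub_Iic (h.integrable_rowInt y).integrableOn
    (h.integrable_rowInt y).integrableOn

lemma IsSource.quadInt_sub_snd (h : IsSource K M Φ) (x y y' : ℝ) :
    quadInt Φ x y' - quadInt Φ x y = ∫ η in y..y', colInt Φ x η := by
  rw [← quadInt_swap Φ x y, ← quadInt_swap Φ x y', h.swap.quadInt_sub_fst]
  rfl

lemma IsSource.rowInt_sub (h : IsSource K M Φ) (x y y' : ℝ) :
    rowInt Φ x y' - rowInt Φ x y = ∫ η in y..y', Φ (x, η) :=
  intervalIntegral.integral_Iic_sub_Iic (h.integrable_row x).integrableOn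
    (h.integrable_row x).integrableOn

lemma IsSource.hasDerivAt_fst (h : IsSource K M Φ) (x y : ℝ) :
    HasDerivAt (fun x => quadInt Φ x y) (rowInt Φ x y) x := by
  have hc : Continuous fun ξ => rowInt Φ ξ y := h.continuous_rowInt.comp (Continuous.prodMk_left y)
  have h1 := (hc.integral_hasStrictDerivAt 0 x).hasDerivAt
  have e : (fun x => quadInt Φ x y) = fun x => (∫ ξ in 0..x, rowInt Φ ξ y) + quadInt Φ 0 y := by
    ext x'
    rw [← h.quadInt_sub_fst]; ring
  rw [e]
  exact h1.add_const _

lemma IsSource.hasDerivAt_snd (h : IsSource K M Φ) (x y : ℝ) :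
    HasDerivAt (fun y => quadInt Φ x y) (colInt Φ x y) y := by
  have e : (fun y => quadInt Φ x y) = fun y => quadInt (Φ ∘ Prod.swap) y x := by
    ext y'
    rw [quadInt_swap]
  rw [e]
  exact h.swap.hasDerivAt_fst y x

lemma continuous_toSpanSingleton {f : ℝ × ℝ → ℝ} (hf : Continuous f) :
    Continuous fun p => ContinuousLinearMap.toSpanSingleton ℝ (f p) := by
  have e : (fun p => ContinuousLinearMap.toSpanSingleton ℝ (f p)) =
      fun p => f p • ContinuousLinearMap.toSpanSingleton ℝ (1 : ℝ) := by
    ext p; simp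
  rw [e]
  exact hf.smul continuous_const

lemma IsSource.hasFDerivAt (h : IsSource K M Φ) (p : ℝ × ℝ) :
    HasFDerivAt (fun p : ℝ × ℝ => quadInt Φ p.1 p.2)
      ((ContinuousLinearMap.toSpanSingleton ℝ (rowInt Φ p.1 p.2)).coprod
        (ContinuousLinearMap.toSpanSingleton ℝ (colInt Φ p.1 p.2))) p :=
  (hasStrictFDerivAt_uncurry_coprod (𝕜 := ℝ) (f := quadInt Φ) (u := p)
    (f₁ := fun x y => ContinuousLinearMap.toSpanSingleton ℝ (rowInt Φ x y))
    (f₂ := fun x y => ContinuousLinearMap.toSpanSingleton ℝ (colInt Φ x y))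
    (Eventually.of_forall fun v => (h.hasDerivAt_fst v.1 v.2).hasFDerivAt)
    (Eventually.of_forall fun v => (h.hasDerivAt_snd v.1 v.2).hasFDerivAt)
    (continuous_toSpanSingleton h.continuous_rowInt).continuousAt
    (continuous_toSpanSingleton h.continuous_colInt).continuousAt).hasFDerivAt

/-- The derivative of the quadrant integral along a line. -/
lemma IsSource.hasDerivAt_line (h : IsSource K M Φ) (x y a b τ : ℝ) :
    HasDerivAt (fun τ => quadInt Φ (x + τ * a) (y + τ * b))
      (a * rowInt Φ (x + τ * a) (y + τ * b) + b * colInt Φ (x + τ * a) (y + τ * b)) τ := by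
  have h1 : HasDerivAt (fun τ : ℝ => (x + τ * a, y + τ * b)) (a, b) τ := by
    refine HasDerivAt.prodMk ?_ ?_
    · simpa using ((hasDerivAt_id τ).mul_const a).const_add x
    · simpa using ((hasDerivAt_id τ).mul_const b).const_add y
  have h2 := (h.hasFDerivAt (x + τ * a, y + τ * b)).comp_hasDerivAt τ h1
  refine h2.congr_deriv ?_
  simp

lemma IsSource.continuous_quadInt (h : IsSource K M Φ) :
    Continuous fun p : ℝ × ℝ => quadInt Φ p.1 p.2 :=
  continuous_iff_continuousAt.2 fun p => (h.hasFDerivAt p).continuousAt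

/-- Puts the values of `quadInt` on the diagonal and along the front into `IsH1`, through
`IsH1.of_lipschitz`. -/
lemma IsSource.abs_quadInt_sub_le (h : IsSource K M Φ) (x y x' y' : ℝ) :
    |quadInt Φ x' y' - quadInt Φ x y| ≤ 2 * K * M * (|x' - x| + |y' - y|) := by
  have e1 : |quadInt Φ x' y' - quadInt Φ x y'| ≤ 2 * K * M * |x' - x| := by
    rw [h.quadInt_sub_fst, ← Real.norm_eq_abs]
    exact intervalIntegral.norm_integral_le_of_norm_le_const fun ξ _ => by
      rw [Real.norm_eq_abs]; exact h.abs_rowInt_le ξ y'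
  have e2 : |quadInt Φ x y' - quadInt Φ x y| ≤ 2 * K * M * |y' - y| := by
    rw [h.quadInt_sub_snd, ← Real.norm_eq_abs]
    exact intervalIntegral.norm_integral_le_of_norm_le_const fun ξ _ => by
      rw [Real.norm_eq_abs]; exact h.abs_colInt_le x ξ
  have := abs_add_le (quadInt Φ x' y' - quadInt Φ x y') (quadInt Φ x y' - quadInt Φ x y)
  rw [sub_add_sub_cancel] at this
  linarith

/-- Sources vanishing for negative times have quadrant integrals vanishing for nonpositive times. -/
lemma quadInt_eq_zero (h : ∀ p : ℝ × ℝ, p.1 + p.2 ≤ 0 → Φ p = 0) {x y : ℝ} (hxy : x + y ≤ 0) :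
    quadInt Φ x y = 0 := by
  rw [quadInt, setIntegral_eq_zero_of_forall_eq_zero]
  rintro ⟨a, b⟩ ⟨h1, h2⟩
  have h1 : a ≤ x := h1
  have h2 : b ≤ y := h2
  exact h _ (by simp only; linarith)

lemma rowInt_eq_zero (h : ∀ p : ℝ × ℝ, p.1 + p.2 ≤ 0 → Φ p = 0) {x y : ℝ} (hxy : x + y ≤ 0) :
    rowInt Φ x y = 0 := by
  rw [rowInt, setIntegral_eq_zero_of_forall_eq_zero]
  intro b h2
  have h2 : b ≤ y := h2
  exact h _ (by simp only; linarith)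

lemma colInt_eq_zero (h : ∀ p : ℝ × ℝ, p.1 + p.2 ≤ 0 → Φ p = 0) {x y : ℝ} (hxy : x + y ≤ 0) :
    colInt Φ x y = 0 := by
  rw [colInt, setIntegral_eq_zero_of_forall_eq_zero]
  intro b h2
  have h2 : b ≤ x := h2
  exact h _ (by simp only; linarith)

/-- An exponentially weighted bound for the difference of two quadrant integrals. -/
lemma IsSource.abs_quadInt_sub_quadInt_le {K' M' : ℝ} {Ψ : ℝ × ℝ → ℝ} (h : IsSource K M Φ)
    (h' : IsSource K' M' Ψ) {c l : ℝ} (hl : 0 < l)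
    (hle : ∀ p : ℝ × ℝ, |Φ p - Ψ p| ≤ c * (Real.exp (l * p.1) * Real.exp (l * p.2))) (x y : ℝ) :
    |quadInt Φ x y - quadInt Ψ x y| ≤ c / l ^ 2 * (Real.exp (l * x) * Real.exp (l * y)) := by
  have hi : ∀ a : ℝ, IntegrableOn (fun ξ => Real.exp (l * ξ)) (Iic a) := fun a =>
    integrableOn_exp_mul_Iic hl a
  have hprod : IntegrableOn (fun p : ℝ × ℝ => Real.exp (l * p.1) * Real.exp (l * p.2))
      (Iic x ×ˢ Iic y) := by
    rw [IntegrableOn, Measure.volume_eq_prod, ← Measure.prod_restrict]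
    exact (hi x).mul_prod (hi y)
  rw [quadInt, quadInt, ← integral_sub h.integrable.integrableOn h'.integrable.integrableOn]
  calc |∫ p in Iic x ×ˢ Iic y, (Φ p - Ψ p)|
      ≤ ∫ p in Iic x ×ˢ Iic y, c * (Real.exp (l * p.1) * Real.exp (l * p.2)) := by
        rw [← Real.norm_eq_abs]
        exact norm_integral_le_of_norm_le (hprod.const_mul c) (ae_of_all _ hle)
    -- Each exponential integral contributes a factor `1 / l`; this gain makes the fixed point map
    -- contract for large `l`.
    _ = c / l ^ 2 * (Real.exp (l * x) * Real.exp (l * y)) := by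
        rw [integral_const_mul, Measure.volume_eq_prod,
          setIntegral_prod_mul (fun ξ => Real.exp (l * ξ)) (fun ξ => Real.exp (l * ξ)),
          integral_exp_mul_Iic hl, integral_exp_mul_Iic hl]
        field_simp

end CharacteristicIntegral

end Debonding

namespace Debonding

/-! ### Profiles satisfying both boundary conditions. -/

section WaveProfiles

variable (κ : ℝ → ℝ) (ρ₀ : ℝ) (N : ℕ) (zb bb : ℝ → ℝ) (G : ℝ → ℝ → ℝ)

/-- The accumulated effect on incoming waves of at most `N` reflections by the front. -/
def frontSum (D : ℝ → ℝ) (y : ℝ) : ℝ := ∑ j ∈ Finset.range N, D (max ρ₀ (κ^[j] y))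

/-- The jump which the condition on the front imposes on the incoming profile. -/
def frontDefect (y : ℝ) : ℝ := bb (κ y) - bb ρ₀ - zb (κ y) + G (κ y) (κ y) - G (κ y) y

/-- The profile of the waves moving towards `r = 0`. -/
def incoming (y : ℝ) : ℝ := bb y + frontSum κ ρ₀ N (frontDefect κ ρ₀ zb bb G) y

/-- The profile of the waves moving away from `r = 0`. -/
def outgoing (x : ℝ) : ℝ := zb x - incoming κ ρ₀ N zb bb G x - G x x

/-- The wave with boundary values `zb` on `r = 0`, zero on the front, and forcing term `G`. -/
def waveForm (x y : ℝ) : ℝ :=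
  outgoing κ ρ₀ N zb bb G x + incoming κ ρ₀ N zb bb G y + G x y

variable {κ ρ₀ N zb bb G}

lemma iterate_le (hκ : ∀ y, κ y ≤ y - 2 * ρ₀) (n : ℕ) (y : ℝ) :
    κ^[n] y ≤ y - 2 * n * ρ₀ := by
  induction n generalizing y with
  | zero => simp
  | succ n ih =>
    rw [Function.iterate_succ_apply]
    have h1 := ih (κ y)
    have h2 := hκ y
    push_cast
    linarith

/-- For `y ≤ ρ₀` the truncation sends every iterate to `ρ₀`, where `D` vanishes: such a
characteristic has not yet met the front. -/
lemma frontSum_of_le (hρ₀ : 0 < ρ₀) (hκ : ∀ y, κ y ≤ y - 2 * ρ₀) {D : ℝ → ℝ} (hD : D ρ₀ = 0)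
    {y : ℝ} (hy : y ≤ ρ₀) : frontSum κ ρ₀ N D y = 0 := by
  refine Finset.sum_eq_zero fun j _ => ?_
  have h1 := iterate_le hκ j y
  have h2 : 0 ≤ 2 * (j : ℝ) * ρ₀ := by positivity
  rw [max_eq_left (by linarith), hD]

/-- A shift of the index: the `j`-th term at `κ y` is the `(j + 1)`-st at `y`. The leftover term of
index `N` vanishes because `κ^[N] y ≤ y - 2 * N * ρ₀ ≤ ρ₀`. -/
lemma frontSum_eq (hκ : ∀ y, κ y ≤ y - 2 * ρ₀) {D : ℝ → ℝ} (hD : D ρ₀ = 0)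
    {y : ℝ} (h1 : ρ₀ ≤ y) (h2 : y ≤ ρ₀ + 2 * N * ρ₀) :
    frontSum κ ρ₀ N D y = frontSum κ ρ₀ N D (κ y) + D y := by
  have e1 := Finset.sum_range_succ (fun j => D (max ρ₀ (κ^[j] y))) N
  have e2 := Finset.sum_range_succ' (fun j => D (max ρ₀ (κ^[j] y))) N
  have e3 : D (max ρ₀ (κ^[N] y)) = 0 := by
    have := iterate_le hκ N y
    rw [max_eq_left (by linarith), hD]
  simp only [e3, Function.iterate_succ_apply, Function.iterate_zero, id, max_eq_right h1] at e1 e2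
  rw [frontSum, frontSum]
  linarith

lemma waveForm_diag (x : ℝ) : waveForm κ ρ₀ N zb bb G x x = zb x := by
  rw [waveForm, outgoing]; ring

/-- Inserting the outgoing profile turns the front condition into a recursion from `incoming (κ y)`
to `incoming y`. By `frontSum_eq` the sum of defects solves it wherever `bb` has its constant value
`bb ρ₀`. -/
lemma waveForm_front (hκ : ∀ y, κ y ≤ y - 2 * ρ₀)
    (hD : frontDefect κ ρ₀ zb bb G ρ₀ = 0) {y : ℝ} (h1 : ρ₀ ≤ y) (h2 : y ≤ ρ₀ + 2 * N * ρ₀)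
    (hb : bb y = bb ρ₀) : waveForm κ ρ₀ N zb bb G (κ y) y = 0 := by
  have := frontSum_eq hκ hD h1 h2
  rw [waveForm, outgoing, incoming, incoming, this, hb, frontDefect]
  ring

lemma abs_frontSum_sub_le {D D' : ℝ → ℝ} {B y : ℝ} (hρ₀ : 0 < ρ₀)
    (hκ : ∀ y, κ y ≤ y - 2 * ρ₀) (h : ∀ y', ρ₀ ≤ y' → y' ≤ max ρ₀ y → |D y' - D' y'| ≤ B) :
    |frontSum κ ρ₀ N D y - frontSum κ ρ₀ N D' y| ≤ N * B := by
  rw [frontSum, frontSum, ← Finset.sum_sub_distrib]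
  refine (Finset.abs_sum_le_sum_abs _ _).trans ?_
  refine (Finset.sum_le_card_nsmul _ _ B fun j _ => ?_).trans (by simp)
  have h1 := iterate_le hκ j y
  have h2 : 0 ≤ 2 * (j : ℝ) * ρ₀ := by positivity
  exact h _ (le_max_left _ _) (max_le_max le_rfl (by linarith))

/-- The data cancel. Each of the two profiles contains `N` defects, each off by at most `2 * B`, and
two values of `G` enter directly: `2 * (2 * N) + 2`. -/
lemma abs_waveForm_sub_le {G' : ℝ → ℝ → ℝ} {B x y : ℝ} (hρ₀ : 0 < ρ₀)
    (hκ : ∀ y, κ y ≤ y - 2 * ρ₀) (hxy : x ≤ y) (h1 : |G x y - G' x y| ≤ B)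
    (h2 : |G x x - G' x x| ≤ B)
    (h3 : ∀ y', ρ₀ ≤ y' → y' ≤ max ρ₀ y → |G (κ y') (κ y') - G' (κ y') (κ y')| ≤ B)
    (h4 : ∀ y', ρ₀ ≤ y' → y' ≤ max ρ₀ y → |G (κ y') y' - G' (κ y') y'| ≤ B) :
    |waveForm κ ρ₀ N zb bb G x y - waveForm κ ρ₀ N zb bb G' x y| ≤ (4 * N + 2) * B := by
  have key : ∀ y', ρ₀ ≤ y' → y' ≤ max ρ₀ y →
      |frontDefect κ ρ₀ zb bb G y' - frontDefect κ ρ₀ zb bb G' y'| ≤ 2 * B := by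
    intro y' k1 k2
    have e : frontDefect κ ρ₀ zb bb G y' - frontDefect κ ρ₀ zb bb G' y' =
        (G (κ y') (κ y') - G' (κ y') (κ y')) - (G (κ y') y' - G' (κ y') y') := by
      rw [frontDefect, frontDefect]; ring
    rw [e]
    exact (abs_sub _ _).trans (by linarith [h3 y' k1 k2, h4 y' k1 k2])
  have s1 := abs_le.1 (abs_frontSum_sub_le (N := N) hρ₀ hκ key)
  have s2 := abs_le.1 (abs_frontSum_sub_le (N := N) (y := x) hρ₀ hκ fun y' k1 k2 =>
    key y' k1 (k2.trans (max_le_max le_rfl hxy)))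
  rw [abs_le] at h1 h2 ⊢
  simp only [waveForm, outgoing, incoming]
  constructor <;> nlinarith [s1.1, s1.2, s2.1, s2.2, h1.1, h1.2, h2.1, h2.2]

lemma monotone_iterate_max (hκ : Monotone κ) (n : ℕ) : Monotone fun y => max ρ₀ (κ^[n] y) :=
  fun _ _ h => max_le_max le_rfl (hκ.iterate n h)

lemma iterate_sub_le (hm : Monotone κ) (hκ : ∀ x y, x ≤ y → κ y - κ x ≤ y - x) (n : ℕ) (x y : ℝ)
    (hxy : x ≤ y) : κ^[n] y - κ^[n] x ≤ y - x := by
  induction n generalizing x y with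
  | zero => simp
  | succ n ih =>
    rw [Function.iterate_succ_apply, Function.iterate_succ_apply]
    exact (ih _ _ (hm hxy)).trans (hκ x y hxy)

/-- Truncating the iterates by `max` instead of splitting cases makes each summand `D` composed with
a nondecreasing 1-Lipschitz map. -/
lemma IsH1.frontSum {D : ℝ → ℝ} (hD : IsH1 D) (hm : Monotone κ)
    (hκ : ∀ x y, x ≤ y → κ y - κ x ≤ y - x) : IsH1 (frontSum κ ρ₀ N D) := by
  unfold Debonding.frontSum
  induction N with
  | zero => simpa using IsH1.const 0
  | succ n ih =>
    simp only [Finset.sum_range_succ]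
    refine ih.add (hD.comp (monotone_iterate_max hm n) fun x y hxy => ?_)
    have h1 := iterate_sub_le hm hκ n x y hxy
    have h2 := le_max_left ρ₀ (κ^[n] x)
    have h3 := le_max_right ρ₀ (κ^[n] x)
    rw [sub_le_iff_le_add]
    exact max_le (by linarith) (by linarith)

lemma IsH1.frontDefect (hz : IsH1 zb) (hb : IsH1 bb) (hm : Monotone κ)
    (hκ : ∀ x y, x ≤ y → κ y - κ x ≤ y - x) {L : ℝ} (hL : 0 ≤ L)
    (hG : ∀ x y x' y', |G x' y' - G x y| ≤ L * (|x' - x| + |y' - y|)) :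
    IsH1 (frontDefect κ ρ₀ zb bb G) := by
  have hκa : ∀ x y, x ≤ y → |κ y - κ x| ≤ y - x := fun x y h =>
    (abs_of_nonneg (sub_nonneg.2 (hm h))).le.trans (hκ x y h)
  refine ((((hb.comp hm hκ).sub (IsH1.const _)).sub (hz.comp hm hκ)).add
    (IsH1.of_lipschitz (2 * L) fun x y hxy => ?_)).sub
    (IsH1.of_lipschitz (2 * L) fun x y hxy => ?_)
  · refine (hG _ _ _ _).trans ?_
    have := hκa x y hxy
    nlinarith
  · refine (hG _ _ _ _).trans ?_
    have := hκa x y hxy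
    rw [abs_of_nonneg (sub_nonneg.2 hxy)]
    nlinarith

lemma IsH1.incoming (hz : IsH1 zb) (hb : IsH1 bb) (hm : Monotone κ)
    (hκ : ∀ x y, x ≤ y → κ y - κ x ≤ y - x) {L : ℝ} (hL : 0 ≤ L)
    (hG : ∀ x y x' y', |G x' y' - G x y| ≤ L * (|x' - x| + |y' - y|)) :
    IsH1 (incoming κ ρ₀ N zb bb G) :=
  hb.add ((IsH1.frontDefect hz hb hm hκ hL hG).frontSum hm hκ)

lemma IsH1.outgoing (hz : IsH1 zb) (hb : IsH1 bb) (hm : Monotone κ)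
    (hκ : ∀ x y, x ≤ y → κ y - κ x ≤ y - x) {L : ℝ} (hL : 0 ≤ L)
    (hG : ∀ x y x' y', |G x' y' - G x y| ≤ L * (|x' - x| + |y' - y|)) :
    IsH1 (outgoing κ ρ₀ N zb bb G) := by
  refine (hz.sub (IsH1.incoming hz hb hm hκ hL hG)).sub
    (IsH1.of_lipschitz (2 * L) fun x y hxy => (hG _ _ _ _).trans ?_)
  rw [abs_of_nonneg (sub_nonneg.2 hxy)]
  nlinarith

end WaveProfiles

/-! ### The source term in characteristic coordinates. -/

section CharacteristicSource

variable {T R ρ₀ α : ℝ} {ρ : ℝ → ℝ}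

/-- The source `¼ V g` of the wave equation, restricted to `Ω`, in characteristic coordinates. -/
def charSource (T R α : ℝ) (ρ : ℝ → ℝ) (g : ℝ × ℝ → ℝ) (p : ℝ × ℝ) : ℝ :=
  (1 / 4) * (Omega T R ρ).indicator (fun p => potential α R p.2 * g p)
    ((p.1 + p.2) / 2, (p.2 - p.1) / 2)

lemma Omega_subset_closedDomain (hρ : IsFront T R ρ₀ ρ) : Omega T R ρ ⊆ closedDomain T ρ :=
  fun _ hp => by
    obtain ⟨h1, h2, h3, h4⟩ := hρ.mem_Omega.1 hp
    exact ⟨h1.le, h2.le, h3.le, h4.le⟩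

lemma continuousAt_potential {r : ℝ} (hr : r < R) : ContinuousAt (potential α R) r := by
  have : (R - r) ^ 2 ≠ 0 := by have : R - r ≠ 0 := by linarith
                               positivity
  unfold potential
  fun_prop (disch := assumption)

lemma IsFront.continuousAt_charSource (hρ : IsFront T R ρ₀ ρ) (hT : 0 < T) (hρ₀ : 0 < ρ₀)
    {g : ℝ × ℝ → ℝ} (hg : ContinuousOn g (closedDomain T ρ)) {p : ℝ × ℝ}
    (hp : ((p.1 + p.2) / 2, (p.2 - p.1) / 2) ∉ closedDomain T ρ \ Omega T R ρ) :
    ContinuousAt (charSource T R α ρ g) p := by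
  have hl : ContinuousAt (fun p : ℝ × ℝ => ((p.1 + p.2) / 2, (p.2 - p.1) / 2)) p := by fun_prop
  have key : ContinuousAt ((Omega T R ρ).indicator (fun p => potential α R p.2 * g p))
      ((p.1 + p.2) / 2, (p.2 - p.1) / 2) := by
    by_cases h1 : ((p.1 + p.2) / 2, (p.2 - p.1) / 2) ∈ Omega T R ρ
    · have hnhds := (hρ.isOpen_Omega hT hρ₀).mem_nhds h1
      have h2 : ContinuousAt (fun p : ℝ × ℝ => potential α R p.2 * g p)
          ((p.1 + p.2) / 2, (p.2 - p.1) / 2) := by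
        refine ContinuousAt.mul ?_ (hg.continuousAt
          (mem_of_superset hnhds (Omega_subset_closedDomain hρ)))
        exact ContinuousAt.comp (g := potential α R) (f := Prod.snd)
          (continuousAt_potential h1.2.1.2) continuousAt_snd
      refine h2.congr ?_
      filter_upwards [hnhds] with x hx
      rw [indicator_of_mem hx]
    · have h2 : ((p.1 + p.2) / 2, (p.2 - p.1) / 2) ∉ closedDomain T ρ := fun h => hp ⟨h, h1⟩
      have hnhds := (hρ.isCompact_closedDomain hT hρ₀).isClosed.isOpen_compl.mem_nhds h2
      refine (continuousAt_const (y := (0 : ℝ))).congr ?_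
      filter_upwards [hnhds] with x hx
      rw [indicator_of_notMem fun h => hx (Omega_subset_closedDomain hρ h)]
  exact (ContinuousAt.comp (f := fun p : ℝ × ℝ => ((p.1 + p.2) / 2, (p.2 - p.1) / 2))
    key hl).const_mul (1 / 4)

lemma IsFront.boundary_cases (hρ : IsFront T R ρ₀ ρ) {p : ℝ × ℝ}
    (hp : p ∈ closedDomain T ρ \ Omega T R ρ) :
    p.1 = 0 ∨ p.1 = T ∨ p.2 = 0 ∨ p.2 = extendFront T ρ p.1 := by
  obtain ⟨⟨h1, h2, h3, h4⟩, h5⟩ := hp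
  by_contra! h
  obtain ⟨k1, k2, k3, k4⟩ := h
  exact h5 (hρ.mem_Omega.2 ⟨lt_of_le_of_ne h1 k1.symm, lt_of_le_of_ne h2 k2,
    lt_of_le_of_ne h3 k3.symm, lt_of_le_of_ne h4 k4⟩)

/-- A characteristic line meets each of `t = 0`, `t = T`, `r = 0` and the front at most once, the
front because it is nondecreasing and strictly slower than characteristics. Off these points the
source is continuous. -/
lemma IsFront.isSource_charSource (hρ : IsFront T R ρ₀ ρ) (hT : 0 < T) (hρ₀ : 0 < ρ₀) (α : ℝ)
    {g : ℝ × ℝ → ℝ} (hg : ContinuousOn g (closedDomain T ρ)) :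
    ∃ K M, IsSource K M (charSource T R α ρ g) := by
  have hq := hρ.isSlowFront hT hρ₀
  have hΩm := (hρ.isOpen_Omega hT hρ₀).measurableSet
  classical
  obtain ⟨C, hC⟩ := (hρ.isCompact_closedDomain hT hρ₀).exists_bound_of_continuousOn hg
  set VM : ℝ := (1 / 4) * (α ^ 2 + 1 / (R - ρ T) ^ 2) with hVM
  have hVM0 : 0 ≤ VM := by positivity
  have hρT : 0 < ρ T := hρ₀.trans_le (hρ.mapsTo ⟨hT.le, le_rfl⟩).1
  have hC0 : 0 ≤ C := (norm_nonneg _).trans (hC (0, 0) ⟨le_rfl, hT.le, le_rfl,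
    hρ₀.le.trans (hq.le 0)⟩)
  have hsupp : ∀ p : ℝ × ℝ, charSource T R α ρ g p ≠ 0 →
      ((p.1 + p.2) / 2, (p.2 - p.1) / 2) ∈ Omega T R ρ := by
    intro p hp
    by_contra h
    exact hp (by rw [charSource, indicator_of_notMem h, mul_zero])
  refine ⟨T + ρ T, (1 / 4) * (VM * C), ⟨by positivity, by positivity, ?_, ?_, ?_, ?_, ?_, ?_⟩⟩
  · have h1 : Measurable ((Omega T R ρ).indicator g) := by
      have := (hg.mono (Omega_subset_closedDomain hρ)).measurable_piecewise
        (g := fun _ => (0 : ℝ)) continuousOn_const hΩm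
      rwa [← piecewise_eq_indicator]
    have h2 : Measurable ((Omega T R ρ).indicator fun p => potential α R p.2 * g p) := by
      have e : ((Omega T R ρ).indicator fun p => potential α R p.2 * g p) =
          fun p => potential α R p.2 * (Omega T R ρ).indicator g p := by
        ext p
        by_cases hp : p ∈ Omega T R ρ <;> simp [hp]
      rw [e]
      exact ((potential_measurable α R).comp measurable_snd).mul h1
    exact (h2.comp (by fun_prop)).const_mul _
  · intro p
    rw [charSource, abs_mul, abs_of_pos (by norm_num : (0 : ℝ) < 1 / 4)]
    refine mul_le_mul_of_nonneg_left ?_ (by norm_num)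
    by_cases h : ((p.1 + p.2) / 2, (p.2 - p.1) / 2) ∈ Omega T R ρ
    · rw [indicator_of_mem h, abs_mul]
      exact mul_le_mul (hρ.abs_potential_le hT hρ₀ h) (hC _ (Omega_subset_closedDomain hρ h))
        (abs_nonneg _) hVM0
    · rw [indicator_of_notMem h, abs_zero]
      positivity
  · intro p hp
    obtain ⟨h1, h2, h3, h4⟩ := hρ.mem_Omega.1 (hsupp p hp)
    have h5 := hρ.extendFront_le hT hρ₀ ((p.1 + p.2) / 2)
    simp only at h1 h2 h3 h4
    rw [abs_le]; constructor <;> linarith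
  · intro p hp
    obtain ⟨h1, h2, h3, h4⟩ := hρ.mem_Omega.1 (hsupp p hp)
    have h5 := hρ.extendFront_le hT hρ₀ ((p.1 + p.2) / 2)
    simp only at h1 h2 h3 h4
    rw [abs_le]; constructor <;> linarith
  · intro x
    have hs : ({y : ℝ | (y - x) / 2 = extendFront T ρ ((x + y) / 2)}).Subsingleton := by
      intro y hy y' hy'
      have e : (x + y) / 2 = (x + y') / 2 := by
        apply hq.sub_strictMono.injective
        simp only [mem_ofPred_eq] at hy hy'
        simp only [← hy, ← hy']
        ring
      linarith
    have h0 : ∀ᵐ y : ℝ, y ∉ {y : ℝ | (y - x) / 2 = extendFront T ρ ((x + y) / 2)} :=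
      measure_eq_zero_iff_ae_notMem.1 (hs.measure_zero _)
    have hne : ∀ c : ℝ, ∀ᵐ y : ℝ, y ≠ c := fun c => by simp [ae_iff, measure_singleton]
    filter_upwards [h0, hne (-x), hne (2 * T - x), hne x] with y k0 k1 k2 k3
    refine hρ.continuousAt_charSource hT hρ₀ hg fun hp => ?_
    rcases hρ.boundary_cases hp with h | h | h | h
    · exact k1 (by simp only at h; linarith)
    · exact k2 (by simp only at h; linarith)
    · exact k3 (by simp only at h; linarith)
    · exact k0 h
  · intro y
    have hs : ({x : ℝ | (y - x) / 2 = extendFront T ρ ((x + y) / 2)}).Subsingleton := by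
      intro x hx x' hx'
      have e : (x + y) / 2 = (x' + y) / 2 := by
        apply hq.add_strictMono.injective
        simp only [mem_ofPred_eq] at hx hx'
        simp only [← hx, ← hx']
        ring
      linarith
    have h0 : ∀ᵐ x : ℝ, x ∉ {x : ℝ | (y - x) / 2 = extendFront T ρ ((x + y) / 2)} :=
      measure_eq_zero_iff_ae_notMem.1 (hs.measure_zero _)
    have hne : ∀ c : ℝ, ∀ᵐ y : ℝ, y ≠ c := fun c => by simp [ae_iff, measure_singleton]
    filter_upwards [h0, hne (-y), hne (2 * T - y), hne y] with x k0 k1 k2 k3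
    refine hρ.continuousAt_charSource hT hρ₀ hg fun hp => ?_
    rcases hρ.boundary_cases hp with h | h | h | h
    · exact k1 (by simp only at h; linarith)
    · exact k2 (by simp only at h; linarith)
    · exact k3 (by simp only at h; linarith)
    · exact k0 h

lemma IsFront.charSource_of_nonpos (hρ : IsFront T R ρ₀ ρ) (α : ℝ) (g : ℝ × ℝ → ℝ)
    (p : ℝ × ℝ) (hp : p.1 + p.2 ≤ 0) : charSource T R α ρ g p = 0 := by
  rw [charSource, indicator_of_notMem, mul_zero]
  intro h
  have := (hρ.mem_Omega.1 h).1
  simp only at this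
  linarith

end CharacteristicSource

end Debonding

namespace Debonding

/-! ### The integral equation as a contraction. -/

section FixedPoint

variable {T R ρ₀ α : ℝ} {ρ : ℝ → ℝ}

lemma abs_charSource_sub_le (hρ : IsFront T R ρ₀ ρ) (hT : 0 < T) (hρ₀ : 0 < ρ₀) {g g' : ℝ × ℝ → ℝ}
    {d l : ℝ} (hd : 0 ≤ d)
    (h : ∀ p ∈ closedDomain T ρ, |g p - g' p| ≤ d * Real.exp (2 * l * p.1)) (p : ℝ × ℝ) :
    |charSource T R α ρ g p - charSource T R α ρ g' p| ≤
      (1 / 4) * ((1 / 4) * (α ^ 2 + 1 / (R - ρ T) ^ 2)) * d *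
        (Real.exp (l * p.1) * Real.exp (l * p.2)) := by
  have hV : 0 ≤ (1 / 4) * (α ^ 2 + 1 / (R - ρ T) ^ 2) := by positivity
  by_cases hp : ((p.1 + p.2) / 2, (p.2 - p.1) / 2) ∈ Omega T R ρ
  · rw [charSource, charSource, indicator_of_mem hp, indicator_of_mem hp, ← mul_sub, ← mul_sub,
      abs_mul, abs_mul, abs_of_pos (by norm_num : (0 : ℝ) < 1 / 4), ← Real.exp_add]
    have h1 := h _ (Omega_subset_closedDomain hρ hp)
    have h2 := hρ.abs_potential_le (α := α) hT hρ₀ hp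
    have e : 2 * l * ((p.1 + p.2) / 2) = l * p.1 + l * p.2 := by ring
    rw [e] at h1
    have := mul_le_mul h2 h1 (abs_nonneg _) hV
    linarith
  · rw [charSource, charSource, indicator_of_notMem hp, indicator_of_notMem hp, sub_self, abs_zero]
    positivity

/-- The wave generated by the data and by the source `V g`. -/
def waveMap (T R ρ₀ α : ℝ) (ρ zb bb : ℝ → ℝ) (N : ℕ) (g : ℝ × ℝ → ℝ) (p : ℝ × ℝ) : ℝ :=
  waveForm (reflect (extendFront T ρ)) ρ₀ N zb bb (quadInt (charSource T R α ρ g))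
    (p.1 - p.2) (p.1 + p.2)

lemma IsFront.continuous_waveMap (hρ : IsFront T R ρ₀ ρ) (hT : 0 < T) (hρ₀ : 0 < ρ₀)
    {zb bb : ℝ → ℝ} (hz : Continuous zb) (hb : Continuous bb) (N : ℕ) {g : ℝ × ℝ → ℝ}
    (hg : ContinuousOn g (closedDomain T ρ)) :
    Continuous (waveMap T R ρ₀ α ρ zb bb N g) := by
  obtain ⟨K, M, hS⟩ := hρ.isSource_charSource hT hρ₀ α hg
  have hκ := (hρ.isSlowFront hT hρ₀).reflect_continuous
  have hG := hS.continuous_quadInt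
  have hD : Continuous (frontDefect (reflect (extendFront T ρ)) ρ₀ zb bb
      (quadInt (charSource T R α ρ g))) := by
    unfold frontDefect
    exact ((((hb.comp hκ).sub continuous_const).sub (hz.comp hκ)).add
      (hG.comp (hκ.prodMk hκ))).sub (hG.comp (hκ.prodMk continuous_id))
  have hin : Continuous (incoming (reflect (extendFront T ρ)) ρ₀ N zb bb
      (quadInt (charSource T R α ρ g))) := by
    unfold incoming frontSum
    exact hb.add (continuous_finsetSum _ fun j _ =>
      hD.comp (continuous_const.max (hκ.iterate j)))
  have hout : Continuous (outgoing (reflect (extendFront T ρ)) ρ₀ N zb bb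
      (quadInt (charSource T R α ρ g))) := by
    unfold outgoing
    exact (hz.sub hin).sub (hG.comp (continuous_id.prodMk continuous_id))
  unfold waveMap waveForm
  exact ((hout.comp (continuous_fst.sub continuous_snd)).add
    (hin.comp (continuous_fst.add continuous_snd))).add
    (hG.comp ((continuous_fst.sub continuous_snd).prodMk (continuous_fst.add continuous_snd)))

/-- At time `t` the wave uses `quadInt` only at points with `x + y ≤ 2 t`, since the reflections
involved occur at hitting times up to `t`. The weight `exp (2 * l * t)` is therefore reproduced,
with a gain `l⁻²`. -/
lemma IsFront.abs_waveMap_sub_le (hρ : IsFront T R ρ₀ ρ) (hT : 0 < T) (hρ₀ : 0 < ρ₀)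
    {zb bb : ℝ → ℝ} (N : ℕ) {g g' : ℝ × ℝ → ℝ} (hg : ContinuousOn g (closedDomain T ρ))
    (hg' : ContinuousOn g' (closedDomain T ρ)) {d l : ℝ} (hd : 0 ≤ d) (hl : 0 < l)
    (h : ∀ p ∈ closedDomain T ρ, |g p - g' p| ≤ d * Real.exp (2 * l * p.1)) {p : ℝ × ℝ}
    (hp : p ∈ closedDomain T ρ) :
    |waveMap T R ρ₀ α ρ zb bb N g p - waveMap T R ρ₀ α ρ zb bb N g' p| ≤
      (4 * N + 2) * ((1 / 4) * ((1 / 4) * (α ^ 2 + 1 / (R - ρ T) ^ 2)) * d / l ^ 2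
        * Real.exp (2 * l * p.1)) := by
  obtain ⟨K, M, hS⟩ := hρ.isSource_charSource hT hρ₀ α hg
  obtain ⟨K', M', hS'⟩ := hρ.isSource_charSource hT hρ₀ α hg'
  have hq := hρ.isSlowFront hT hρ₀
  obtain ⟨p1, p2, p3, p4⟩ := hp
  set c := (1 / 4) * ((1 / 4) * (α ^ 2 + 1 / (R - ρ T) ^ 2)) * d with hc
  have hc0 : 0 ≤ c := by positivity
  have key : ∀ x y, x + y ≤ 2 * p.1 → |quadInt (charSource T R α ρ g) x y
      - quadInt (charSource T R α ρ g') x y| ≤ c / l ^ 2 * Real.exp (2 * l * p.1) := by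
    intro x y hxy
    refine (hS.abs_quadInt_sub_quadInt_le hS' hl
      (abs_charSource_sub_le hρ hT hρ₀ hd h) x y).trans ?_
    refine mul_le_mul_of_nonneg_left ?_ (by positivity)
    rw [← Real.exp_add, Real.exp_le_exp]
    nlinarith
  have hθ : ∀ y', ρ₀ ≤ y' → y' ≤ max ρ₀ (p.1 + p.2) →
      hitTime (extendFront T ρ) y' ≤ p.1 := by
    intro y' _ h2
    have h3 : y' ≤ p.1 + extendFront T ρ p.1 :=
      h2.trans (max_le (by linarith [hq.le p.1]) (by linarith))
    exact (hq.hitTime_mono h3).trans_eq (hq.hitTime_eq _)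
  refine abs_waveForm_sub_le hρ₀ hq.reflect_le (by linarith) (key _ _ (by linarith))
    (key _ _ (by linarith)) (fun y' h1 h2 => key _ _ ?_) (fun y' h1 h2 => key _ _ ?_)
  · have := hq.reflect_add y'
    have := hq.reflect_le y'
    linarith [hθ y' h1 h2]
  · have := hq.reflect_add y'
    linarith [hθ y' h1 h2]

/-- The integral equation for the wave has a continuous solution. -/
theorem IsFront.exists_waveMap_fixedPoint (hρ : IsFront T R ρ₀ ρ) (hT : 0 < T) (hρ₀ : 0 < ρ₀)
    (α : ℝ) {zb bb : ℝ → ℝ} (hz : Continuous zb) (hb : Continuous bb) (N : ℕ) :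
    ∃ g : ℝ × ℝ → ℝ, ContinuousOn g (closedDomain T ρ) ∧
      ∀ p ∈ closedDomain T ρ, g p = waveMap T R ρ₀ α ρ zb bb N g p := by
  classical
  set Q := closedDomain T ρ with hQ
  have : CompactSpace Q := isCompact_iff_compactSpace.1 (hρ.isCompact_closedDomain hT hρ₀)
  set VM : ℝ := (1 / 4) * (α ^ 2 + 1 / (R - ρ T) ^ 2) with hVM
  have hVM0 : 0 ≤ VM := by positivity
  obtain ⟨l, hl, hl2⟩ : ∃ l : ℝ, 0 < l ∧ (4 * N + 2) * ((1 / 4) * VM) / l ^ 2 ≤ 1 / 2 := by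
    refine ⟨(4 * N + 2) * VM + 1, by positivity, ?_⟩
    rw [div_le_iff₀ (by positivity)]
    have : 0 ≤ (4 * N + 2) * VM := by positivity
    nlinarith
  -- Conjugation with `exp (2 * l * t)` turns the weighted norm into the supremum norm of `C(Q, ℝ)`.
  let ext : C(Q, ℝ) → ℝ × ℝ → ℝ := fun f p =>
    if hp : p ∈ Q then Real.exp (2 * l * p.1) * f ⟨p, hp⟩ else 0
  have ext_eq : ∀ f (p : Q), ext f p = Real.exp (2 * l * p.1.1) * f p := fun f p => by
    simp only [ext, dif_pos p.2]
  have hext : ∀ f, ContinuousOn (ext f) Q := fun f => by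
    rw [continuousOn_iff_continuous_domRestrict]
    have : Q.domRestrict (ext f) = fun p : Q => Real.exp (2 * l * p.1.1) * f p := by
      ext p; exact ext_eq f p
    rw [this]
    fun_prop
  let S : C(Q, ℝ) → C(Q, ℝ) := fun f =>
    ⟨fun p => Real.exp (-(2 * l * p.1.1)) * waveMap T R ρ₀ α ρ zb bb N (ext f) p, by
      have := hρ.continuous_waveMap (α := α) hT hρ₀ hz hb N (hext f)
      fun_prop⟩
  have hS : ContractingWith (1 / 2) S := by
    refine ⟨by rw [← NNReal.coe_lt_coe]; norm_num, LipschitzWith.of_dist_le_mul fun f f' => ?_⟩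
    rw [ContinuousMap.dist_le (by positivity)]
    intro p
    have h1 : ∀ p ∈ Q, |ext f p - ext f' p| ≤ dist f f' * Real.exp (2 * l * p.1) := by
      intro p hp
      have e1 := ext_eq f ⟨p, hp⟩
      have e2 := ext_eq f' ⟨p, hp⟩
      simp only at e1 e2
      rw [e1, e2, ← mul_sub, abs_mul, abs_of_pos (Real.exp_pos _), mul_comm]
      rw [← Real.dist_eq]
      exact mul_le_mul_of_nonneg_right (ContinuousMap.dist_apply_le_dist _) (Real.exp_pos _).le
    have h2 := hρ.abs_waveMap_sub_le (α := α) (zb := zb) (bb := bb) hT hρ₀ N (hext f) (hext f')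
      dist_nonneg hl h1 p.2
    rw [Real.dist_eq]
    change |Real.exp (-(2 * l * p.1.1)) * _ - Real.exp (-(2 * l * p.1.1)) * _| ≤ _
    rw [← mul_sub, abs_mul, abs_of_pos (Real.exp_pos _)]
    calc Real.exp (-(2 * l * p.1.1)) * |waveMap T R ρ₀ α ρ zb bb N (ext f) p
          - waveMap T R ρ₀ α ρ zb bb N (ext f') p|
        ≤ Real.exp (-(2 * l * p.1.1)) * ((4 * N + 2) * ((1 / 4) * VM * dist f f' / l ^ 2
          * Real.exp (2 * l * p.1.1))) := mul_le_mul_of_nonneg_left h2 (Real.exp_pos _).le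
      _ = (4 * N + 2) * ((1 / 4) * VM) / l ^ 2 * dist f f' := by
          rw [Real.exp_neg]
          field_simp
      _ ≤ 1 / 2 * dist f f' := mul_le_mul_of_nonneg_right hl2 dist_nonneg
      _ = _ := by norm_num
  have : Nonempty C(Q, ℝ) := ⟨0⟩
  set f := hS.fixedPoint S with hf
  have hfix : S f = f := hS.fixedPoint_isFixedPt
  refine ⟨ext f, hext f, fun p hp => ?_⟩
  have h1 : f ⟨p, hp⟩ = Real.exp (-(2 * l * p.1)) * waveMap T R ρ₀ α ρ zb bb N (ext f) p := by
    conv_lhs => rw [← hfix]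
    rfl
  rw [ext_eq f ⟨p, hp⟩, h1, ← mul_assoc, ← Real.exp_add]
  simp

end FixedPoint

end Debonding

namespace Debonding

/-! ### Construction of the wave from the data. -/

section WaveExistence

/-- The wave with profiles `a`, `b` and source `Φ` in characteristic coordinates. -/
def wave (a b : ℝ → ℝ) (Φ : ℝ × ℝ → ℝ) (p : ℝ × ℝ) : ℝ :=
  a (p.1 - p.2) + b (p.1 + p.2) + quadInt Φ (p.1 - p.2) (p.1 + p.2)

/-- `wave a b Φ` solves the integral form of the initial boundary value problem. -/
structure IsWave (T R ρ₀ α : ℝ) (ρ z h₀ h₁ a b : ℝ → ℝ) (K M : ℝ) (Φ : ℝ × ℝ → ℝ) : Prop where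
  out_h1 : IsH1 a
  in_h1 : IsH1 b
  source : IsSource K M Φ
  source_nonpos : ∀ p : ℝ × ℝ, p.1 + p.2 ≤ 0 → Φ p = 0
  source_mem : ∀ p ∈ Omega T R ρ,
    Φ (p.1 - p.2, p.1 + p.2) = (1 / 4) * (potential α R p.2 * wave a b Φ p)
  source_notMem : ∀ p ∉ Omega T R ρ, Φ (p.1 - p.2, p.1 + p.2) = 0
  left : ∀ t ∈ Icc 0 T, wave a b Φ (t, 0) = z t
  front : ∀ t ∈ Icc 0 T, wave a b Φ (t, extendFront T ρ t) = 0
  in_eq : ∀ r ∈ Icc 0 ρ₀, b r = (1 / 2) * h₀ r + (1 / 2) * ∫ s in 0..r, h₁ s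
  out_eq : ∀ r ∈ Icc 0 ρ₀, a (-r) = (1 / 2) * h₀ r - (1 / 2) * ∫ s in 0..r, h₁ s

variable {T R ρ₀ : ℝ} {ρ z h₀ h₁ : ℝ → ℝ}

theorem IsFront.exists_isWave (hρ : IsFront T R ρ₀ ρ) (hT : 0 < T) (hρ₀ : 0 < ρ₀) (α : ℝ)
    (hz : MemW12Interval 0 T z) (hzc : ContinuousOn z (Icc 0 T))
    (hh₀ : MemW12Interval 0 ρ₀ h₀) (hh₀c : ContinuousOn h₀ (Icc 0 ρ₀))
    (hh₁ : MemLp h₁ 2 (volume.restrict (Ioo 0 ρ₀)))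
    (hcomp₀ : h₀ 0 = z 0) (hcomp₁ : h₀ ρ₀ = 0) :
    ∃ a b K M Φ, IsWave T R ρ₀ α ρ z h₀ h₁ a b K M Φ := by
  have hq := hρ.isSlowFront hT hρ₀
  set q := extendFront T ρ with hqdef
  set κ := reflect q with hκ
  set zb : ℝ → ℝ := fun x => z (max 0 (min x T)) with hzb
  set hb : ℝ → ℝ := fun x => h₀ (max 0 (min x ρ₀)) with hhb
  set Hb : ℝ → ℝ := fun x => ∫ s in 0..max 0 (min x ρ₀), h₁ s with hHb
  have zb1 : IsH1 zb := by
    obtain ⟨g, g1, g2⟩ := hz.exists_primitive hT hzc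
    exact IsH1.of_primitive hT.le g1 g2
  have hb1 : IsH1 hb := by
    obtain ⟨g, g1, g2⟩ := hh₀.exists_primitive hρ₀ hh₀c
    exact IsH1.of_primitive hρ₀.le g1 g2
  have ii : ∀ x ∈ Icc 0 ρ₀, IntervalIntegrable h₁ volume 0 x := fun x hx => by
    rw [intervalIntegrable_iff_integrableOn_Ioo_of_le hx.1]
    exact IntegrableOn.mono_set (t := Ioo 0 ρ₀) (hh₁.integrable (by norm_num))
      (Ioo_subset_Ioo le_rfl hx.2)
  have Hb1 : IsH1 Hb := IsH1.of_primitive (f := fun x => ∫ s in 0..x, h₁ s) hρ₀.le hh₁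
    fun x hx y hy _ => intervalIntegral.integral_interval_sub_left (ii y hy) (ii x hx)
  -- The clamped data let one formula serve three ranges. On `[0, ρ₀]` it is the incoming d'Alembert
  -- profile, beyond `ρ₀` it is constant, and at `-r` it is chosen so that `zb - bb` is the outgoing
  -- profile `(h₀ r - ∫ s in 0..r, h₁ s) / 2`.
  set bb : ℝ → ℝ := fun y => (1 / 2) * (hb y - hb (-y)) + (1 / 2) * (Hb y + Hb (-y))
    + (1 / 2) * z 0 with hbb
  have bb1 : IsH1 bb := (((hb1.sub hb1.comp_neg).const_mul _).add
    ((Hb1.add Hb1.comp_neg).const_mul _)).add (IsH1.const _)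
  have cl : ∀ {A x : ℝ}, x ∈ Icc 0 A → max 0 (min x A) = x := fun hx => by
    rw [min_eq_left hx.2, max_eq_right hx.1]
  have cl0 : ∀ {A x : ℝ}, x ≤ 0 → max 0 (min x A) = 0 := fun hx =>
    max_eq_left ((min_le_left _ _).trans hx)
  have hbn : ∀ {x : ℝ}, x ≤ 0 → hb x = z 0 := fun hx => by simp only [hhb, cl0 hx, hcomp₀]
  have Hbn : ∀ {x : ℝ}, x ≤ 0 → Hb x = 0 := fun hx => by
    simp only [hHb, cl0 hx, intervalIntegral.integral_same]
  have hbp : ∀ {x : ℝ}, x ∈ Icc 0 ρ₀ → hb x = h₀ x := fun hx => by simp only [hhb, cl hx]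
  have Hbp : ∀ {x : ℝ}, x ∈ Icc 0 ρ₀ → Hb x = ∫ s in 0..x, h₁ s := fun hx => by
    simp only [hHb, cl hx]
  have bbp : ∀ r ∈ Icc 0 ρ₀, bb r = (1 / 2) * h₀ r + (1 / 2) * ∫ s in 0..r, h₁ s := by
    intro r hr
    simp only [hbb]
    rw [hbp hr, Hbp hr, hbn (neg_nonpos.2 hr.1), Hbn (neg_nonpos.2 hr.1)]
    ring
  have bbn : ∀ r ∈ Icc 0 ρ₀, bb (-r) = z 0 - (1 / 2) * h₀ r + (1 / 2) * ∫ s in 0..r, h₁ s := by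
    intro r hr
    simp only [hbb, neg_neg]
    rw [hbp hr, Hbp hr, hbn (neg_nonpos.2 hr.1), Hbn (neg_nonpos.2 hr.1)]
    ring
  have hρ₀m : ρ₀ ∈ Icc 0 ρ₀ := ⟨hρ₀.le, le_rfl⟩
  have bbge : ∀ y, ρ₀ ≤ y → bb y = bb ρ₀ := by
    intro y hy
    have e : max 0 (min y ρ₀) = max 0 (min ρ₀ ρ₀) := by rw [min_eq_right hy, min_self]
    have e1 : hb y = hb ρ₀ := by simp only [hhb, e]
    have e2 : Hb y = Hb ρ₀ := by simp only [hHb, e]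
    simp only [hbb]
    rw [e1, e2, hbn (by linarith : -y ≤ 0), Hbn (by linarith : -y ≤ 0), hbn (by linarith : -ρ₀ ≤ 0),
      Hbn (by linarith : -ρ₀ ≤ 0)]
  -- In the domain `y ≤ T + ρ T`, and each reflection lowers `y` by at least `2 * ρ₀`, so `N`
  -- reflections exhaust it.
  obtain ⟨N, hN⟩ := exists_nat_ge ((T + ρ T) / (2 * ρ₀))
  rw [div_le_iff₀ (by positivity)] at hN
  obtain ⟨g, hgc, hg⟩ := hρ.exists_waveMap_fixedPoint (T := T) hT hρ₀ α zb1.continuous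
    bb1.continuous N
  obtain ⟨K, M, hS⟩ := hρ.isSource_charSource hT hρ₀ α hgc
  set Φ := charSource T R α ρ g with hΦ
  have hΦ0 : ∀ p : ℝ × ℝ, p.1 + p.2 ≤ 0 → Φ p = 0 := hρ.charSource_of_nonpos α g
  have hL : 0 ≤ 2 * K * M := by
    have := hS.K_nonneg
    have := hS.M_nonneg
    positivity
  have hG := fun x y x' y' => hS.abs_quadInt_sub_le x y x' y'
  have hκρ : κ ρ₀ = -ρ₀ := reflect_initial hρ hT hρ₀
  -- The defect at `ρ₀` reduces to `-h₀ ρ₀`, so this is the compatibility of the data at the front.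
  -- The one at `r = 0` enters through `hbn`.
  have hD : frontDefect κ ρ₀ zb bb (quadInt Φ) ρ₀ = 0 := by
    rw [frontDefect, hκρ, quadInt_eq_zero hΦ0 (by linarith), quadInt_eq_zero hΦ0 (by linarith),
      bbn ρ₀ hρ₀m, bbp ρ₀ hρ₀m, hcomp₁]
    simp only [hzb, cl0 (by linarith : -ρ₀ ≤ 0)]
    ring
  have hin : ∀ y ≤ ρ₀, incoming κ ρ₀ N zb bb (quadInt Φ) y = bb y := fun y hy => by
    rw [incoming, frontSum_of_le hρ₀ hq.reflect_le hD hy, add_zero]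
  have hin1 := IsH1.incoming (ρ₀ := ρ₀) (N := N) zb1 bb1 hq.reflect_mono hq.reflect_sub_le hL hG
  have hout1 := IsH1.outgoing (ρ₀ := ρ₀) (N := N) zb1 bb1 hq.reflect_mono hq.reflect_sub_le hL hG
  have hlin : ∀ p : ℝ × ℝ, ((p.1 - p.2 + (p.1 + p.2)) / 2, (p.1 + p.2 - (p.1 - p.2)) / 2) = p :=
    fun p => by ext <;> simp only <;> ring
  refine ⟨outgoing κ ρ₀ N zb bb (quadInt Φ), incoming κ ρ₀ N zb bb (quadInt Φ), K, M, Φ,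
    ⟨hout1, hin1, hS, hΦ0, fun p hp => ?_, fun p hp => ?_, fun t ht => ?_, fun t ht => ?_,
      fun r hr => ?_, fun r hr => ?_⟩⟩
  · have e := hg p (Omega_subset_closedDomain hρ hp)
    rw [hΦ, charSource]
    simp only [hlin]
    rw [indicator_of_mem hp, e]
    rfl
  · rw [hΦ, charSource]
    simp only [hlin]
    rw [indicator_of_notMem hp, mul_zero]
  · have := waveForm_diag (κ := κ) (ρ₀ := ρ₀) (N := N) (zb := zb) (bb := bb) (G := quadInt Φ) t
    rw [wave]
    simp only [sub_zero, add_zero]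
    rw [waveForm] at this
    rw [this]
    simp only [hzb, cl ht]
  · have h1 : ρ₀ ≤ t + q t := by linarith [hq.le t, ht.1]
    have h2 : t + q t ≤ ρ₀ + 2 * N * ρ₀ := by
      have := hρ.extendFront_le hT hρ₀ t
      linarith [ht.2]
    have h3 := waveForm_front (N := N) hq.reflect_le hD h1 h2 (bbge _ h1)
    have h4 : κ (t + q t) = t - q t := by rw [hκ, reflect, hq.hitTime_eq]
    have h5 : reflect q (t + q t) = t - q t := h4
    rw [h5] at h3
    exact h3
  · rw [hin r hr.2, bbp r hr]
  · rw [outgoing, hin (-r) (by linarith [hr.1]), bbn r hr,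
      quadInt_eq_zero hΦ0 (by linarith [hr.1])]
    simp only [hzb, cl0 (neg_nonpos.2 hr.1)]
    ring

end WaveExistence

end Debonding

namespace Debonding

/-! ### Weak derivatives of the wave. -/

section WaveDerivatives

/-- The derivative of `wave a b Φ` in the direction `v`. -/
def waveDir (a b : ℝ → ℝ) (Φ : ℝ × ℝ → ℝ) (v p : ℝ × ℝ) : ℝ :=
  (v.1 - v.2) * (deriv a (p.1 - p.2) + rowInt Φ (p.1 - p.2) (p.1 + p.2)) +
    (v.1 + v.2) * (deriv b (p.1 + p.2) + colInt Φ (p.1 - p.2) (p.1 + p.2))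

variable {a b : ℝ → ℝ} {K M : ℝ} {Φ : ℝ × ℝ → ℝ}

lemma IsH1.integral_deriv_comp (ha : IsH1 a) (c x s : ℝ) :
    ∫ τ in 0..s, c * deriv a (x - c * τ) = a x - a (x - c * s) := by
  rw [intervalIntegral.integral_const_mul, ← smul_eq_mul,
    intervalIntegral.smul_integral_comp_sub_mul, ha.integral_deriv]
  simp

lemma IsH1.intervalIntegrable_deriv_comp (ha : IsH1 a) (c x s : ℝ) :
    IntervalIntegrable (fun τ => c * deriv a (x - c * τ)) volume 0 s := by
  rcases eq_or_ne c 0 with rfl | hc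
  · simp
  · refine IntervalIntegrable.const_mul ?_ c
    have h1 := ha.intervalIntegrable_deriv x (x - c * s)
    have h2 := (h1.comp_sub_left x).comp_mul_left (c := c)
    simpa [hc] using h2

/-- Along every line the profiles are absolutely continuous, or constant, and `quadInt` is `C¹`; so
there are no exceptional points or directions. -/
lemma wave_sub (ha : IsH1 a) (hb : IsH1 b) (hS : IsSource K M Φ) (v p : ℝ × ℝ) (s : ℝ) :
    wave a b Φ p - wave a b Φ (p - s • v) = lineInt s v (waveDir a b Φ v) p := by
  set c := v.1 - v.2 with hc
  set d := v.1 + v.2 with hd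
  set x := p.1 - p.2 with hx
  set y := p.1 + p.2 with hy
  have e1 : ∀ τ : ℝ, (p - τ • v).1 - (p - τ • v).2 = x - c * τ := fun τ => by
    simp only [Prod.fst_sub, Prod.snd_sub, Prod.smul_fst, Prod.smul_snd, smul_eq_mul, hx, hc]
    ring
  have e2 : ∀ τ : ℝ, (p - τ • v).1 + (p - τ • v).2 = y - d * τ := fun τ => by
    simp only [Prod.fst_sub, Prod.snd_sub, Prod.smul_fst, Prod.smul_snd, smul_eq_mul, hy, hd]
    ring
  have hder : ∀ τ ∈ uIcc 0 s, HasDerivAt (fun τ => -quadInt Φ (x - c * τ) (y - d * τ))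
      (c * rowInt Φ (x - c * τ) (y - d * τ) + d * colInt Φ (x - c * τ) (y - d * τ)) τ := by
    intro τ _
    have := (hS.hasDerivAt_line x y (-c) (-d) τ).neg
    have f1 : ∀ τ : ℝ, x + τ * -c = x - c * τ := fun τ => by ring
    have f2 : ∀ τ : ℝ, y + τ * -d = y - d * τ := fun τ => by ring
    simp only [f1, f2] at this
    refine this.congr_deriv ?_
    ring
  have hline : Continuous fun τ : ℝ => (x - c * τ, y - d * τ) := by fun_prop
  have c1 : Continuous fun τ => c * rowInt Φ (x - c * τ) (y - d * τ) :=
    continuous_const.mul (hS.continuous_rowInt.comp hline)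
  have c2 : Continuous fun τ => d * colInt Φ (x - c * τ) (y - d * τ) :=
    continuous_const.mul (hS.continuous_colInt.comp hline)
  have hG := intervalIntegral.integral_eq_sub_of_hasDerivAt hder
    ((c1.add c2).intervalIntegrable 0 s)
  have i1 := ha.intervalIntegrable_deriv_comp c x s
  have i2 := hb.intervalIntegrable_deriv_comp d y s
  have i3 : IntervalIntegrable (fun τ => c * rowInt Φ (x - c * τ) (y - d * τ)
      + d * colInt Φ (x - c * τ) (y - d * τ)) volume 0 s := (c1.add c2).intervalIntegrable 0 s
  have e3 : lineInt s v (waveDir a b Φ v) p = ∫ τ in 0..s, ((c * deriv a (x - c * τ)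
      + d * deriv b (y - d * τ)) + (c * rowInt Φ (x - c * τ) (y - d * τ)
      + d * colInt Φ (x - c * τ) (y - d * τ))) := by
    rw [lineInt]
    congr 1
    ext τ
    rw [waveDir, e1, e2]
    ring
  rw [e3, intervalIntegral.integral_add (i1.add i2) i3, intervalIntegral.integral_add i1 i2,
    ha.integral_deriv_comp, hb.integral_deriv_comp, hG]
  simp only [wave, e1, e2]
  simp only [mul_zero, sub_zero]
  ring

/-- In the direction `(1, -1)` only `a'` and `rowInt` survive. Along `(1, 1)` the coordinate `x` is
constant, so `a'`, which need not be differentiable, cancels. The factor `4` is `2` from the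
direction times the speed `2` of `y`. -/
lemma waveDir_out_sub (hS : IsSource K M Φ) (p : ℝ × ℝ) (s : ℝ) :
    waveDir a b Φ (1, -1) p - waveDir a b Φ (1, -1) (p - s • ((1, 1) : ℝ × ℝ)) =
      lineInt s (1, 1) (fun p => 4 * Φ (p.1 - p.2, p.1 + p.2)) p := by
  have e1 : ∀ τ : ℝ, (p - τ • ((1, 1) : ℝ × ℝ)).1 - (p - τ • ((1, 1) : ℝ × ℝ)).2 = p.1 - p.2 :=
    fun τ => by simp
  have e2 : ∀ τ : ℝ, (p - τ • ((1, 1) : ℝ × ℝ)).1 + (p - τ • ((1, 1) : ℝ × ℝ)).2 =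
      p.1 + p.2 - 2 * τ := fun τ => by
    simp; ring
  simp only [lineInt, waveDir, e1, e2]
  have h1 := intervalIntegral.smul_integral_comp_sub_mul (a := 0) (b := s)
    (fun η => Φ (p.1 - p.2, η)) 2 (p.1 + p.2)
  rw [← hS.rowInt_sub] at h1
  rw [intervalIntegral.integral_const_mul]
  simp only [smul_eq_mul, mul_zero, sub_zero] at h1
  linear_combination (-2) * h1

lemma continuous_wave (ha : IsH1 a) (hb : IsH1 b) (hS : IsSource K M Φ) :
    Continuous (wave a b Φ) :=
  ((ha.continuous.comp (by fun_prop)).add (hb.continuous.comp (by fun_prop))).add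
    (hS.continuous_quadInt.comp (f := fun p : ℝ × ℝ => (p.1 - p.2, p.1 + p.2)) (by fun_prop))

lemma measurable_waveDir (hS : IsSource K M Φ) (v : ℝ × ℝ) : Measurable (waveDir a b Φ v) := by
  have h1 : Measurable fun p : ℝ × ℝ => rowInt Φ (p.1 - p.2) (p.1 + p.2) :=
    (hS.continuous_rowInt.comp (f := fun p : ℝ × ℝ => (p.1 - p.2, p.1 + p.2))
      (by fun_prop)).measurable
  have h2 : Measurable fun p : ℝ × ℝ => colInt Φ (p.1 - p.2) (p.1 + p.2) :=
    (hS.continuous_colInt.comp (f := fun p : ℝ × ℝ => (p.1 - p.2, p.1 + p.2))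
      (by fun_prop)).measurable
  have h3 : Measurable fun p : ℝ × ℝ => deriv a (p.1 - p.2) :=
    (measurable_deriv a).comp (by fun_prop)
  have h4 : Measurable fun p : ℝ × ℝ => deriv b (p.1 + p.2) :=
    (measurable_deriv b).comp (by fun_prop)
  exact ((h3.add h1).const_mul _).add ((h4.add h2).const_mul _)

lemma IsH1.memLp_indicator_deriv (ha : IsH1 a) (A : ℝ) :
    MemLp ((Icc (-A) A).indicator (deriv a)) 2 :=
  (memLp_indicator_iff_restrict measurableSet_Icc).2 (ha.memLp_deriv _ _)

lemma restrict_le_prod_restrict {U : Set (ℝ × ℝ)} {I : Set ℝ} (h : ∀ p ∈ U, p.2 ∈ I) :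
    volume.restrict U ≤ (volume : Measure ℝ).prod (volume.restrict I) := by
  have e : (volume : Measure ℝ).prod (volume.restrict I) =
      (volume.restrict univ).prod (volume.restrict I) := by rw [Measure.restrict_univ]
  rw [e, Measure.prod_restrict, ← Measure.volume_eq_prod]
  exact Measure.restrict_mono (fun p hp => mk_mem_prod (mem_univ _) (h p hp)) le_rfl

/-- Fubini after the shear `(t, r) ↦ (t - r, r)`. Truncation to `[-2 * B, 2 * B]` makes `a'`
globally square integrable without changing the function on `U`. -/
lemma IsH1.memLp_deriv_sub (ha : IsH1 a) {B : ℝ} {U : Set (ℝ × ℝ)} (hU : MeasurableSet U)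
    (hUB : ∀ p ∈ U, |p.1| ≤ B ∧ |p.2| ≤ B) :
    MemLp (fun p : ℝ × ℝ => deriv a (p.1 - p.2)) 2 (volume.restrict U) := by
  set f := (Icc (-(2 * B)) (2 * B)).indicator (deriv a) with hf
  have h1 : MemLp (fun p : ℝ × ℝ => f p.1) 2
      ((volume : Measure ℝ).prod (volume.restrict (Icc (-B) B))) :=
    (ha.memLp_indicator_deriv _).comp_fst _
  have h2 := h1.comp_measurePreserving
    (measurePreserving_sub_prod (volume : Measure ℝ) (volume.restrict (Icc (-B) B)))
  have h3 := restrict_le_prod_restrict (I := Icc (-B) B) fun p hp => abs_le.1 (hUB p hp).2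
  refine (h2.mono_measure h3).ae_eq ((ae_restrict_iff' hU).2 (ae_of_all _ fun p hp => ?_))
  obtain ⟨k1, k2⟩ := hUB p hp
  rw [abs_le] at k1 k2
  simp only [Function.comp, hf]
  rw [indicator_of_mem]
  constructor <;> linarith

lemma IsH1.memLp_deriv_add (hb : IsH1 b) {B : ℝ} {U : Set (ℝ × ℝ)} (hU : MeasurableSet U)
    (hUB : ∀ p ∈ U, |p.1| ≤ B ∧ |p.2| ≤ B) :
    MemLp (fun p : ℝ × ℝ => deriv b (p.1 + p.2)) 2 (volume.restrict U) := by
  set f := (Icc (-(2 * B)) (2 * B)).indicator (deriv b) with hf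
  have h1 : MemLp (fun p : ℝ × ℝ => f p.1) 2
      ((volume : Measure ℝ).prod (volume.restrict (Icc (-B) B))) :=
    (hb.memLp_indicator_deriv _).comp_fst _
  have h2 := h1.comp_measurePreserving
    (measurePreserving_add_prod (volume : Measure ℝ) (volume.restrict (Icc (-B) B)))
  have h3 := restrict_le_prod_restrict (I := Icc (-B) B) fun p hp => abs_le.1 (hUB p hp).2
  refine (h2.mono_measure h3).ae_eq ((ae_restrict_iff' hU).2 (ae_of_all _ fun p hp => ?_))
  obtain ⟨k1, k2⟩ := hUB p hp
  rw [abs_le] at k1 k2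
  simp only [Function.comp, hf]
  rw [indicator_of_mem]
  constructor <;> linarith

lemma volume_lt_top_of_bounded {B : ℝ} {U : Set (ℝ × ℝ)}
    (hUB : ∀ p ∈ U, |p.1| ≤ B ∧ |p.2| ≤ B) : volume U < ⊤ :=
  (measure_mono fun p hp => ⟨abs_le.1 (hUB p hp).1, abs_le.1 (hUB p hp).2⟩ :
    volume U ≤ volume (Icc (-B) B ×ˢ Icc (-B) B)).trans_lt
    (isCompact_Icc.prod isCompact_Icc).measure_lt_top

lemma memLp_waveDir (ha : IsH1 a) (hb : IsH1 b) (hS : IsSource K M Φ) {B : ℝ} {U : Set (ℝ × ℝ)}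
    (hU : MeasurableSet U) (hUB : ∀ p ∈ U, |p.1| ≤ B ∧ |p.2| ≤ B) (v : ℝ × ℝ) :
    MemLp (waveDir a b Φ v) 2 (volume.restrict U) := by
  have : IsFiniteMeasure (volume.restrict U) :=
    ⟨by simpa using volume_lt_top_of_bounded hUB⟩
  have h1 : MemLp (fun p : ℝ × ℝ => rowInt Φ (p.1 - p.2) (p.1 + p.2)) 2 (volume.restrict U) :=
    MemLp.of_bound (hS.continuous_rowInt.comp (f := fun p : ℝ × ℝ => (p.1 - p.2, p.1 + p.2))
      (by fun_prop)).aestronglyMeasurable (2 * K * M) (ae_of_all _ fun p => hS.abs_rowInt_le _ _)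
  have h2 : MemLp (fun p : ℝ × ℝ => colInt Φ (p.1 - p.2) (p.1 + p.2)) 2 (volume.restrict U) :=
    MemLp.of_bound (hS.continuous_colInt.comp (f := fun p : ℝ × ℝ => (p.1 - p.2, p.1 + p.2))
      (by fun_prop)).aestronglyMeasurable (2 * K * M) (ae_of_all _ fun p => hS.abs_colInt_le _ _)
  exact (((ha.memLp_deriv_sub hU hUB).add h1).const_mul _).add
    (((hb.memLp_deriv_add hU hUB).add h2).const_mul _)

lemma memLp_wave (ha : IsH1 a) (hb : IsH1 b) (hS : IsSource K M Φ) {B : ℝ} {U : Set (ℝ × ℝ)}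
    (hU : MeasurableSet U) (hUB : ∀ p ∈ U, |p.1| ≤ B ∧ |p.2| ≤ B) :
    MemLp (wave a b Φ) 2 (volume.restrict U) := by
  have : IsFiniteMeasure (volume.restrict U) :=
    ⟨by simpa using volume_lt_top_of_bounded hUB⟩
  have hc := continuous_wave ha hb hS
  obtain ⟨C, hC⟩ := (isCompact_Icc.prod isCompact_Icc : IsCompact
    (Icc (-B) B ×ˢ Icc (-B) B)).exists_bound_of_continuousOn hc.continuousOn
  exact MemLp.of_bound hc.aestronglyMeasurable C ((ae_restrict_iff' hU).2 (ae_of_all _ fun p hp =>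
    hC p ⟨abs_le.1 (hUB p hp).1, abs_le.1 (hUB p hp).2⟩))

lemma hasWeakDeriv_wave (ha : IsH1 a) (hb : IsH1 b) (hS : IsSource K M Φ) {B : ℝ}
    {U : Set (ℝ × ℝ)} (hU : IsOpen U) (hUB : ∀ p ∈ U, |p.1| ≤ B ∧ |p.2| ≤ B) (v : ℝ × ℝ) :
    HasWeakDeriv U v (wave a b Φ) (waveDir a b Φ v) := by
  have : IsFiniteMeasure (volume.restrict U) :=
    ⟨by simpa using volume_lt_top_of_bounded hUB⟩
  exact hasWeakDeriv_of_sub_eq_lineInt hU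
    ((memLp_wave ha hb hS hU.measurableSet hUB).integrable (by norm_num))
    ((memLp_waveDir ha hb hS hU.measurableSet hUB v).integrable (by norm_num))
    fun p s _ _ => wave_sub ha hb hS v p s

end WaveDerivatives

/-! ### The wave solves the equation. -/

section WaveEquation

variable {T R ρ₀ α : ℝ} {ρ z h₀ h₁ a b : ℝ → ℝ} {K M : ℝ} {Φ : ℝ × ℝ → ℝ}

lemma IsFront.abs_le_of_mem_Omega (hρ : IsFront T R ρ₀ ρ) (hT : 0 < T) (hρ₀ : 0 < ρ₀) :
    ∀ p ∈ Omega T R ρ, |p.1| ≤ T + ρ T ∧ |p.2| ≤ T + ρ T := by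
  intro p hp
  obtain ⟨h1, h2, h3, h4⟩ := hρ.mem_Omega.1 hp
  have h5 := hρ.extendFront_le hT hρ₀ p.1
  rw [abs_of_pos h1, abs_of_pos h3]
  constructor <;> linarith

/-- The wave operator factors into the two characteristic derivatives, which are moved from `φ` onto
the wave one after the other. Only the outgoing derivative of the wave is formed, so `b` is never
differentiated. -/
lemma IsWave.equation (hw : IsWave T R ρ₀ α ρ z h₀ h₁ a b K M Φ) (hρ : IsFront T R ρ₀ ρ)
    (hT : 0 < T) (hρ₀ : 0 < ρ₀) {φ : ℝ × ℝ → ℝ} (hφ : IsTestFun (Omega T R ρ) φ) :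
    ∫ p in Omega T R ρ, wave a b Φ p *
      (dirDeriv (1, 0) (dirDeriv (1, 0) φ) p - dirDeriv (0, 1) (dirDeriv (0, 1) φ) p
        - potential α R p.2 * φ p) = 0 := by
  have hU := hρ.isOpen_Omega hT hρ₀
  have hUB := hρ.abs_le_of_mem_Omega hT hρ₀
  have ha := hw.out_h1
  have hb := hw.in_h1
  have hS := hw.source
  have : IsFiniteMeasure (volume.restrict (Omega T R ρ)) :=
    ⟨by simpa using volume_lt_top_of_bounded hUB⟩
  have m1 := hasWeakDeriv_wave ha hb hS hU hUB (1, -1) _ (hφ.dirDeriv (1, 1))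
  have iu : IntegrableOn (wave a b Φ) (Omega T R ρ) :=
    (memLp_wave ha hb hS hU.measurableSet hUB).integrable (by norm_num)
  have iF : IntegrableOn (fun p : ℝ × ℝ => 4 * Φ (p.1 - p.2, p.1 + p.2)) (Omega T R ρ) := by
    refine MemLp.integrable (q := 2) (by norm_num) (MemLp.of_bound
      ((hS.measurable.comp (by fun_prop)).const_mul _).aestronglyMeasurable (4 * M)
      (ae_of_all _ fun p => ?_))
    rw [norm_mul]
    norm_num
    exact hS.bound _
  have m2 := hasWeakDeriv_of_sub_eq_lineInt hU
    ((memLp_waveDir ha hb hS hU.measurableSet hUB (1, -1)).integrable (by norm_num)) iF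
    (fun p s _ _ => waveDir_out_sub (a := a) (b := b) hS p s) φ hφ
  have e : ∀ p ∈ Omega T R ρ, wave a b Φ p *
      (dirDeriv (1, 0) (dirDeriv (1, 0) φ) p - dirDeriv (0, 1) (dirDeriv (0, 1) φ) p
        - potential α R p.2 * φ p) =
      wave a b Φ p * dirDeriv (1, -1) (dirDeriv (1, 1) φ) p
        - 4 * Φ (p.1 - p.2, p.1 + p.2) * φ p := by
    intro p hp
    rw [hw.source_mem p hp, dirDeriv_char_eq hφ.smooth]
    ring
  obtain ⟨c1, -, k1⟩ := ((hφ.dirDeriv (1, 1)).dirDeriv (1, -1)).bounded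
  obtain ⟨c2, -, k2⟩ := hφ.bounded
  rw [setIntegral_congr_fun hU.measurableSet e, integral_sub
    (iu.mul_bdd (c := c1) ((hφ.dirDeriv (1, 1)).dirDeriv (1, -1)).continuous.aestronglyMeasurable
      (ae_of_all _ k1))
    (iF.mul_bdd (c := c2) hφ.continuous.aestronglyMeasurable (ae_of_all _ k2)), m1, m2]
  ring

end WaveEquation

end Debonding

namespace Debonding

/-! ### Continuity in time with values in `L²`. -/

section ContinuousSlices

/-- `t ↦ k t` is continuous with values in `L²(μ)`. -/
def L2Continuous (μ : Measure ℝ) (k : ℝ → ℝ → ℝ) : Prop :=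
  (∀ t, MemLp (k t) 2 μ) ∧
    ∀ s, Tendsto (fun t => eLpNorm (fun r => k t r - k s r) 2 μ) (𝓝 s) (𝓝 0)

variable {μ : Measure ℝ} {k l : ℝ → ℝ → ℝ}

lemma L2Continuous.add (hk : L2Continuous μ k) (hl : L2Continuous μ l) :
    L2Continuous μ fun t r => k t r + l t r := by
  refine ⟨fun t => (hk.1 t).add (hl.1 t), fun s => ?_⟩
  refine tendsto_of_tendsto_of_tendsto_of_le_of_le tendsto_const_nhds
    (by simpa using (hk.2 s).add (hl.2 s)) (fun _ => zero_le) fun t => ?_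
  have e : (fun r => k t r + l t r - (k s r + l s r)) =
      (fun r => k t r - k s r) + fun r => l t r - l s r := by
    ext r; simp only [Pi.add_apply]; ring
  simp only
  rw [e]
  exact eLpNorm_add_le ((hk.1 t).sub (hk.1 s)).1 ((hl.1 t).sub (hl.1 s)).1 (by norm_num)

lemma L2Continuous.const_mul (hk : L2Continuous μ k) (c : ℝ) :
    L2Continuous μ fun t r => c * k t r := by
  refine ⟨fun t => (hk.1 t).const_mul c, fun s => ?_⟩
  have h := ENNReal.Tendsto.const_mul (a := ‖c‖ₑ) (hk.2 s) (Or.inr enorm_ne_top)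
  rw [mul_zero] at h
  refine h.congr fun t => ?_
  rw [← eLpNorm_const_smul]
  congr 1
  ext r
  simp only [Pi.smul_apply, smul_eq_mul]
  ring

lemma L2Continuous.restrict (hk : L2Continuous μ k) (S : Set ℝ) :
    L2Continuous (μ.restrict S) k :=
  ⟨fun t => (hk.1 t).restrict S, fun s => tendsto_of_tendsto_of_tendsto_of_le_of_le
    tendsto_const_nhds (hk.2 s) (fun _ => zero_le)
    fun _ => eLpNorm_mono_measure _ Measure.restrict_le_self⟩

/-- Continuity is local in time, so locally square integrable functions may be truncated near each
instant. -/
lemma L2Continuous.of_eventually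
    (h : ∀ s, ∃ l, L2Continuous μ l ∧ ∀ᶠ t in 𝓝 s, k t =ᵐ[μ] l t) : L2Continuous μ k := by
  refine ⟨fun t => ?_, fun s => ?_⟩
  · obtain ⟨l, h1, h2⟩ := h t
    exact (h1.1 t).ae_eq h2.self_of_nhds.symm
  · obtain ⟨l, h1, h2⟩ := h s
    refine (h1.2 s).congr' ?_
    filter_upwards [h2] with t ht
    refine eLpNorm_congr_ae ?_
    filter_upwards [ht, h2.self_of_nhds] with r e1 e2
    rw [e1, e2]

lemma L2Continuous.of_continuous (A B : ℝ) (hk : Continuous (Function.uncurry k)) :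
    L2Continuous (volume.restrict (Ioo A B)) k := by
  refine ⟨fun t => ?_, fun s => ?_⟩
  · have hc : Continuous (k t) := hk.comp (Continuous.prodMk_right t)
    obtain ⟨C, hC⟩ := isCompact_Icc.exists_bound_of_continuousOn (hc.continuousOn (s := Icc A B))
    exact MemLp.of_bound hc.aestronglyMeasurable C ((ae_restrict_iff' measurableSet_Ioo).2
      (ae_of_all _ fun r hr => hC r (Ioo_subset_Icc_self hr)))
  · rw [ENNReal.tendsto_nhds_zero]
    intro δ hδ
    set D := (volume.restrict (Ioo A B)) univ ^ ((2 : ℝ≥0∞).toReal)⁻¹ with hD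
    have hDt : D ≠ ⊤ := ENNReal.rpow_ne_top_of_nonneg (by positivity) (measure_ne_top _ _)
    obtain ⟨ε, hε, hεδ⟩ : ∃ ε : ℝ, 0 < ε ∧ D * ENNReal.ofReal ε ≤ δ := by
      have h1 : Tendsto (fun ε : ℝ => D * ENNReal.ofReal ε) (𝓝[>] 0) (𝓝 0) := by
        have := ENNReal.Tendsto.const_mul (a := D) (ENNReal.tendsto_ofReal
          (tendsto_nhdsWithin_of_tendsto_nhds tendsto_id : Tendsto id (𝓝[>] (0 : ℝ)) (𝓝 0)))
          (Or.inr hDt)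
        simpa using this
      obtain ⟨ε, h2, h3⟩ := ((ENNReal.tendsto_nhds_zero.1 h1 δ hδ).and
        self_mem_nhdsWithin).exists
      exact ⟨ε, h3, h2⟩
    have h1 : ∀ᶠ t in 𝓝 s, ∀ r ∈ Icc A B, ‖k t r - k s r‖ ≤ ε := by
      refine isCompact_Icc.eventually_forall_of_forall_eventually fun r _ => ?_
      have h2 : ContinuousAt (fun z : ℝ × ℝ => ‖k z.1 z.2 - k s z.2‖) (s, r) := by
        refine Continuous.continuousAt (Continuous.norm (Continuous.sub ?_ ?_))
        · exact hk
        · exact hk.comp (by fun_prop : Continuous fun z : ℝ × ℝ => (s, z.2))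
      have h3 : ‖k s r - k s r‖ < ε := by simpa using hε
      exact (h2.eventually (gt_mem_nhds h3)).mono fun z hz => hz.le
    filter_upwards [h1] with t ht
    refine (eLpNorm_le_of_ae_bound ((ae_restrict_iff' measurableSet_Ioo).2
      (ae_of_all _ fun r hr => ht r (Ioo_subset_Icc_self hr)))).trans hεδ

/-- Continuity of translations in `L²`, as a case of composition with measure preserving maps that
depend continuously on `t`. -/
lemma L2Continuous.comp_sub {f : ℝ → ℝ} (hf : MemLp f 2) :
    L2Continuous volume fun t r => f (t - r) := by
  have hm : ∀ t : ℝ, MeasurePreserving (fun r : ℝ => t - r) := fun t =>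
    Measure.measurePreserving_sub_left volume t
  refine ⟨fun t => hf.comp_measurePreserving (hm t), fun s => ?_⟩
  let c : C(ℝ, C(ℝ, ℝ)) := ContinuousMap.curry ⟨fun p : ℝ × ℝ => p.1 - p.2, by fun_prop⟩
  have h1 : Tendsto (fun t => Lp.compMeasurePreserving (c t) (hm t) (hf.toLp f)) (𝓝 s)
      (𝓝 (Lp.compMeasurePreserving (c s) (hm s) (hf.toLp f))) :=
    Filter.Tendsto.compMeasurePreservingLp tendsto_const_nhds (c.continuous.tendsto s)
      (fun t => hm t) (hm s) (by norm_num)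
  have h2 := (Lp.tendsto_Lp_iff_tendsto_eLpNorm' _ _).1 h1
  refine h2.congr fun t => eLpNorm_congr_ae ?_
  have e : ∀ t : ℝ, Lp.compMeasurePreserving (c t) (hm t) (hf.toLp f) =ᵐ[volume]
      fun r => f (t - r) := fun t =>
    (Lp.coeFn_compMeasurePreserving _ _).trans
      ((hm t).quasiMeasurePreserving.ae_eq_comp hf.coeFn_toLp)
  filter_upwards [e t, e s] with r e1 e2
  rw [Pi.sub_apply, e1, e2]

lemma L2Continuous.comp_add {f : ℝ → ℝ} (hf : MemLp f 2) :
    L2Continuous volume fun t r => f (t + r) := by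
  have hm : ∀ t : ℝ, MeasurePreserving (fun r : ℝ => t + r) := fun t =>
    measurePreserving_add_left volume t
  refine ⟨fun t => hf.comp_measurePreserving (hm t), fun s => ?_⟩
  let c : C(ℝ, C(ℝ, ℝ)) := ContinuousMap.curry ⟨fun p : ℝ × ℝ => p.1 + p.2, by fun_prop⟩
  have h1 : Tendsto (fun t => Lp.compMeasurePreserving (c t) (hm t) (hf.toLp f)) (𝓝 s)
      (𝓝 (Lp.compMeasurePreserving (c s) (hm s) (hf.toLp f))) :=
    Filter.Tendsto.compMeasurePreservingLp tendsto_const_nhds (c.continuous.tendsto s)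
      (fun t => hm t) (hm s) (by norm_num)
  have h2 := (Lp.tendsto_Lp_iff_tendsto_eLpNorm' _ _).1 h1
  refine h2.congr fun t => eLpNorm_congr_ae ?_
  have e : ∀ t : ℝ, Lp.compMeasurePreserving (c t) (hm t) (hf.toLp f) =ᵐ[volume]
      fun r => f (t + r) := fun t =>
    (Lp.coeFn_compMeasurePreserving _ _).trans
      ((hm t).quasiMeasurePreserving.ae_eq_comp hf.coeFn_toLp)
  filter_upwards [e t, e s] with r e1 e2
  rw [Pi.sub_apply, e1, e2]

/-- Cutting off at a continuously moving point preserves continuity in `L²`. -/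
lemma L2Continuous.indicator_Iic {S : Set ℝ} (hk : L2Continuous (volume.restrict S) k) {q : ℝ → ℝ}
    (hq : Continuous q) : L2Continuous (volume.restrict S) fun t => (Iic (q t)).indicator (k t) := by
  refine ⟨fun t => (hk.1 t).indicator measurableSet_Iic, fun s => ?_⟩
  -- The two cutoffs differ on the interval between `q s` and `q t`, whose length tends to zero, and
  -- a single `L²` function has small norm on sets of small measure.
  have h2 : Tendsto (fun t => eLpNorm ((uIcc (q s) (q t)).indicator (k s)) 2
      (volume.restrict S)) (𝓝 s) (𝓝 0) := by
    rw [ENNReal.tendsto_nhds_zero]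
    intro δ hδ
    rcases eq_or_ne δ ⊤ with rfl | hδt
    · exact Eventually.of_forall fun _ => le_top
    obtain ⟨η, hη, h⟩ := (hk.1 s).eLpNorm_indicator_le (by norm_num) (by norm_num)
      (ENNReal.toReal_pos hδ.ne' hδt)
    rw [ENNReal.ofReal_toReal hδt] at h
    have h3 : ∀ᶠ t in 𝓝 s, |q t - q s| < η := by
      have : Tendsto (fun t => |q t - q s|) (𝓝 s) (𝓝 |q s - q s|) :=
        ((hq.tendsto s).sub_const _).abs
      rw [sub_self, abs_zero] at this
      exact this.eventually (gt_mem_nhds hη)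
    filter_upwards [h3] with t ht
    refine h _ measurableSet_uIcc (((Measure.restrict_apply_le _ _)).trans ?_)
    rw [Real.volume_interval]
    exact ENNReal.ofReal_le_ofReal ht.le
  refine tendsto_of_tendsto_of_tendsto_of_le_of_le tendsto_const_nhds
    (by simpa using (hk.2 s).add h2) (fun _ => zero_le) fun t => ?_
  have e : (fun r => (Iic (q t)).indicator (k t) r - (Iic (q s)).indicator (k s) r) =
      (Iic (q t)).indicator (fun r => k t r - k s r) +
        ((Iic (q t)).indicator (k s) - (Iic (q s)).indicator (k s)) := by
    ext r
    simp only [Pi.add_apply, Pi.sub_apply, indicator]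
    split_ifs <;> ring
  simp only
  rw [e]
  refine (eLpNorm_add_le (((hk.1 t).sub (hk.1 s)).1.indicator measurableSet_Iic)
    (((hk.1 s).1.indicator measurableSet_Iic).sub ((hk.1 s).1.indicator measurableSet_Iic))
    (by norm_num)).trans (add_le_add (eLpNorm_indicator_le _) (eLpNorm_mono fun r => ?_))
  rw [Pi.sub_apply]
  by_cases h1 : r ≤ q t <;> by_cases h3 : r ≤ q s
  · simp [indicator, h1, h3]
  · have : r ∈ uIcc (q s) (q t) := mem_uIcc.2 (Or.inl ⟨(not_le.1 h3).le, h1⟩)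
    rw [indicator_of_mem (show r ∈ Iic (q t) from h1), indicator_of_notMem (show r ∉ Iic (q s) from h3),
      indicator_of_mem this, sub_zero]
  · have : r ∈ uIcc (q s) (q t) := mem_uIcc.2 (Or.inr ⟨(not_le.1 h1).le, h3⟩)
    rw [indicator_of_notMem (show r ∉ Iic (q t) from h1), indicator_of_mem (show r ∈ Iic (q s) from h3),
      indicator_of_mem this, zero_sub, norm_neg]
  · simp [indicator, h1, h3]

lemma L2Continuous.continuous_toLp (hk : L2Continuous μ k) :
    Continuous fun t => (hk.1 t).toLp (k t) := by
  rw [continuous_iff_continuousAt]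
  intro s
  exact (Lp.tendsto_Lp_iff_tendsto_eLpNorm'' _ (fun t => hk.1 t) _ (hk.1 s)).2 (hk.2 s)

end ContinuousSlices

end Debonding

namespace Debonding

/-! ### Boundary and initial traces of the wave. -/

section Traces

lemma hasTrace_of_continuous {A B δ : ℝ} {γ : ℝ → ℝ → ℝ × ℝ} {h : ℝ × ℝ → ℝ} {g : ℝ → ℝ}
    {k : ℝ → ℝ → ℝ} (hδ : 0 < δ) (hk : Continuous (Function.uncurry k))
    (h1 : ∀ ε ∈ Ioo 0 δ, ∀ s ∈ Ioo A B, h (γ ε s) = k ε s) (h2 : ∀ s ∈ Ioo A B, k 0 s = g s) :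
    HasTrace A B γ h g := by
  have h3 := ((L2Continuous.of_continuous A B hk).2 0).mono_left
    (inf_le_left.trans nhdsWithin_le_nhds : essZeroRight ≤ 𝓝 0)
  refine h3.congr' ?_
  have h4 : ∀ᶠ ε in essZeroRight, ε ∈ Ioo 0 δ :=
    (inf_le_left : essZeroRight ≤ 𝓝[>] 0) (Ioo_mem_nhdsGT hδ)
  filter_upwards [h4] with ε hε
  refine eLpNorm_congr_ae ((ae_restrict_iff' measurableSet_Ioo).2 (ae_of_all _ fun s hs => ?_))
  simp only [h1 ε hε s hs, h2 s hs]

/-- A test function of `W^{1,2}` norm at most `1` has `L²` norm at most `1`. The initial velocity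
can therefore be checked in the stronger `L²` norm. -/
lemma wNegNorm_le_eLpNorm {A B : ℝ} {f : ℝ → ℝ}
    (hf : AEStronglyMeasurable f (volume.restrict (Ioo A B))) :
    wNegNorm A B f ≤ eLpNorm f 2 (volume.restrict (Ioo A B)) := by
  refine iSup_le fun φ => iSup_le fun hφ => iSup_le fun h1 => ?_
  have hφm : MemLp φ 2 (volume.restrict (Ioo A B)) :=
    (hφ.continuous.memLp_of_hasCompactSupport hφ.compact).restrict _
  have h2 : eLpNorm φ 2 (volume.restrict (Ioo A B)) ≤ 1 := by
    rw [hφm.eLpNorm_eq_integral_rpow_norm (by norm_num) (by norm_num)]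
    rw [← ENNReal.ofReal_one]
    refine ENNReal.ofReal_le_ofReal ?_
    rw [ENNReal.toReal_ofNat]
    refine Real.rpow_le_one (by positivity) ?_ (by positivity)
    have e : ∫ x in Ioo A B, ‖φ x‖ ^ (2 : ℝ) = ∫ x in Ioo A B, φ x ^ 2 := by
      congr 1
      ext x
      rw [Real.rpow_two, Real.norm_eq_abs, sq_abs]
    rw [e]
    rw [w12Norm, Real.sqrt_le_one] at h1
    have : 0 ≤ ∫ x in Ioo A B, deriv φ x ^ 2 := integral_nonneg fun _ => sq_nonneg _
    linarith
  have h3 := eLpNorm_smul_le_mul_eLpNorm (p := 2) (q := 2) (r := 1) hφm.1 hf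
  calc ENNReal.ofReal |∫ r in Ioo A B, f r * φ r|
      ≤ ∫⁻ r in Ioo A B, ‖f r * φ r‖ₑ := by
        rw [← Real.enorm_eq_ofReal_abs]
        exact enorm_integral_le_lintegral_enorm _
    _ = eLpNorm (f • φ) 1 (volume.restrict (Ioo A B)) := by
        rw [eLpNorm_one_eq_lintegral_enorm]
        rfl
    _ ≤ eLpNorm f 2 (volume.restrict (Ioo A B)) * 1 := h3.trans (mul_le_mul_right h2 _)
    _ = _ := mul_one _

lemma HasWeakDeriv.congr_left {U : Set (ℝ × ℝ)} {f f' g : ℝ × ℝ → ℝ} {v : ℝ × ℝ}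
    (hU : MeasurableSet U) (h : HasWeakDeriv U v f g) (e : ∀ p ∈ U, f' p = f p) :
    HasWeakDeriv U v f' g := by
  intro φ hφ
  rw [← h φ hφ]
  exact setIntegral_congr_fun hU fun p hp => by simp only [e p hp]

variable {a b : ℝ → ℝ} {K M : ℝ} {Φ : ℝ × ℝ → ℝ}

lemma l2Continuous_waveDir (ha : IsH1 a) (hb : IsH1 b) (hS : IsSource K M Φ) (v : ℝ × ℝ)
    (A B : ℝ) : L2Continuous (volume.restrict (Ioo A B)) fun t r => waveDir a b Φ v (t, r) := by
  refine L2Continuous.of_eventually fun s => ?_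
  -- For `|t - s| < 1` and `r ∈ (A, B)` both `t - r` and `t + r` lie in `[-D, D]`, so truncating
  -- `a'` and `b'` there changes nothing.
  set D := |s| + 1 + |A| + |B| with hD
  have h1 := ((L2Continuous.comp_sub (ha.memLp_indicator_deriv D)).restrict (Ioo A B)).add
    (L2Continuous.of_continuous A B (k := fun t r => rowInt Φ (t - r) (t + r))
      (hS.continuous_rowInt.comp (f := fun p : ℝ × ℝ => (p.1 - p.2, p.1 + p.2)) (by fun_prop)))
  have h2 := ((L2Continuous.comp_add (hb.memLp_indicator_deriv D)).restrict (Ioo A B)).add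
    (L2Continuous.of_continuous A B (k := fun t r => colInt Φ (t - r) (t + r))
      (hS.continuous_colInt.comp (f := fun p : ℝ × ℝ => (p.1 - p.2, p.1 + p.2)) (by fun_prop)))
  refine ⟨_, (h1.const_mul (v.1 - v.2)).add (h2.const_mul (v.1 + v.2)), ?_⟩
  filter_upwards [Ioo_mem_nhds (sub_one_lt s) (lt_add_one s)] with t ht
  refine (ae_restrict_iff' measurableSet_Ioo).2 (ae_of_all _ fun r hr => ?_)
  have k1 := abs_le.1 (le_refl |s|)
  have k2 := abs_le.1 (le_refl |A|)
  have k3 := abs_le.1 (le_refl |B|)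
  have k4 := abs_nonneg A
  have k5 := abs_nonneg B
  have m1 : t - r ∈ Icc (-D) D := by
    constructor <;> linarith [ht.1, ht.2, hr.1, hr.2]
  have m2 : t + r ∈ Icc (-D) D := by
    constructor <;> linarith [ht.1, ht.2, hr.1, hr.2]
  simp only [waveDir, indicator_of_mem m1, indicator_of_mem m2]

lemma IsH1.ae_differentiableAt {f : ℝ → ℝ} (hf : IsH1 f) : ∀ᵐ x : ℝ, DifferentiableAt ℝ f x := by
  have h : ∀ n : ℕ, ∀ᵐ x : ℝ, x ∈ uIcc (-(n : ℝ)) n → DifferentiableAt ℝ f x := fun n =>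
    (hf.absolutelyContinuous (by have : (0 : ℝ) ≤ n := n.cast_nonneg
                                 linarith)).ae_differentiableAt
  filter_upwards [ae_all_iff.2 h] with x hx
  obtain ⟨n, hn⟩ := exists_nat_ge |x|
  refine hx n ?_
  rw [uIcc_of_le (by have : (0 : ℝ) ≤ n := n.cast_nonneg
                     linarith)]
  exact abs_le.1 hn

variable {T R ρ₀ α : ℝ} {ρ z h₀ h₁ : ℝ → ℝ}

/-- The initial profiles satisfy `b r - a (-r) = ∫ s in 0..r, h₁ s`, which is differentiated at
almost every `r`; the source integrals vanish at time zero. -/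
lemma IsWave.deriv_initial (hw : IsWave T R ρ₀ α ρ z h₀ h₁ a b K M Φ) (hρ₀ : 0 < ρ₀)
    (hh₁ : MemLp h₁ 2 (volume.restrict (Ioo 0 ρ₀))) :
    ∀ᵐ r : ℝ, r ∈ Ioo 0 ρ₀ → waveDir a b Φ (1, 0) (0, r) = h₁ r := by
  have ii : IntervalIntegrable h₁ volume 0 ρ₀ := by
    rw [intervalIntegrable_iff_integrableOn_Ioo_of_le hρ₀.le]
    exact hh₁.integrable (by norm_num)
  have hneg : ∀ᵐ r : ℝ, DifferentiableAt ℝ a (-r) :=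
    (Measure.measurePreserving_neg (volume : Measure ℝ)).quasiMeasurePreserving.ae
      hw.out_h1.ae_differentiableAt
  filter_upwards [hneg, hw.in_h1.ae_differentiableAt, ii.ae_hasDerivAt_integral]
    with r e1 e2 e3 hr
  have e4 := e3 (by rw [uIcc_of_le hρ₀.le]; exact Ioo_subset_Icc_self hr) 0 left_mem_uIcc
  have e5 : HasDerivAt (fun r => b r - a (-r)) (deriv b r + deriv a (-r)) r := by
    have := e2.hasDerivAt.sub (e1.hasDerivAt.comp r (hasDerivAt_neg r))
    refine this.congr_deriv ?_
    ring
  have e6 : (fun r => b r - a (-r)) =ᶠ[𝓝 r] fun r => ∫ s in 0..r, h₁ s := by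
    filter_upwards [Ioo_mem_nhds hr.1 hr.2] with x hx
    rw [hw.in_eq x (Ioo_subset_Icc_self hx), hw.out_eq x (Ioo_subset_Icc_self hx)]
    ring
  have e7 := e5.unique (e4.congr_of_eventuallyEq e6)
  rw [waveDir]
  simp only [zero_sub, zero_add, sub_zero, add_zero, one_mul]
  rw [rowInt_eq_zero hw.source_nonpos (by simp), colInt_eq_zero hw.source_nonpos (by simp), ← e7]
  ring

lemma IsWave.wave_initial (hw : IsWave T R ρ₀ α ρ z h₀ h₁ a b K M Φ) {r : ℝ}
    (hr : r ∈ Icc 0 ρ₀) : wave a b Φ (0, r) = h₀ r := by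
  rw [wave]
  simp only [zero_sub, zero_add]
  rw [hw.in_eq r hr, hw.out_eq r hr, quadInt_eq_zero hw.source_nonpos (by simp)]
  ring

lemma IsWave.isSolution (hw : IsWave T R ρ₀ α ρ z h₀ h₁ a b K M Φ) (hρ : IsFront T R ρ₀ ρ)
    (hT : 0 < T) (hρ₀ : 0 < ρ₀) (hh₁ : MemLp h₁ 2 (volume.restrict (Ioo 0 ρ₀))) :
    IsSolution T R ρ₀ α ρ z h₀ h₁ ((closedDomain T ρ).indicator (wave a b Φ)) := by
  have hU := hρ.isOpen_Omega hT hρ₀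
  have hUB := hρ.abs_le_of_mem_Omega hT hρ₀
  have hq := hρ.isSlowFront hT hρ₀
  have ha := hw.out_h1
  have hb := hw.in_h1
  have hS := hw.source
  have hc := continuous_wave ha hb hS
  have he : ∀ p ∈ Omega T R ρ, (closedDomain T ρ).indicator (wave a b Φ) p = wave a b Φ p :=
    fun p hp => indicator_of_mem (Omega_subset_closedDomain hρ hp) _
  refine ⟨waveDir a b Φ (1, 0), waveDir a b Φ (0, 1), ⟨?_, memLp_waveDir ha hb hS hU.measurableSet
    hUB _, memLp_waveDir ha hb hS hU.measurableSet hUB _,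
    (hasWeakDeriv_wave ha hb hS hU hUB _).congr_left hU.measurableSet he,
    (hasWeakDeriv_wave ha hb hS hU hUB _).congr_left hU.measurableSet he⟩, fun φ hφ => ?_,
    ?_, ?_, ?_, ?_⟩
  · exact (memLp_wave ha hb hS hU.measurableSet hUB).ae_eq
      ((ae_restrict_iff' hU.measurableSet).2 (ae_of_all _ fun p hp => (he p hp).symm))
  · exact (setIntegral_congr_fun hU.measurableSet fun p hp => by simp only [he p hp]).trans
      (hw.equation hρ hT hρ₀ hφ)
  · refine hasTrace_of_continuous (k := fun ε t => wave a b Φ (t, ε)) hρ₀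
      (hc.comp (by fun_prop : Continuous fun p : ℝ × ℝ => (p.2, p.1))) (fun ε hε t ht => ?_)
      fun t ht => hw.left t (Ioo_subset_Icc_self ht)
    exact he _ (hρ.mem_Omega.2 ⟨ht.1, ht.2, hε.1, hε.2.trans_le (hq.le t)⟩)
  · have hqc := hq.continuous
    refine hasTrace_of_continuous (k := fun ε t => wave a b Φ (t, extendFront T ρ t - ε)) hρ₀
      (hc.comp (by fun_prop : Continuous fun p : ℝ × ℝ => (p.2, extendFront T ρ p.2 - p.1)))
      (fun ε hε t ht => ?_) fun t ht => ?_
    · rw [← extendFront_of_mem (ρ := ρ) (Ioo_subset_Icc_self ht)]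
      refine he _ (hρ.mem_Omega.2 ⟨ht.1, ht.2, ?_, ?_⟩)
      · have := hq.le t
        simp only
        linarith [hε.2]
      · simp only
        linarith [hε.1]
    · simp only [sub_zero]
      exact hw.front t (Ioo_subset_Icc_self ht)
  · refine hasTrace_of_continuous (k := fun ε r => wave a b Φ (ε, r)) hT
      (hc.comp (by fun_prop : Continuous fun p : ℝ × ℝ => (p.1, p.2))) (fun ε hε r hr => ?_)
      fun r hr => hw.wave_initial (Ioo_subset_Icc_self hr)
    exact he _ (hρ.mem_Omega.2 ⟨hε.1, hε.2, hr.1, hr.2.trans_le (hq.le _)⟩)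
  · have h1 := l2Continuous_waveDir ha hb hS (1, 0) 0 ρ₀
    have h2 := (h1.2 0).mono_left (inf_le_left.trans nhdsWithin_le_nhds : essZeroRight ≤ 𝓝 0)
    refine tendsto_of_tendsto_of_tendsto_of_le_of_le tendsto_const_nhds h2 (fun _ => zero_le)
      fun t => ?_
    have h3 : eLpNorm (fun r => waveDir a b Φ (1, 0) (t, r) - waveDir a b Φ (1, 0) (0, r)) 2
        (volume.restrict (Ioo 0 ρ₀)) = eLpNorm (fun r => waveDir a b Φ (1, 0) (t, r) - h₁ r) 2
        (volume.restrict (Ioo 0 ρ₀)) := by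
      refine eLpNorm_congr_ae ((ae_restrict_iff' measurableSet_Ioo).2 ?_)
      filter_upwards [hw.deriv_initial hρ₀ hh₁] with r hr hr'
      rw [hr hr']
    simp only
    rw [h3]
    exact wNegNorm_le_eLpNorm ((h1.1 t).sub hh₁).1

end Traces

end Debonding

namespace Debonding

/-! ### Differentiation of curves in `L²`. -/

section SliceDerivative

/-- Minkowski's integral inequality in `L²`. -/
lemma eLpNorm_intervalIntegral_le {μ : Measure ℝ} [SFinite μ] {k : ℝ → ℝ → ℝ}
    (hk : Measurable (Function.uncurry k)) {s t : ℝ} {C : ℝ≥0∞}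
    (hC : ∀ τ ∈ uIcc s t, eLpNorm (k τ) 2 μ ≤ C) :
    eLpNorm (fun r => ∫ τ in s..t, k τ r) 2 μ ≤ ENNReal.ofReal |t - s| * C := by
  have sq : ∀ {ν : Measure ℝ} (f : ℝ → ℝ), eLpNorm f 2 ν ^ (2 : ℝ) = ∫⁻ x, ‖f x‖ₑ ^ (2 : ℝ) ∂ν :=
    fun f => eLpNorm_nnreal_pow_eq_lintegral (p := 2) (by norm_num)
  have hvol : volume.restrict (uIoc s t) univ = ENNReal.ofReal |t - s| := by
    rw [Measure.restrict_apply_univ, uIoc, Real.volume_Ioc, max_sub_min_eq_abs]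
  have h1 : ∀ r, ‖∫ τ in s..t, k τ r‖ₑ ^ (2 : ℝ) ≤
      ENNReal.ofReal |t - s| * ∫⁻ τ in uIoc s t, ‖k τ r‖ₑ ^ (2 : ℝ) := by
    intro r
    have hm : Measurable fun τ => k τ r := hk.comp measurable_prodMk_right
    have e1 : ‖∫ τ in s..t, k τ r‖ₑ ≤ ∫⁻ τ in uIoc s t, ‖k τ r‖ₑ := by
      rw [← ofReal_norm, intervalIntegral.norm_intervalIntegral_eq, ofReal_norm]
      exact enorm_integral_le_lintegral_enorm _
    have e2 := eLpNorm_le_eLpNorm_mul_rpow_measure_univ (p := 1) (q := 2) (by norm_num)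
      (hm.aestronglyMeasurable (μ := volume.restrict (uIoc s t)))
    rw [eLpNorm_one_eq_lintegral_enorm, hvol] at e2
    refine (ENNReal.rpow_le_rpow (e1.trans e2) (by norm_num)).trans_eq ?_
    rw [ENNReal.mul_rpow_of_nonneg _ _ (by norm_num), sq, ← ENNReal.rpow_mul, mul_comm]
    norm_num
  have h2 : ∫⁻ r, ‖∫ τ in s..t, k τ r‖ₑ ^ (2 : ℝ) ∂μ ≤ (ENNReal.ofReal |t - s| * C) ^ (2 : ℝ) := by
    have hkm : Measurable (Function.uncurry fun (r τ : ℝ) => ‖k τ r‖ₑ ^ (2 : ℝ)) :=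
      ((hk.comp measurable_swap).enorm).pow_const _
    calc ∫⁻ r, ‖∫ τ in s..t, k τ r‖ₑ ^ (2 : ℝ) ∂μ
        ≤ ∫⁻ r, (ENNReal.ofReal |t - s| * ∫⁻ τ in uIoc s t, ‖k τ r‖ₑ ^ (2 : ℝ)) ∂μ :=
          lintegral_mono h1
      _ = ENNReal.ofReal |t - s| * ∫⁻ τ in uIoc s t, (∫⁻ r, ‖k τ r‖ₑ ^ (2 : ℝ) ∂μ) := by
          rw [lintegral_const_mul' _ _ ENNReal.ofReal_ne_top,
            lintegral_lintegral_swap hkm.aemeasurable]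
      _ ≤ ENNReal.ofReal |t - s| * ∫⁻ τ in uIoc s t, C ^ (2 : ℝ) := by
          refine mul_le_mul_right ?_ _
          refine setLIntegral_mono measurable_const fun τ hτ => ?_
          rw [← sq]
          exact ENNReal.rpow_le_rpow (hC τ (uIoc_subset_uIcc hτ)) (by norm_num)
      _ = (ENNReal.ofReal |t - s| * C) ^ (2 : ℝ) := by
          rw [lintegral_const, hvol, ENNReal.mul_rpow_of_nonneg _ _ (by norm_num)]
          rw [ENNReal.rpow_two, ENNReal.rpow_two]
          ring
  rw [← sq] at h2
  exact (ENNReal.rpow_le_rpow_iff (by norm_num)).1 h2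

/-- The remainder at `s` is the integral of `k τ - k s` over `τ` between `s` and `t`. Minkowski's
inequality bounds it by `|t - s|` times the oscillation of `k` near `s`. -/
lemma hasDerivWithinAt_toLp {μ : Measure ℝ} [SFinite μ] {I : Set ℝ} {h k : ℝ → ℝ → ℝ}
    (hh : ∀ t, MemLp (h t) 2 μ) (hk : L2Continuous μ k)
    (hkm : Measurable (Function.uncurry k))
    (hki : ∀ r s t, IntervalIntegrable (fun τ => k τ r) volume s t)
    (hint : ∀ᵐ r ∂μ, ∀ s ∈ I, ∀ t ∈ I, h t r - h s r = ∫ τ in s..t, k τ r) {s : ℝ} (hs : s ∈ I) :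
    HasDerivWithinAt (fun t => (hh t).toLp (h t)) ((hk.1 s).toLp (k s)) I s := by
  rw [hasDerivWithinAt_iff_isLittleO, Asymptotics.isLittleO_iff]
  intro ε hε
  obtain ⟨δ, hδ, hball⟩ := Metric.eventually_nhds_iff.1
    (ENNReal.tendsto_nhds_zero.1 (hk.2 s) (ENNReal.ofReal ε) (ENNReal.ofReal_pos.2 hε))
  filter_upwards [self_mem_nhdsWithin, mem_nhdsWithin_of_mem_nhds (Metric.ball_mem_nhds s hδ)]
    with t ht htδ
  rw [← MemLp.toLp_const_smul, ← MemLp.toLp_sub, ← MemLp.toLp_sub, Lp.norm_toLp]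
  refine ENNReal.toReal_le_of_le_ofReal (by positivity) ?_
  have e : (h t - h s - (t - s) • k s) =ᵐ[μ] fun r => ∫ τ in s..t, (k τ r - k s r) := by
    filter_upwards [hint] with r hr
    simp only [Pi.sub_apply, Pi.smul_apply, smul_eq_mul]
    rw [hr s hs t ht, intervalIntegral.integral_sub (hki r s t) intervalIntegrable_const,
      intervalIntegral.integral_const, smul_eq_mul]
  rw [eLpNorm_congr_ae e]
  refine (eLpNorm_intervalIntegral_le (k := fun τ r => k τ r - k s r) (C := ENNReal.ofReal ε)
    ?_ fun τ hτ => ?_).trans_eq ?_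
  · exact hkm.sub (hkm.comp (by fun_prop : Measurable fun p : ℝ × ℝ => (s, p.2)))
  · refine hball ((?_ : dist τ s ≤ dist t s).trans_lt htδ)
    rw [Real.dist_eq, Real.dist_eq, abs_sub_comm τ s, abs_sub_comm t s]
    rw [abs_sub_comm s τ, abs_sub_comm s t]
    exact abs_sub_left_of_mem_uIcc hτ
  · rw [← ENNReal.ofReal_mul (abs_nonneg _), mul_comm, Real.norm_eq_abs]

end SliceDerivative

/-! ### The wave cut off at the front. -/

section WaveSlices

variable {a b : ℝ → ℝ} {K M : ℝ} {Φ : ℝ × ℝ → ℝ}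

lemma wave_sub_space (ha : IsH1 a) (hb : IsH1 b) (hS : IsSource K M Φ) (t x y : ℝ) :
    wave a b Φ (t, y) - wave a b Φ (t, x) = ∫ r in x..y, waveDir a b Φ (0, 1) (t, r) := by
  have h := wave_sub ha hb hS (0, 1) (t, y) (y - x)
  have e : ∀ τ : ℝ, (t, y) - τ • ((0, 1) : ℝ × ℝ) = (t, y - τ) := fun τ => by ext <;> simp
  simp only [lineInt, e] at h
  rw [intervalIntegral.integral_comp_sub_left (fun r => waveDir a b Φ (0, 1) (t, r))] at h
  simpa using h

lemma wave_sub_time (ha : IsH1 a) (hb : IsH1 b) (hS : IsSource K M Φ) (r s t : ℝ) :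
    wave a b Φ (t, r) - wave a b Φ (s, r) = ∫ τ in s..t, waveDir a b Φ (1, 0) (τ, r) := by
  have h := wave_sub ha hb hS (1, 0) (t, r) (t - s)
  have e : ∀ τ : ℝ, (t, r) - τ • ((1, 0) : ℝ × ℝ) = (t - τ, r) := fun τ => by ext <;> simp
  simp only [lineInt, e] at h
  rw [intervalIntegral.integral_comp_sub_left (fun τ => waveDir a b Φ (1, 0) (τ, r))] at h
  simpa using h

lemma intervalIntegrable_waveDir_time (ha : IsH1 a) (hb : IsH1 b) (hS : IsSource K M Φ)
    (v : ℝ × ℝ) (r s t : ℝ) :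
    IntervalIntegrable (fun τ => waveDir a b Φ v (τ, r)) volume s t := by
  have h1 : IntervalIntegrable (fun τ => deriv a (τ - r)) volume s t := by
    simpa using (ha.intervalIntegrable_deriv (s - r) (t - r)).comp_sub_right r
  have h2 : IntervalIntegrable (fun τ => deriv b (τ + r)) volume s t := by
    simpa using (hb.intervalIntegrable_deriv (s + r) (t + r)).comp_add_right r
  have h3 : Continuous fun τ : ℝ => rowInt Φ (τ - r) (τ + r) :=
    hS.continuous_rowInt.comp (f := fun τ : ℝ => (τ - r, τ + r)) (by fun_prop)
  have h4 : Continuous fun τ : ℝ => colInt Φ (τ - r) (τ + r) :=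
    hS.continuous_colInt.comp (f := fun τ : ℝ => (τ - r, τ + r)) (by fun_prop)
  exact ((h1.add (h3.intervalIntegrable _ _)).const_mul _).add
    ((h2.add (h4.intervalIntegrable _ _)).const_mul _)

lemma integral_indicator_Iic_eq (g : ℝ → ℝ) (c : ℝ) {x y : ℝ} (hxy : x ≤ y) :
    ∫ r in x..y, (Iic c).indicator g r = ∫ r in min x c..min y c, g r := by
  rw [intervalIntegral.integral_of_le hxy,
    intervalIntegral.integral_of_le (min_le_min_right c hxy),
    setIntegral_indicator measurableSet_Iic]
  congr 2
  ext r
  simp only [mem_inter_iff, mem_Ioc, mem_Iic, min_lt_iff, le_min_iff]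
  constructor
  · rintro ⟨⟨h1, h2⟩, h3⟩
    exact ⟨Or.inl h1, h2, h3⟩
  · rintro ⟨h1 | h1, h2, h3⟩
    · exact ⟨⟨h1, h2⟩, h3⟩
    · exact absurd h3 (not_le.2 h1)

variable {T R ρ₀ α : ℝ} {ρ z h₀ h₁ : ℝ → ℝ}

lemma indicator_closedDomain {u : ℝ × ℝ → ℝ} {t r : ℝ} (ht : t ∈ Icc 0 T) (hr : 0 ≤ r) :
    (closedDomain T ρ).indicator u (t, r) =
      (Iic (extendFront T ρ t)).indicator (fun r => u (t, r)) r := by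
  by_cases h : r ≤ extendFront T ρ t
  · rw [indicator_of_mem (show (t, r) ∈ closedDomain T ρ from ⟨ht.1, ht.2, hr, h⟩),
      indicator_of_mem (show r ∈ Iic _ from h)]
  · rw [indicator_of_notMem (show (t, r) ∉ closedDomain T ρ from fun h' => h h'.2.2.2),
      indicator_of_notMem (show r ∉ Iic _ from h)]

/-- Vanishing on the front turns the extension by zero into a composition with `min r (q t)`, so the
cutoff adds no singular part to the derivatives. -/
lemma IsWave.indicator_eq_min (hw : IsWave T R ρ₀ α ρ z h₀ h₁ a b K M Φ) {t r : ℝ}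
    (ht : t ∈ Icc 0 T) :
    (Iic (extendFront T ρ t)).indicator (fun r => wave a b Φ (t, r)) r =
      wave a b Φ (t, min r (extendFront T ρ t)) := by
  by_cases h : r ≤ extendFront T ρ t
  · rw [indicator_of_mem (show r ∈ Iic _ from h), min_eq_left h]
  · rw [indicator_of_notMem (show r ∉ Iic _ from h), min_eq_right (not_le.1 h).le, hw.front t ht]

lemma IsWave.indicator_sub_space (hw : IsWave T R ρ₀ α ρ z h₀ h₁ a b K M Φ) {t x y : ℝ}
    (ht : t ∈ Icc 0 T) (hxy : x ≤ y) :
    (Iic (extendFront T ρ t)).indicator (fun r => wave a b Φ (t, r)) y -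
      (Iic (extendFront T ρ t)).indicator (fun r => wave a b Φ (t, r)) x =
      ∫ r in x..y, (Iic (extendFront T ρ t)).indicator (fun r => waveDir a b Φ (0, 1) (t, r)) r := by
  rw [hw.indicator_eq_min ht, hw.indicator_eq_min ht, integral_indicator_Iic_eq _ _ hxy,
    wave_sub_space hw.out_h1 hw.in_h1 hw.source]

lemma IsWave.indicator_sub_time_of_le (hw : IsWave T R ρ₀ α ρ z h₀ h₁ a b K M Φ)
    (hρ : IsFront T R ρ₀ ρ) (hT : 0 < T) (hρ₀ : 0 < ρ₀) {r s t : ℝ}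
    (hs : 0 ≤ s) (ht : t ≤ T) (hst : s ≤ t) :
    (Iic (extendFront T ρ t)).indicator (fun r => wave a b Φ (t, r)) r -
      (Iic (extendFront T ρ s)).indicator (fun r => wave a b Φ (s, r)) r =
      ∫ τ in s..t, (Iic (extendFront T ρ τ)).indicator
        (fun r => waveDir a b Φ (1, 0) (τ, r)) r := by
  have hq := hρ.isSlowFront hT hρ₀
  set q := extendFront T ρ with hqd
  have hsub : ∀ c, c ≤ t → r ≤ q c → ∫ τ in c..t, (Iic (q τ)).indicator
      (fun r => waveDir a b Φ (1, 0) (τ, r)) r = wave a b Φ (t, r) - wave a b Φ (c, r) := by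
    intro c hc hr
    rw [wave_sub_time hw.out_h1 hw.in_h1 hw.source]
    refine intervalIntegral.integral_congr fun τ hτ => ?_
    rw [uIcc_of_le hc] at hτ
    exact indicator_of_mem (show r ∈ Iic (q τ) from hr.trans (hq.mono hτ.1)) _
  by_cases h1 : r ≤ q s
  · rw [hsub s hst h1, indicator_of_mem (show r ∈ Iic (q t) from h1.trans (hq.mono hst)),
      indicator_of_mem (show r ∈ Iic (q s) from h1)]
  by_cases h2 : r ≤ q t
  · have hcomp : IsCompact (Icc s t ∩ q ⁻¹' Ici r) :=
      isCompact_Icc.inter_right (isClosed_Ici.preimage hq.continuous)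
    obtain ⟨c, ⟨⟨c1, c2⟩, c3⟩, hmin⟩ := hcomp.exists_isLeast ⟨t, ⟨hst, le_rfl⟩, h2⟩
    obtain ⟨c', ⟨d1, d2⟩, d3⟩ := intermediate_value_Icc c1 hq.continuous.continuousOn
      ⟨(not_le.1 h1).le, c3⟩
    have hcc : c ≤ c' := hmin ⟨⟨d1, d2.trans c2⟩, d3.ge⟩
    have hqc : q c = r := by rw [le_antisymm hcc d2, d3]
    have i1 := hsub c c2 hqc.ge
    have i0 : ∫ τ in s..c, (Iic (q τ)).indicator
        (fun r => waveDir a b Φ (1, 0) (τ, r)) r = 0 := by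
      refine intervalIntegral.integral_zero_ae ?_
      have hne : ∀ᵐ τ : ℝ, τ ≠ c := by simp [ae_iff, measure_singleton]
      filter_upwards [hne] with τ hτ hτ'
      rw [uIoc_of_le c1] at hτ'
      have hr : r ∉ Iic (q τ) := fun hr =>
        hτ (le_antisymm hτ'.2 (hmin ⟨⟨hτ'.1.le, hτ'.2.trans c2⟩, hr⟩))
      exact indicator_of_notMem hr _
    have hii : ∀ x y, IntervalIntegrable (fun τ => (Iic (q τ)).indicator
        (fun r => waveDir a b Φ (1, 0) (τ, r)) r) volume x y := by
      intro x y
      refine (intervalIntegrable_waveDir_time hw.out_h1 hw.in_h1 hw.source (1, 0) r x y).mono_fun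
        ?_ (ae_of_all _ fun τ => norm_indicator_le_norm_self _ _)
      have : Measurable (({p : ℝ × ℝ | p.2 ≤ q p.1}).indicator (waveDir a b Φ (1, 0))) :=
        (measurable_waveDir hw.source _).indicator
          (measurableSet_le measurable_snd (hq.continuous.measurable.comp measurable_fst))
      exact (this.comp (measurable_prodMk_right (y := r))).aestronglyMeasurable
    rw [← intervalIntegral.integral_add_adjacent_intervals (hii s c) (hii c t), i0, i1,
      indicator_of_mem (show r ∈ Iic (q t) from h2), indicator_of_notMem (show r ∉ Iic (q s) from h1)]
    have := hw.front c ⟨hs.trans c1, c2.trans ht⟩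
    rw [← hqd, hqc] at this
    rw [this]
    ring
  · rw [indicator_of_notMem (show r ∉ Iic (q t) from h2),
      indicator_of_notMem (show r ∉ Iic (q s) from h1), sub_zero, eq_comm]
    refine intervalIntegral.integral_zero_ae (ae_of_all _ fun τ hτ => ?_)
    rw [uIoc_of_le hst] at hτ
    have hr : r ∉ Iic (q τ) := fun hr : r ≤ q τ => h2 (hr.trans (hq.mono hτ.2))
    exact indicator_of_notMem hr _

end WaveSlices

end Debonding

namespace Debonding

/-! ### Regularity of the solution in time. -/

section WaveContinuity

variable {a b : ℝ → ℝ} {K M : ℝ} {Φ : ℝ × ℝ → ℝ} {T R ρ₀ α : ℝ} {ρ z h₀ h₁ : ℝ → ℝ}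

lemma IsWave.indicator_sub_time (hw : IsWave T R ρ₀ α ρ z h₀ h₁ a b K M Φ)
    (hρ : IsFront T R ρ₀ ρ) (hT : 0 < T) (hρ₀ : 0 < ρ₀) {r s t : ℝ}
    (hs : s ∈ Icc 0 T) (ht : t ∈ Icc 0 T) :
    (Iic (extendFront T ρ t)).indicator (fun r => wave a b Φ (t, r)) r -
      (Iic (extendFront T ρ s)).indicator (fun r => wave a b Φ (s, r)) r =
      ∫ τ in s..t, (Iic (extendFront T ρ τ)).indicator
        (fun r => waveDir a b Φ (1, 0) (τ, r)) r := by
  rcases le_total s t with h | h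
  · exact hw.indicator_sub_time_of_le hρ hT hρ₀ hs.1 ht.2 h
  · rw [intervalIntegral.integral_symm, ← hw.indicator_sub_time_of_le hρ hT hρ₀ ht.1 hs.2 h,
      neg_sub]

lemma measurable_indicator_front {q : ℝ → ℝ} (hq : Continuous q) {u : ℝ × ℝ → ℝ}
    (hu : Measurable u) :
    Measurable (Function.uncurry fun t r => (Iic (q t)).indicator (fun r => u (t, r)) r) :=
  hu.indicator (measurableSet_le measurable_snd (hq.measurable.comp measurable_fst))

lemma l2Continuous_wave (ha : IsH1 a) (hb : IsH1 b) (hS : IsSource K M Φ) (A B : ℝ) :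
    L2Continuous (volume.restrict (Ioo A B)) fun t r => wave a b Φ (t, r) :=
  L2Continuous.of_continuous A B (continuous_wave ha hb hS)

lemma IsWave.inC0W12 (hw : IsWave T R ρ₀ α ρ z h₀ h₁ a b K M Φ) (hρ : IsFront T R ρ₀ ρ)
    (hT : 0 < T) (hρ₀ : 0 < ρ₀) :
    InC0W12 T R ((closedDomain T ρ).indicator (wave a b Φ)) := by
  have hq := hρ.isSlowFront hT hρ₀
  have k0 := (l2Continuous_wave hw.out_h1 hw.in_h1 hw.source 0 R).indicator_Iic hq.continuous
  have k1 := (l2Continuous_waveDir hw.out_h1 hw.in_h1 hw.source (0, 1) 0 R).indicator_Iic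
    hq.continuous
  refine ⟨fun t => (k0.1 t).toLp _, fun t => (k1.1 t).toLp _, k0.continuous_toLp.continuousOn,
    k1.continuous_toLp.continuousOn, fun t ht => ⟨?_, ?_⟩⟩
  · refine (k0.1 t).coeFn_toLp.trans ((ae_restrict_iff' measurableSet_Ioo).2
      (ae_of_all _ fun r hr => ?_))
    exact (indicator_closedDomain ht hr.1.le).symm
  · set f := (Iic (extendFront T ρ t)).indicator fun r => wave a b Φ (t, r) with hf
    set g := (Iic (extendFront T ρ t)).indicator fun r => waveDir a b Φ (0, 1) (t, r) with hg
    have key : HasWeakDeriv (Ioo 0 R) 1 f g := by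
      refine hasWeakDeriv_of_sub_eq_lineInt isOpen_Ioo ((k0.1 t).integrable (by norm_num))
        ((k1.1 t).integrable (by norm_num)) fun x s hs _ => ?_
      rw [smul_eq_mul, mul_one, hw.indicator_sub_space ht (by linarith : x - s ≤ x), lineInt]
      simp only [smul_eq_mul, mul_one]
      rw [intervalIntegral.integral_comp_sub_left]
      simp only [sub_zero]
      rfl
    intro φ hφ
    have e1 : ∫ r in Ioo 0 R, (closedDomain T ρ).indicator (wave a b Φ) (t, r) * dirDeriv 1 φ r =
        ∫ r in Ioo 0 R, f r * dirDeriv 1 φ r :=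
      setIntegral_congr_fun measurableSet_Ioo fun r hr => by
        simp only [indicator_closedDomain ht hr.1.le, hf]
    have e2 : ∫ r in Ioo 0 R, ((k1.1 t).toLp _ : ℝ → ℝ) r * φ r = ∫ r in Ioo 0 R, g r * φ r := by
      refine integral_congr_ae ?_
      filter_upwards [(k1.1 t).coeFn_toLp] with r hr
      rw [hr]
    rw [e1, e2, key φ hφ]

lemma IsWave.inC1L2 (hw : IsWave T R ρ₀ α ρ z h₀ h₁ a b K M Φ) (hρ : IsFront T R ρ₀ ρ)
    (hT : 0 < T) (hρ₀ : 0 < ρ₀) :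
    InC1L2 T R ((closedDomain T ρ).indicator (wave a b Φ)) := by
  have hq := hρ.isSlowFront hT hρ₀
  have k0 := (l2Continuous_wave hw.out_h1 hw.in_h1 hw.source 0 R).indicator_Iic hq.continuous
  have k1 := (l2Continuous_waveDir hw.out_h1 hw.in_h1 hw.source (1, 0) 0 R).indicator_Iic
    hq.continuous
  have hm := measurable_indicator_front hq.continuous
    (measurable_waveDir (a := a) (b := b) hw.source (1, 0))
  refine ⟨fun t => (k0.1 t).toLp _, ?_, fun t ht => ?_⟩
  · have hder : ∀ s ∈ Icc 0 T, HasDerivWithinAt (fun t => (k0.1 t).toLp _) ((k1.1 s).toLp _)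
        (Icc 0 T) s := by
      intro s hs
      refine hasDerivWithinAt_toLp k0.1 k1 hm (fun r s t => ?_)
        (ae_of_all _ fun r s hs t ht => hw.indicator_sub_time hρ hT hρ₀ hs ht) hs
      refine (intervalIntegrable_waveDir_time hw.out_h1 hw.in_h1 hw.source (1, 0) r s t).mono_fun
        ?_ (ae_of_all _ fun τ => norm_indicator_le_norm_self _ _)
      exact (hm.comp (measurable_prodMk_right (y := r))).aestronglyMeasurable
    have hu := uniqueDiffOn_Icc hT
    rw [contDiffOn_one_iff_derivWithin hu]
    exact ⟨fun s hs => (hder s hs).differentiableWithinAt, k1.continuous_toLp.continuousOn.congr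
      fun s hs => (hder s hs).derivWithin (hu s hs)⟩
  · refine (k0.1 t).coeFn_toLp.trans ((ae_restrict_iff' measurableSet_Ioo).2
      (ae_of_all _ fun r hr => ?_))
    exact (indicator_closedDomain ht hr.1.le).symm

end WaveContinuity

end Debonding

namespace Debonding

/-! ### The representation formula. -/

section Representation

lemma integral_comp_char {f : ℝ × ℝ → ℝ} (hf : Measurable f) :
    ∫ p : ℝ × ℝ, f (p.1 - p.2, p.1 + p.2) = (1 / 2) * ∫ p, f p := by
  set L : ℝ × ℝ →ₗ[ℝ] ℝ × ℝ :=
    Matrix.toLin (Module.Basis.finTwoProd ℝ) (Module.Basis.finTwoProd ℝ) !![1, -1; 1, 1] with hL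
  have hLp : ∀ p, L p = (p.1 - p.2, p.1 + p.2) := fun p => by
    rw [hL, Matrix.toLin_finTwoProd_apply]
    ext <;> simp only <;> ring
  have hdet : LinearMap.det L = 2 := by
    rw [hL, LinearMap.det_toLin, Matrix.det_fin_two_of]
    norm_num
  have hmap := Measure.map_linearMap_addHaar_eq_smul_addHaar (volume : Measure (ℝ × ℝ))
    (f := L) (by rw [hdet]; norm_num)
  have hLm : Measurable L := L.continuous_of_finiteDimensional.measurable
  have h1 := integral_map (μ := (volume : Measure (ℝ × ℝ))) hLm.aemeasurable
    hf.aestronglyMeasurable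
  rw [hmap, integral_smul_measure, hdet] at h1
  simp only [hLp] at h1
  rw [← h1]
  norm_num

/-- The part of `Ω` in the quadrant of the characteristic coordinates with corner `(x, y)`. -/
def charQuadrant (T R : ℝ) (ρ : ℝ → ℝ) (x y : ℝ) : Set (ℝ × ℝ) :=
  {q ∈ Omega T R ρ | q.1 - q.2 ≤ x ∧ q.1 + q.2 ≤ y}

variable {a b : ℝ → ℝ} {K M : ℝ} {Φ : ℝ × ℝ → ℝ} {T R ρ₀ α : ℝ} {ρ z h₀ h₁ : ℝ → ℝ}

/-- The time constraints are redundant: `0 < q.1` in `Ω`, and adding the two characteristic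
inequalities gives `q.1 ≤ t`. Differences of cones become differences of nested quadrants. -/
lemma cone_eq_charQuadrant (T R : ℝ) (ρ : ℝ → ℝ) (t r : ℝ) :
    cone T R ρ t r = charQuadrant T R ρ (t - r) (t + r) := by
  ext q
  simp only [cone, charQuadrant, mem_ofPred_eq]
  constructor
  · rintro ⟨h, h1, h2, h3, h4⟩
    exact ⟨h, by linarith, by linarith⟩
  · rintro ⟨h, h1, h2⟩
    exact ⟨h, h.1.1.le, by linarith, by linarith, by linarith⟩

lemma charQuadrant_mono {x y x' y' : ℝ} (hx : x' ≤ x) (hy : y' ≤ y) :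
    charQuadrant T R ρ x' y' ⊆ charQuadrant T R ρ x y :=
  fun _ hq => ⟨hq.1, hq.2.1.trans hx, hq.2.2.trans hy⟩

lemma IsFront.measurableSet_charQuadrant (hρ : IsFront T R ρ₀ ρ) (hT : 0 < T) (hρ₀ : 0 < ρ₀)
    (x y : ℝ) : MeasurableSet (charQuadrant T R ρ x y) :=
  (hρ.isOpen_Omega hT hρ₀).measurableSet.inter
    ((measurableSet_le (measurable_fst.sub measurable_snd) measurable_const).inter
      (measurableSet_le (measurable_fst.add measurable_snd) measurable_const))

/-- The factor is the `1 / 4` of the source times the Jacobian `2` of the characteristic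
coordinates. -/
lemma IsWave.quadInt_eq (hw : IsWave T R ρ₀ α ρ z h₀ h₁ a b K M Φ) (hρ : IsFront T R ρ₀ ρ)
    (hT : 0 < T) (hρ₀ : 0 < ρ₀) (x y : ℝ) :
    quadInt Φ x y = (1 / 2) * ∫ q in charQuadrant T R ρ x y,
      potential α R q.2 * (closedDomain T ρ).indicator (wave a b Φ) q := by
  have hm : MeasurableSet (Iic x ×ˢ Iic y) := measurableSet_Iic.prod measurableSet_Iic
  have h1 := integral_comp_char (hw.source.measurable.indicator hm)
  rw [integral_indicator hm] at h1
  have h2 : (fun p : ℝ × ℝ => (Iic x ×ˢ Iic y).indicator Φ (p.1 - p.2, p.1 + p.2)) =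
      (charQuadrant T R ρ x y).indicator fun q => (1 / 4) * (potential α R q.2 *
        (closedDomain T ρ).indicator (wave a b Φ) q) := by
    ext p
    by_cases hp : p ∈ Omega T R ρ
    · by_cases hq : p.1 - p.2 ≤ x ∧ p.1 + p.2 ≤ y
      · rw [indicator_of_mem (show (p.1 - p.2, p.1 + p.2) ∈ Iic x ×ˢ Iic y from hq),
          indicator_of_mem (show p ∈ charQuadrant T R ρ x y from ⟨hp, hq⟩), hw.source_mem p hp,
          indicator_of_mem (Omega_subset_closedDomain hρ hp)]
      · rw [indicator_of_notMem (show (p.1 - p.2, p.1 + p.2) ∉ Iic x ×ˢ Iic y from hq),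
          indicator_of_notMem (show p ∉ charQuadrant T R ρ x y from fun h => hq h.2)]
    · rw [indicator_of_notMem (show p ∉ charQuadrant T R ρ x y from fun h => hp h.1)]
      exact indicator_apply_eq_zero.2 fun _ => hw.source_notMem p hp
  rw [h2, integral_indicator (hρ.measurableSet_charQuadrant hT hρ₀ x y), integral_const_mul] at h1
  rw [quadInt]
  linarith

lemma IsWave.integrableOn (hw : IsWave T R ρ₀ α ρ z h₀ h₁ a b K M Φ) (hρ : IsFront T R ρ₀ ρ)
    (hT : 0 < T) (hρ₀ : 0 < ρ₀) :
    IntegrableOn (fun q => potential α R q.2 * (closedDomain T ρ).indicator (wave a b Φ) q)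
      (Omega T R ρ) := by
  have hU := (hρ.isOpen_Omega hT hρ₀).measurableSet
  have : IsFiniteMeasure (volume.restrict (Omega T R ρ)) :=
    ⟨by simpa using hρ.volume_Omega_lt_top hT hρ₀⟩
  have h1 : IntegrableOn (fun p : ℝ × ℝ => 4 * Φ (p.1 - p.2, p.1 + p.2)) (Omega T R ρ) := by
    refine MemLp.integrable (q := 2) (by norm_num) (MemLp.of_bound
      ((hw.source.measurable.comp (by fun_prop)).const_mul _).aestronglyMeasurable (4 * M)
      (ae_of_all _ fun p => ?_))
    rw [norm_mul]
    norm_num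
    exact hw.source.bound _
  refine h1.congr_fun (fun p hp => ?_) hU
  simp only
  rw [hw.source_mem p hp, indicator_of_mem (Omega_subset_closedDomain hρ hp)]
  ring

lemma ae_fst_ne_snd : ∀ᵐ p : ℝ × ℝ, p.1 ≠ p.2 := by
  have h : ∀ᵐ x : ℝ, x ≠ 0 := by simp [ae_iff, measure_singleton]
  have := (Measure.quasiMeasurePreserving_fst.comp (measurePreserving_sub_prod
    (volume : Measure ℝ) (volume : Measure ℝ)).quasiMeasurePreserving).ae h
  filter_upwards [this] with p hp h'
  exact hp (sub_eq_zero.2 h')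

lemma ae_fst_add_snd_ne (c : ℝ) : ∀ᵐ p : ℝ × ℝ, p.1 + p.2 ≠ c := by
  have h : ∀ᵐ x : ℝ, x ≠ c := by simp [ae_iff, measure_singleton]
  exact (Measure.quasiMeasurePreserving_fst.comp (measurePreserving_add_prod
    (volume : Measure ℝ) (volume : Measure ℝ)).quasiMeasurePreserving).ae h

lemma IsFront.measurableSet_OmegaPrime (hρ : IsFront T R ρ₀ ρ) (hT : 0 < T) (hρ₀ : 0 < ρ₀) :
    MeasurableSet (OmegaPrime T R ρ₀ ρ) := by
  have hU := (hρ.isOpen_Omega hT hρ₀).measurableSet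
  have h1 : Measurable fun p : ℝ × ℝ => p.1 := measurable_fst
  have h2 : Measurable fun p : ℝ × ℝ => p.2 := measurable_snd
  exact ((hU.inter ((measurableSet_le h1 h2).inter
    (measurableSet_le (h1.add h2) measurable_const))).union (hU.inter ((measurableSet_lt h2 h1).inter
    (measurableSet_lt (h1.add h2) measurable_const)))).union (hU.inter ((measurableSet_lt h1 h2).inter
    (measurableSet_lt measurable_const (h1.add h2))))

theorem IsWave.representationFormula (hw : IsWave T R ρ₀ α ρ z h₀ h₁ a b K M Φ)
    (hρ : IsFront T R ρ₀ ρ) (hT : 0 < T) (hρ₀ : 0 < ρ₀)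
    (hh₁ : MemLp h₁ 2 (volume.restrict (Ioo 0 ρ₀))) :
    RepresentationFormula T R ρ₀ α ρ z h₀ h₁ ((closedDomain T ρ).indicator (wave a b Φ)) := by
  have hq := hρ.isSlowFront hT hρ₀
  have hI := hw.integrableOn hρ hT hρ₀
  have ii : ∀ x ∈ Icc 0 ρ₀, IntervalIntegrable h₁ volume 0 x := fun x hx => by
    rw [intervalIntegrable_iff_integrableOn_Ioo_of_le hx.1]
    exact IntegrableOn.mono_set (t := Ioo 0 ρ₀) (hh₁.integrable (by norm_num))
      (Ioo_subset_Ioo le_rfl hx.2)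
  have hsub : ∀ x ∈ Icc 0 ρ₀, ∀ y ∈ Icc 0 ρ₀,
      ∫ s in x..y, h₁ s = (∫ s in 0..y, h₁ s) - ∫ s in 0..x, h₁ s := fun x hx y hy =>
    (intervalIntegral.integral_interval_sub_left (ii y hy) (ii x hx)).symm
  have hdiff : ∀ {x y x' y' : ℝ}, x' ≤ x → y' ≤ y →
      (1 / 2) * ∫ q in charQuadrant T R ρ x y \ charQuadrant T R ρ x' y',
        potential α R q.2 * (closedDomain T ρ).indicator (wave a b Φ) q =
      quadInt Φ x y - quadInt Φ x' y' := by
    intro x y x' y' hx hy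
    rw [setIntegral_sdiff (hρ.measurableSet_charQuadrant hT hρ₀ x' y') (hI.mono_set fun q h => h.1)
      (charQuadrant_mono hx hy), hw.quadInt_eq hρ hT hρ₀, hw.quadInt_eq hρ hT hρ₀]
    ring
  refine (ae_restrict_iff' (hρ.measurableSet_OmegaPrime hT hρ₀)).2 ?_
  -- `Omega1` contains parts of the lines `t = r` and `t + r = ρ₀`, where `regionP` takes its
  -- default value `∅`; both lines are null.
  filter_upwards [ae_fst_ne_snd, ae_fst_add_snd_ne ρ₀]
  rintro ⟨t, r⟩ n1 n2 hp
  simp only at n1 n2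
  have hΩ : (t, r) ∈ Omega T R ρ := by
    rcases hp with (h | h) | h <;> exact h.1
  obtain ⟨p1, p2, p3, p4⟩ := hρ.mem_Omega.1 hΩ
  simp only at p1 p2 p3 p4
  rw [indicator_of_mem (Omega_subset_closedDomain hρ hΩ)]
  have hreg : regionP T R ρ₀ ρ t r ⊆ Omega T R ρ := by
    rw [regionP]
    split_ifs
    · exact fun q h => h.1
    · exact fun q h => h.1.1
    · exact fun q h => h.1.1
    · exact empty_subset _
  refine ⟨hI.mono_set hreg, ?_⟩
  rcases hp with (h | h) | h
  · have k1 : t < r := lt_of_le_of_ne h.2.1 n1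
    have k2 : t + r < ρ₀ := lt_of_le_of_ne h.2.2 n2
    have m1 : r - t ∈ Icc 0 ρ₀ := ⟨by linarith, by linarith⟩
    have m2 : t + r ∈ Icc 0 ρ₀ := ⟨by linarith, by linarith⟩
    have e1 := hw.out_eq _ m1
    rw [neg_sub] at e1
    rw [dAlembert, if_pos h, regionP, if_pos ⟨k1, k2⟩, cone_eq_charQuadrant,
      ← hw.quadInt_eq hρ hT hρ₀, wave]
    simp only
    rw [e1, hw.in_eq _ m2, add_comm r t, hsub _ m1 _ m2]
    ring
  -- The outgoing profile at `t - r > 0` is eliminated by the condition on `r = 0` at time `t - r`.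
  -- This brings in `z`, the incoming profile at `t - r`, and the quadrant with corner `(t - r, t -
  -- r)`, which is the cone removed from `P`.
  · have k1 : r < t := h.2.1
    have k2 : t + r < ρ₀ := h.2.2
    have m1 : t - r ∈ Icc 0 ρ₀ := ⟨by linarith, by linarith⟩
    have m2 : t + r ∈ Icc 0 ρ₀ := ⟨by linarith, by linarith⟩
    have h' : (t, r) ∉ Omega1 T R ρ₀ ρ := fun h => absurd h.2.1 (not_le.2 k1)
    have e1 := hw.left (t - r) ⟨by linarith, by linarith⟩
    rw [wave] at e1
    simp only [sub_zero, add_zero] at e1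
    have e2 := hw.in_eq _ m1
    rw [dAlembert, if_neg h', if_pos h, regionP, if_neg (fun h => absurd h.1 k1.not_gt),
      if_pos ⟨k1, k2⟩, cone_eq_charQuadrant, cone_eq_charQuadrant, hdiff (by linarith)
      (by linarith), wave]
    simp only [sub_zero, add_zero]
    rw [hw.in_eq _ m2, add_comm r t, hsub _ m1 _ m2]
    linarith
  -- The incoming profile at `t + r > ρ₀` is eliminated by the front condition at the hitting time
  -- `θ`. The outgoing profile at `ω' ≥ -ρ₀` is given by the initial data, and the quadrant with
  -- corner `(ω', t + r)` is the cone of the point of reflection.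
  · have k1 : t < r := h.2.1
    have k2 : ρ₀ < t + r := h.2.2
    have h' : (t, r) ∉ Omega1 T R ρ₀ ρ := fun h => absurd h.2.2 (not_le.2 k2)
    have h'' : (t, r) ∉ Omega2 T R ρ₀ ρ := fun h => absurd h.2.1 k1.not_gt
    have k3 : t + r ≤ T + ρ T := by
      have := hρ.extendFront_le hT hρ₀ t
      linarith
    obtain ⟨e1, e2⟩ := psiInv_eq hρ hT hρ₀ k2.le k3
    have e3 := omega_eq hρ hT hρ₀ k2.le k3
    have e4 := hw.front _ e2
    set θ := hitTime (extendFront T ρ) (t + r) with hθ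
    set ω' := reflect (extendFront T ρ) (t + r) with hω'
    have e5 : θ + extendFront T ρ θ = t + r := hq.hitTime_add _
    have e6 : θ - extendFront T ρ θ = ω' := rfl
    have k4 : ω' < t - r := (hq.lt_iff_reflect_lt t r).1 p4
    have k5 : -ρ₀ ≤ ω' := by
      rw [← reflect_initial hρ hT hρ₀]
      exact hq.reflect_mono k2.le
    have m1 : r - t ∈ Icc 0 ρ₀ := ⟨by linarith, by linarith⟩
    have m2 : -ω' ∈ Icc 0 ρ₀ := ⟨by linarith, by linarith⟩
    have e7 := hw.out_eq _ m1
    have e8 := hw.out_eq _ m2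
    rw [neg_sub] at e7
    rw [neg_neg] at e8
    rw [wave] at e4
    simp only [e5, e6] at e4
    rw [dAlembert, if_neg h', if_neg h'', if_pos h, regionP,
      if_neg (fun h => absurd h.2 k2.not_gt), if_neg (fun h => absurd h.2 k2.not_gt),
      if_pos ⟨k1, k2⟩, e1, ← extendFront_of_mem (ρ := ρ) e2, cone_eq_charQuadrant,
      cone_eq_charQuadrant, e5, e6, hdiff k4.le le_rfl, wave]
    simp only
    rw [add_comm r t, e3, hsub _ m1 _ m2, e7]
    linarith

end Representation

end Debonding

end

/-- In the conclusion `h` is the continuous representative, extended by zero outside the closure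
of `Ω`; `z` and `h₀` are the continuous representatives of the `W^{1,2}` data. -/
theorem theorem1p4 (T R ρ₀ α : ℝ) (hT : 0 < T) (hρ₀ : 0 < ρ₀) (hR : ρ₀ < R) (hα : 0 ≤ α)
    (ρ : ℝ → ℝ) (hρ : Debonding.IsFront T R ρ₀ ρ)
    (z h₀ h₁ : ℝ → ℝ)
    (hz : Debonding.MemW12Interval 0 T z) (hzc : ContinuousOn z (Icc 0 T))
    (hh₀ : Debonding.MemW12Interval 0 ρ₀ h₀) (hh₀c : ContinuousOn h₀ (Icc 0 ρ₀))
    (hh₁ : MemLp h₁ 2 (volume.restrict (Ioo 0 ρ₀)))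
    (hcomp₀ : h₀ 0 = z 0) (hcomp₁ : h₀ ρ₀ = 0) :
    ∃ h : ℝ × ℝ → ℝ,
      Debonding.IsSolution T R ρ₀ α ρ z h₀ h₁ h ∧
      (∀ h' : ℝ × ℝ → ℝ, Debonding.IsSolution T R ρ₀ α ρ z h₀ h₁ h' →
        h' =ᵐ[volume.restrict (Debonding.Omega T R ρ)] h) ∧
      Debonding.RepresentationFormula T R ρ₀ α ρ z h₀ h₁ h ∧
      ContinuousOn h (closure (Debonding.Omega T R ρ)) ∧
      (∀ p, p ∉ closure (Debonding.Omega T R ρ) → h p = 0) ∧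
      Debonding.InC0W12 T R h ∧
      Debonding.InC1L2 T R h := by
  obtain ⟨a, b, K, M, Φ, hw⟩ := hρ.exists_isWave hT hρ₀ α hz hzc hh₀ hh₀c hh₁ hcomp₀ hcomp₁
  have hs := hw.isSolution hρ hT hρ₀ hh₁
  have hcl := hρ.closure_Omega hT hρ₀
  refine ⟨(Debonding.closedDomain T ρ).indicator (Debonding.wave a b Φ), hs,
    fun h' hs' => Debonding.IsSolution.unique hρ hT hρ₀ hz.1.1 hh₀.1.1 hh₁ hs hs',
    hw.representationFormula hρ hT hρ₀ hh₁, ?_, fun p hp => ?_,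
    hw.inC0W12 hρ hT hρ₀, hw.inC1L2 hρ hT hρ₀⟩
  · rw [hcl]
    exact (Debonding.continuous_wave hw.out_h1 hw.in_h1 hw.source).continuousOn.congr
      fun p hp => indicator_of_mem hp _
  · rw [hcl] at hp
    exact indicator_of_notMem hp _
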